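/- **Setting.** Let $f\in C^2(\mathbb R)$ with $f''$ bounded, $\varepsilon>0$, and let $f_\varepsilon$ be the piecewise affine interpolation of $f$ at the points of $\varepsilon\mathbb Z$. Let $\bar u:\mathbb R\to\mathbb R$ have bounded variation, and let $\bar u_\varepsilon$ be a right continuous, piecewise constant function with compact support and values in $\varepsilon\mathbb Z$ such that $\mathrm{TV}(\bar u_\varepsilon)\le \mathrm{TV}(\bar u)$. Write $\mathrm{conv}_{[a,b]}g$ and $\mathrm{conc}_{[a,b]}g$ for the convex and concave envelopes of $g$ in $[a,b]$. Let $u_\varepsilon$ be the wavefront tracking solution with flux $f_\varepsilon$ and initial datum $\bar u_\varepsilon$: at time $0$, and again at each time when wavefronts collide, the Riemann problems at the discontinuities are solved with flux $f_\varepsilon$, and the resulting wavefronts travel along straight lines until the next collision. Let $0=t_0<t_1<t_2<\dots$, where $t_1,t_2,\dots$ are the collision times. Assume that at each $t_j$, $j\ge1$, exactly two wavefronts collide, at the point $x_j$. The point $(t_j,x_j)$ is a *cancellation point* if the two colliding wavefronts have opposite signs (the sign of a wavefront is the sign of its jump). The amount of cancellation is $$\mathcal C(t_j,x_j)=\mathrm{TV}(u_\varepsilon(t_{j-1},\cdot))-\mathrm{TV}(u_\varepsilon(t_j,\cdot)).$$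 **Waves.** Put $U(x)=\mathrm{TV}(\bar u_\varepsilon;(-\infty,x])$ and $\mathcal W=\{1,\dots,\tfrac1\varepsilon\mathrm{TV}(\bar u_\varepsilon)\}$. For $s\in\mathcal W$ put $$\mathtt x(0,s)=\inf\{x:\varepsilon s\le U(x)\},\qquad \mathcal S(s)=\mathrm{sign}\big[\bar u_\varepsilon(\mathtt x(0,s))-\bar u_\varepsilon(\mathtt x(0,s)-)\big],$$ $$\hat u(s)=\bar u_\varepsilon(\mathtt x(0,s)-)+\mathcal S(s)\big[\varepsilon s-U(\mathtt x(0,s)-)\big].$$ The position $\mathtt x(t,s)\in(-\infty,+\infty]$ of the wave $s$ is defined inductively. From $t_j$ up to the next collision time a wave with finite position $x=\mathtt x(t_j,s)$ moves with constant speed. With $u^-=u_\varepsilon(t_j,x-)$ and $u^+=u_\varepsilon(t_j,x)$, this speed is the (constant) value of $\frac{d}{du}\mathrm{conv}_{[u^-,u^+]}f_\varepsilon$ on $(\hat u(s)-\varepsilon,\hat u(s))$ if $u^-<u^+$, and of $\frac{d}{du}\mathrm{conc}_{[u^+,u^-]}f_\varepsilon$ on $(\hat u(s),\hat u(s)+\varepsilon)$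 if $u^->u^+$. A wave that arrives at $x_{j+1}$ at time $t_{j+1}$ is kept if $$\mathcal S(s)u_\varepsilon(t_{j+1},x_{j+1}-)\le\mathcal S(s)\hat u(s)-\varepsilon\quad\text{and}\quad\mathcal S(s)\hat u(s)\le \mathcal S(s)u_\varepsilon(t_{j+1},x_{j+1}).$$ Otherwise it is removed: its position is $+\infty$ from $t_{j+1}$ on. Let $\mathcal W(t)=\{s\in\mathcal W:\mathtt x(t,s)<+\infty\}$. **The functional.** Waves $s,s'\in\mathcal W(t)$ *have already interacted* at time $t$ if $\mathtt x(r,s)=\mathtt x(r,s')$ for some $r\in[0,t]$. Let $\mathcal I(t,s,s')$ be the set of all $p\in\mathcal W(t)$ that have already interacted at time $t$ both with $s$ and with $s'$. Let $I$ be the interval $\bigcup_{p\in\mathcal I(t,s,s')}(\hat u(p)-\varepsilon,\hat u(p)]$ if these waves are positive, and $\bigcup_{p\in\mathcal I(t,s,s')}[\hat u(p),\hat u(p)+\varepsilon)$ if they are negative. For $r\in\{s,s'\}$ let $\sigma(\mathcal I(t,s,s'),r)$ be the value of $\frac{d}{du}\mathrm{conv}_{I}f_\varepsilon$ on $(\hat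 u(r)-\varepsilon,\hat u(r))$ in the positive case, and of $\frac{d}{du}\mathrm{conc}_{I}f_\varepsilon$ on $(\hat u(r),\hat u(r)+\varepsilon)$ in the negative case. For $s<s'$ in $\mathcal W(t)$ put $$\mathfrak q(t,s,s')=\begin{cases}\dfrac{|\sigma(\mathcal I(t,s,s'),s')-\sigma(\mathcal I(t,s,s'),s)|}{|\hat u(s')-(\hat u(s)-\mathcal S(s)\varepsilon)|}&\text{if } s,s' \text{ have already interacted at time } t,\\[2mm] \|f''\|_{L^\infty}&\text{otherwise,}\end{cases}$$ and $$\mathfrak Q(t)=\sum_{\substack{s,s'\in\mathcal W(t)\\ s<s'}}\mathfrak q(t,s,s')\,\varepsilon^2.$$ **Theorem.** If $(t_j,x_j)$, $j\ge1$, is a cancellation point, then $$\mathfrak Q(t_j)-\mathfrak Q(t_{j-1})\le \log(2)\,\|f''\|_{L^\infty}\,\mathrm{TV}(\bar u)\,\mathcal C(t_j,x_j).$$ -/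

import Mathlib

open Set Filter Topology

noncomputable section

namespace WFT

/-! ### Convex and concave envelopes, piecewise affine interpolation -/

/-- The convex envelope of `g` in the interval `[a, b]`, evaluated at `u`. -/
def convEnv (g : ℝ → ℝ) (a b u : ℝ) : ℝ :=
  sSup {y : ℝ | ∃ h : ℝ → ℝ, ConvexOn ℝ (Icc a b) h ∧ (∀ w ∈ Icc a b, h w ≤ g w) ∧ y = h u}

/-- The concave envelope of `g` in the interval `[a, b]`, evaluated at `u`. -/
def concEnv (g : ℝ → ℝ) (a b u : ℝ) : ℝ :=
  sInf {y : ℝ | ∃ h : ℝ → ℝ, ConcaveOn ℝ (Icc a b) h ∧ (∀ w ∈ Icc a b, g w ≤ h w) ∧ y = h u}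

/-- The piecewise affine interpolation `f_ε` of `f` with grid size `ε`: it is affine on each
`[mε, (m+1)ε]` and coincides with `f` at the points `mε`, `m ∈ ℤ`. -/
def interp (f : ℝ → ℝ) (ε u : ℝ) : ℝ :=
  f (⌊u / ε⌋ * ε) + (u - ⌊u / ε⌋ * ε) * ((f ((⌊u / ε⌋ + 1) * ε) - f (⌊u / ε⌋ * ε)) / ε)

/-- The `L^∞(ℝ)` norm of `f''` (for `f` of class `C²` the essential supremum of `|f''|` is its
supremum). -/
def secondDerivNorm (f : ℝ → ℝ) : ℝ := ⨆ u : ℝ, |iteratedDeriv 2 f u|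

/-- Total variation on `ℝ`. -/
def totVar (v : ℝ → ℝ) : ℝ := (eVariationOn v univ).toReal

/-! ### Riemann problems with flux `f_ε` -/

/-- The right states of the elementary waves of size `ε` in a jump from `uL` to `uR`: the points
of `εℤ` in `(uL, uR]` if `uL < uR`, in `[uR, uL)` if `uR < uL`, none if `uL = uR`. -/
def fanStates (ε uL uR : ℝ) : Set ℝ :=
  {w | (∃ m : ℤ, w = m * ε) ∧ ((uL < w ∧ w ≤ uR) ∨ (uR ≤ w ∧ w < uL))}

/-- The constant value on `(w - ε, w)` of the derivative of the convex envelope of `f_ε` in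
`[a, b]`. The envelope is affine on that cell, the derivative is taken at its midpoint. -/
def convSpeed (f : ℝ → ℝ) (ε a b w : ℝ) : ℝ := deriv (convEnv (interp f ε) a b) (w - ε / 2)

/-- The constant value on `(w, w + ε)` of the derivative of the concave envelope of `f_ε` in
`[a, b]`. -/
def concSpeed (f : ℝ → ℝ) (ε a b w : ℝ) : ℝ := deriv (concEnv (interp f ε) a b) (w + ε / 2)

/-- The speed given by the Riemann problem `(uL, uR)` to the elementary wave with right
state `w`. -/
def fanSpeed (f : ℝ → ℝ) (ε uL uR w : ℝ) : ℝ :=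
  if uL < uR then convSpeed f ε uL uR w else concSpeed f ε uR uL w

/-- The entropy solution at time `τ` of the Riemann problem `(uL, uR)` with flux `f_ε` and jump
at the origin, right continuous in `y`: the elementary wave with right state `w` lies at
`fanSpeed w * τ`, and crossing it changes the value by `±ε`. -/
def riemannSol (f : ℝ → ℝ) (ε uL uR τ y : ℝ) : ℝ :=
  uL + Real.sign (uR - uL) * (ε * ({w ∈ fanStates ε uL uR | fanSpeed f ε uL uR w * τ ≤ y}.ncard))

/-! ### Wavefronts and the wavefront tracking solution

A profile `v : ℝ → ℝ` is a right continuous, piecewise constant function of compact support. -/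

/-- The jump of `v` at `x`. -/
def jump (v : ℝ → ℝ) (x : ℝ) : ℝ := v x - Function.leftLim v x

/-- The wavefronts that emerge from the discontinuities of the profile `v`: pairs
(starting point, speed). -/
def fronts (f : ℝ → ℝ) (ε : ℝ) (v : ℝ → ℝ) : Set (ℝ × ℝ) :=
  {p | ∃ w ∈ fanStates ε (Function.leftLim v p.1) (v p.1),
    fanSpeed f ε (Function.leftLim v p.1) (v p.1) w = p.2}

/-- The delays `τ > 0` at which two different wavefronts emerging from `v`, prolonged along
straight lines, are at the same place. -/
def collisionDelays (f : ℝ → ℝ) (ε : ℝ) (v : ℝ → ℝ) : Set ℝ :=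
  {τ | 0 < τ ∧ ∃ p ∈ fronts f ε v, ∃ q ∈ fronts f ε v, p ≠ q ∧ p.1 + p.2 * τ = q.1 + q.2 * τ}

/-- The delay after which the first collision occurs (`0` if there is none). -/
def nextDelay (f : ℝ → ℝ) (ε : ℝ) (v : ℝ → ℝ) : ℝ := sInf (collisionDelays f ε v)

/-- The wavefronts emerging from `v` that take part in a collision at the first collision time. -/
def collidingFronts (f : ℝ → ℝ) (ε : ℝ) (v : ℝ → ℝ) : Set (ℝ × ℝ) :=
  {p ∈ fronts f ε v | ∃ q ∈ fronts f ε v, p ≠ q ∧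
    p.1 + p.2 * nextDelay f ε v = q.1 + q.2 * nextDelay f ε v}

/-- The solution with initial profile `v` after a delay `τ ≥ 0` not beyond the first collision:
the Riemann solutions at the discontinuities of `v`, glued together. As `v` vanishes near `-∞`,
the glued function is the sum of the increments of the Riemann solutions. -/
def evolve (f : ℝ → ℝ) (ε : ℝ) (v : ℝ → ℝ) (τ x : ℝ) : ℝ :=
  ∑ᶠ ξ : ℝ, (riemannSol f ε (Function.leftLim v ξ) (v ξ) τ (x - ξ) - Function.leftLim v ξ)

/-- `profile j = u_ε(t_j, ·)`, where `t_0 = 0` and `t_1 < t_2 < …` are the collision times (after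
the last collision the sequence is constant): at each collision time all the Riemann problems
are solved anew. -/
def profile (f : ℝ → ℝ) (ε : ℝ) (u₀ : ℝ → ℝ) : ℕ → ℝ → ℝ
  | 0 => u₀
  | j + 1 => evolve f ε (profile f ε u₀ j) (nextDelay f ε (profile f ε u₀ j))

/-- The collision time `t_j`, with `t_0 = 0`. -/
def time (f : ℝ → ℝ) (ε : ℝ) (u₀ : ℝ → ℝ) (j : ℕ) : ℝ :=
  ∑ i ∈ Finset.range j, nextDelay f ε (profile f ε u₀ i)

/-- The collision number `j + 1` occurs, i.e. there is a collision after `t_j`. -/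
def HasCollision (f : ℝ → ℝ) (ε : ℝ) (u₀ : ℝ → ℝ) (j : ℕ) : Prop :=
  (collisionDelays f ε (profile f ε u₀ j)).Nonempty

/-- The collision point `x_{j+1}`. -/
def collisionPoint (f : ℝ → ℝ) (ε : ℝ) (u₀ : ℝ → ℝ) (j : ℕ) : ℝ :=
  sInf ((fun p : ℝ × ℝ => p.1 + p.2 * nextDelay f ε (profile f ε u₀ j)) ''
    collidingFronts f ε (profile f ε u₀ j))

/-- Exactly two wavefronts collide at time `t_{j+1}`. -/
def IsBinaryCollision (f : ℝ → ℝ) (ε : ℝ) (u₀ : ℝ → ℝ) (j : ℕ) : Prop :=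
  (collidingFronts f ε (profile f ε u₀ j)).encard = 2

/-- `(t_{j+1}, x_{j+1})` is a cancellation point: the wavefronts which collide in it have
opposite signs. -/
def IsCancellation (f : ℝ → ℝ) (ε : ℝ) (u₀ : ℝ → ℝ) (j : ℕ) : Prop :=
  HasCollision f ε u₀ j ∧
    ∃ p ∈ collidingFronts f ε (profile f ε u₀ j), ∃ q ∈ collidingFronts f ε (profile f ε u₀ j),
      jump (profile f ε u₀ j) p.1 * jump (profile f ε u₀ j) q.1 < 0

/-- The number of collision times in `(0, t]`, i.e. the index `j` with `t_j ≤ t < t_{j+1}`. -/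
def collisionCount (f : ℝ → ℝ) (ε : ℝ) (u₀ : ℝ → ℝ) (t : ℝ) : ℕ :=
  {i : ℕ | HasCollision f ε u₀ i ∧ time f ε u₀ (i + 1) ≤ t}.ncard

/-- The wavefront tracking solution `u_ε(t, x)`, `t ≥ 0`, with initial datum `u₀`. -/
def sol (f : ℝ → ℝ) (ε : ℝ) (u₀ : ℝ → ℝ) (t x : ℝ) : ℝ :=
  evolve f ε (profile f ε u₀ (collisionCount f ε u₀ t))
    (t - time f ε u₀ (collisionCount f ε u₀ t)) x

/-- The amount of cancellation at `(t_{j+1}, x_{j+1})`. -/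
def cancellation (f : ℝ → ℝ) (ε : ℝ) (u₀ : ℝ → ℝ) (j : ℕ) : ℝ :=
  totVar (sol f ε u₀ (time f ε u₀ j)) - totVar (sol f ε u₀ (time f ε u₀ (j + 1)))

/-! ### Waves: enumeration at time `0`, position at later times -/

/-- The set of waves `{1, …, Tot.Var.(u₀) / ε}`. -/
def waves (ε : ℝ) (u₀ : ℝ → ℝ) : Finset ℕ := Finset.Icc 1 ⌊totVar u₀ / ε⌋₊

/-- The total variation function `U(x) = Tot.Var.(u₀; (-∞, x])`. -/
def varUpTo (u₀ : ℝ → ℝ) (x : ℝ) : ℝ := (eVariationOn u₀ (Iic x)).toReal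

/-- The initial position of the wave `s`. -/
def initPos (ε : ℝ) (u₀ : ℝ → ℝ) (s : ℕ) : ℝ := sInf {x : ℝ | ε * s ≤ varUpTo u₀ x}

/-- The sign of the wave `s`. -/
def waveSign (ε : ℝ) (u₀ : ℝ → ℝ) (s : ℕ) : ℝ := Real.sign (jump u₀ (initPos ε u₀ s))

/-- The right state `û(s)` of the wave `s`. -/
def rightState (ε : ℝ) (u₀ : ℝ → ℝ) (s : ℕ) : ℝ :=
  Function.leftLim u₀ (initPos ε u₀ s) +
    waveSign ε u₀ s * (ε * s - Function.leftLim (varUpTo u₀) (initPos ε u₀ s))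

/-- The speed given to the wave `s` by the Riemann problem that the profile `v` has at `p`. -/
def speedAt (f : ℝ → ℝ) (ε : ℝ) (u₀ v : ℝ → ℝ) (p : ℝ) (s : ℕ) : ℝ :=
  fanSpeed f ε (Function.leftLim v p) (v p) (rightState ε u₀ s)

/-- At time `t_{j+1}` the wave `s` is one of those that the profile retains at the collision
point. -/
def Survives (f : ℝ → ℝ) (ε : ℝ) (u₀ : ℝ → ℝ) (j s : ℕ) : Prop :=
  waveSign ε u₀ s * Function.leftLim (profile f ε u₀ (j + 1)) (collisionPoint f ε u₀ j)
      ≤ waveSign ε u₀ s * rightState ε u₀ s - ε ∧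
    waveSign ε u₀ s * rightState ε u₀ s
      ≤ waveSign ε u₀ s * profile f ε u₀ (j + 1) (collisionPoint f ε u₀ j)

open Classical in
/-- The position of the wave `s` at the collision time `t_j`; `⊤` means that the wave has been
removed by a cancellation. -/
def posAt (f : ℝ → ℝ) (ε : ℝ) (u₀ : ℝ → ℝ) : ℕ → ℕ → WithTop ℝ
  | 0, s => (initPos ε u₀ s : ℝ)
  | j + 1, s =>
    match posAt f ε u₀ j s with
    | ⊤ => ⊤
    | (p : ℝ) =>
      let y := p + speedAt f ε u₀ (profile f ε u₀ j) p s * nextDelay f ε (profile f ε u₀ j)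
      if y = collisionPoint f ε u₀ j ∧ HasCollision f ε u₀ j ∧ ¬ Survives f ε u₀ j s then ⊤
      else (y : ℝ)

/-- The position `x(t, s)` of the wave `s` at time `t ≥ 0`. -/
def pos (f : ℝ → ℝ) (ε : ℝ) (u₀ : ℝ → ℝ) (t : ℝ) (s : ℕ) : WithTop ℝ :=
  match posAt f ε u₀ (collisionCount f ε u₀ t) s with
  | ⊤ => ⊤
  | (p : ℝ) =>
    ((p + speedAt f ε u₀ (profile f ε u₀ (collisionCount f ε u₀ t)) p s *
      (t - time f ε u₀ (collisionCount f ε u₀ t)) : ℝ) : WithTop ℝ)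

open Classical in
/-- The set `W(t)` of the waves not yet removed at time `t`. -/
def realWaves (f : ℝ → ℝ) (ε : ℝ) (u₀ : ℝ → ℝ) (t : ℝ) : Finset ℕ :=
  (waves ε u₀).filter fun s => pos f ε u₀ t s ≠ ⊤

/-! ### The functional -/

/-- The waves `s`, `s'` have already interacted at time `t`. -/
def HaveInteracted (f : ℝ → ℝ) (ε : ℝ) (u₀ : ℝ → ℝ) (t : ℝ) (s s' : ℕ) : Prop :=
  s ∈ realWaves f ε u₀ t ∧ s' ∈ realWaves f ε u₀ t ∧
    ∃ r : ℝ, 0 ≤ r ∧ r ≤ t ∧ pos f ε u₀ r s = pos f ε u₀ r s'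

/-- The set `I(t, s, s')` of the waves present at time `t` that have already interacted both with
`s` and with `s'`. -/
def commonWaves (f : ℝ → ℝ) (ε : ℝ) (u₀ : ℝ → ℝ) (t : ℝ) (s s' : ℕ) : Set ℕ :=
  {p | HaveInteracted f ε u₀ t p s ∧ HaveInteracted f ε u₀ t p s'}

/-- The interval of values occupied by the wave `s`. -/
def cell (ε : ℝ) (u₀ : ℝ → ℝ) (s : ℕ) : Set ℝ :=
  if 0 < waveSign ε u₀ s then Ioc (rightState ε u₀ s - ε) (rightState ε u₀ s)
  else Ico (rightState ε u₀ s) (rightState ε u₀ s + ε)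

/-- The artificial speed `σ(K, s)` given to the wave `s` by the Riemann problem on the interval
`⋃_{p ∈ K} cell p`, for a set of waves `K`. -/
def artSpeed (f : ℝ → ℝ) (ε : ℝ) (u₀ : ℝ → ℝ) (K : Set ℕ) (s : ℕ) : ℝ :=
  let A := ⋃ p ∈ K, cell ε u₀ p
  if 0 < waveSign ε u₀ s then convSpeed f ε (sInf A) (sSup A) (rightState ε u₀ s)
  else concSpeed f ε (sInf A) (sSup A) (rightState ε u₀ s)

open Classical in
/-- The weight of the pair of waves `s < s'` at time `t`. -/
def weight (f : ℝ → ℝ) (ε : ℝ) (u₀ : ℝ → ℝ) (t : ℝ) (s s' : ℕ) : ℝ :=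
  if HaveInteracted f ε u₀ t s s' then
    |artSpeed f ε u₀ (commonWaves f ε u₀ t s s') s' -
        artSpeed f ε u₀ (commonWaves f ε u₀ t s s') s| /
      |rightState ε u₀ s' - (rightState ε u₀ s - waveSign ε u₀ s * ε)|
  else secondDerivNorm f

/-- The functional `Q(t)`; every wave has strength `ε`. -/
def Q (f : ℝ → ℝ) (ε : ℝ) (u₀ : ℝ → ℝ) (t : ℝ) : ℝ :=
  ∑ p ∈ (realWaves f ε u₀ t ×ˢ realWaves f ε u₀ t).filter (fun p => p.1 < p.2),
    weight f ε u₀ t p.1 p.2 * ε * ε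

/-- `u₀` is an admissible discretization with step `ε` of the initial datum `ubar`: it has compact
support, takes values in `εℤ`, is right continuous (hence, its variation being finite,
piecewise constant), and its total variation does not exceed that of `ubar`. -/
structure IsDiscretization (ε : ℝ) (ubar u₀ : ℝ → ℝ) : Prop where
  compactSupport : HasCompactSupport u₀
  values : ∀ x, ∃ m : ℤ, u₀ x = m * ε
  rightCont : ∀ x, ContinuousWithinAt u₀ (Ici x) x
  variation_le : eVariationOn u₀ univ ≤ eVariationOn ubar univ

end WFT

end

/-!
The waves present after the `i`-th collision describe the profile completely: crossing the wave `s`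
changes the value by `ε` times its sign, and the right state of `s` is obtained by summing up the
signs of the waves up to `s` (`WFT.isConfig`). This reduces everything to a combinatorial system of
waves (`WFT.WaveSystem`, `WFT.waveSystem`) whose speeds are slopes of convex envelopes of sequences
on intervals of integers; negative waves are reflected to positive ones.

For waves `s < s'` that have interacted, the waves between them occupy contiguous cells, and the
weight of the pair is the difference of the artificial speeds divided by `ε` times the number of
waves from `s` to `s'` (`WFT.weight_eq`). The structural fact behind the estimate is that fronts
which have interacted in the past remain divided by the artificial Riemann problem: at the state
between two consecutive waves in different fronts the convex envelope on the cells of the common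
waves has a genuine kink (`WFT.WaveSystem.divided_of_not_sameFront`). Since envelopes on both sides
of a kink do not see each other, a cancellation raises weights only of pairs with a wave in the
surviving part `X` of the colliding fronts. If `X` is, say, what remains of the left front, then for
such a pair the interval loses cells at its top, which raises envelope slopes, the more so the
higher the cell (`WFT.sl_sub_sl_mono`). Hence the increase of the speed difference of `s, s'` is at
most `h s' - h s` for one monotone function `h` on the remaining waves: the increase of the slopes
at the cells of `X`, extended by constants. Its oscillation is at most `‖f''‖ ε` times the number of
removed waves, since that is how much a chord of the flux turns when its end is moved
(`WFT.WaveSystem.Cancels.exists_monotoneOn`). The total variation being `ε` times the number of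
waves (`WFT.IsConfig.totVar_eq`), this is `‖f''‖` times the amount of cancellation.

Whether two remaining waves have interacted does not change at a cancellation, so the other pairs
keep the weight `‖f''‖`, and it remains to sum up `(h s' - h s) / (number of waves from s to s')`
over all pairs. When `h` is written by its increments between neighbours, the increment that has `A`
waves on its left and `B` on its right is multiplied by the sum of `1 / (a + b)` over `1 ≤ a ≤ A`
and `1 ≤ b ≤ B`, which is at most the logarithm of the binomial coefficient of `A + B` over `A`,
hence at most `(A + B) log 2` (`WFT.sum_pairs_le`).
-/

namespace WFT

/-! ### Convex envelopes of functions on the integers -/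

/-- `h` is convex on the integer interval `[A, B]`. -/
def ConvexSeq (A B : ℤ) (h : ℤ → ℝ) : Prop :=
  ∀ k, A < k → k < B → 2 * h k ≤ h (k - 1) + h (k + 1)

/-- The convex envelope of `F` on the integer interval `[A, B]`. -/
noncomputable def dEnv (F : ℤ → ℝ) (A B n : ℤ) : ℝ :=
  sSup {y | ∃ h : ℤ → ℝ, ConvexSeq A B h ∧ (∀ k ∈ Icc A B, h k ≤ F k) ∧ y = h n}

/-- The slope of the convex envelope of `F` on `[A, B]` in the cell `[m - 1, m]`. -/
noncomputable def sl (F : ℤ → ℝ) (A B m : ℤ) : ℝ := dEnv F A B m - dEnv F A B (m - 1)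

/-- The contact conditions which characterize the convex envelope: a convex minorant that touches
`F` at the end points and wherever its slope changes. -/
structure IsEnv (F : ℤ → ℝ) (A B : ℤ) (H : ℤ → ℝ) : Prop where
  convex : ConvexSeq A B H
  le : ∀ k ∈ Icc A B, H k ≤ F k
  left : H A = F A
  right : H B = F B
  contact : ∀ k, A < k → k < B → H k = F k ∨ 2 * H k = H (k - 1) + H (k + 1)

variable {F : ℤ → ℝ} {A B : ℤ}

theorem IsEnv.max {H K : ℤ → ℝ} (hH : IsEnv F A B H) (hK : ConvexSeq A B K)
    (hKF : ∀ k ∈ Icc A B, K k ≤ F k) : ∀ n ∈ Icc A B, K n ≤ H n := by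
  -- At the leftmost point where `K - H` attains a positive maximum, `H` is affine and `K` convex.
  by_contra! hcon
  obtain ⟨n, hn, hlt⟩ := hcon
  have hne : (Finset.Icc A B).Nonempty := ⟨n, by simpa using hn⟩
  obtain ⟨m, hm, hmax⟩ := Finset.exists_max_image (Finset.Icc A B) (fun k => K k - H k) hne
  have hex : ∃ i : ℕ, A + i ∈ Finset.Icc A B ∧ K (A + i) - H (A + i) = K m - H m := by
    rw [Finset.mem_Icc] at hm
    refine ⟨(m - A).toNat, ?_⟩
    have : A + ((m - A).toNat : ℤ) = m := by omega
    rw [this]; exact ⟨by simpa using hm, rfl⟩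
  classical
  obtain ⟨hi1, hi2⟩ := Nat.find_spec hex
  have hmin := fun k (hk : k < Nat.find hex) => Nat.find_min hex hk
  set i := Nat.find hex
  have hpos : 0 < K (A + i) - H (A + i) := by
    rw [hi2]; have := hmax n (by simpa using hn); linarith
  rw [Finset.mem_Icc] at hi1
  have hKi := hKF (A + i) hi1
  have hi0 : i ≠ 0 := by
    intro h0
    rw [h0] at hpos hKi
    simp only [Nat.cast_zero, add_zero] at hpos hKi
    rw [hH.left] at hpos; linarith
  have hiB : A + (i : ℤ) ≠ B := by
    intro h0
    rw [h0, hH.right] at hpos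
    rw [h0] at hKi; linarith
  have h1 : A < A + (i : ℤ) := by omega
  have h2 : A + (i : ℤ) < B := by omega
  have h3 := hK _ h1 h2
  have h4 : 2 * H (A + i) = H (A + i - 1) + H (A + i + 1) := by
    rcases hH.contact _ h1 h2 with h | h
    · linarith
    · exact h
  have h5 := hmax (A + i - 1) (by simp only [Finset.mem_Icc]; omega)
  have h6 := hmax (A + i + 1) (by simp only [Finset.mem_Icc]; omega)
  have h7 := hmin (i - 1) (by omega)
  apply h7
  have h8 : A + ((i - 1 : ℕ) : ℤ) = A + i - 1 := by omega
  rw [h8]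
  refine ⟨by simp only [Finset.mem_Icc]; omega, ?_⟩
  linarith

theorem IsEnv.eq_dEnv {H : ℤ → ℝ} (hH : IsEnv F A B H) : ∀ n ∈ Icc A B, dEnv F A B n = H n := by
  intro n hn
  refine IsGreatest.csSup_eq ⟨⟨H, hH.convex, hH.le, rfl⟩, ?_⟩
  rintro y ⟨h, hc, hl, rfl⟩
  exact hH.max hc hl n hn

theorem dEnv_bddAbove {n : ℤ} (hn : n ∈ Icc A B) :
    BddAbove {y | ∃ h : ℤ → ℝ, ConvexSeq A B h ∧ (∀ k ∈ Icc A B, h k ≤ F k) ∧ y = h n} :=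
  ⟨F n, by rintro y ⟨h, -, hl, rfl⟩; exact hl n hn⟩

theorem le_dEnv {h : ℤ → ℝ} (hc : ConvexSeq A B h) (hl : ∀ k ∈ Icc A B, h k ≤ F k)
    {n : ℤ} (hn : n ∈ Icc A B) : h n ≤ dEnv F A B n :=
  le_csSup (dEnv_bddAbove hn) ⟨h, hc, hl, rfl⟩

theorem dEnv_nonempty (n : ℤ) :
    {y | ∃ h : ℤ → ℝ, ConvexSeq A B h ∧ (∀ k ∈ Icc A B, h k ≤ F k) ∧ y = h n}.Nonempty := by
  obtain ⟨c, hc⟩ := ((Finset.Icc A B).image F).bddBelow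
  refine ⟨c, fun _ => c, fun k _ _ => by linarith, fun k hk => ?_, rfl⟩
  exact hc (by simpa using ⟨k, hk, rfl⟩)

theorem dEnv_le {n : ℤ} (hn : n ∈ Icc A B) : dEnv F A B n ≤ F n :=
  csSup_le (dEnv_nonempty n) (by rintro y ⟨h, -, hl, rfl⟩; exact hl n hn)

theorem convexSeq_dEnv : ConvexSeq A B (dEnv F A B) := by
  intro k h1 h2
  have : dEnv F A B k ≤ (dEnv F A B (k - 1) + dEnv F A B (k + 1)) / 2 := by
    refine csSup_le (dEnv_nonempty k) ?_
    rintro y ⟨h, hc, hl, rfl⟩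
    have h3 := le_dEnv hc hl (n := k - 1) ⟨by omega, by omega⟩
    have h4 := le_dEnv hc hl (n := k + 1) ⟨by omega, by omega⟩
    have := hc k h1 h2
    linarith
  linarith

/-- Raising the envelope at a single point where it is below `F` must break convexity. -/
theorem dEnv_raise {n : ℤ} (hn : n ∈ Icc A B) {η : ℝ} (hη : 0 < η)
    (hF : dEnv F A B n + η ≤ F n) :
    A < n ∧ n < B ∧ dEnv F A B (n - 1) + dEnv F A B (n + 1) < 2 * (dEnv F A B n + η) := by
  by_contra hcon
  let h : ℤ → ℝ := fun k => if k = n then dEnv F A B n + η else dEnv F A B k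
  have hge : ∀ k, dEnv F A B k ≤ h k := by
    intro k; simp only [h]; split_ifs with hk
    · subst hk; linarith
    · exact le_rfl
  have hc : ConvexSeq A B h := by
    intro k h1 h2
    by_cases hk : k = n
    · subst hk
      have : h k = dEnv F A B k + η := by simp [h]
      rw [this]
      have h3 := hge (k - 1)
      have h4 := hge (k + 1)
      by_contra! h5
      exact hcon ⟨h1, h2, by linarith⟩
    · have : h k = dEnv F A B k := by simp [h, hk]
      rw [this]
      have := convexSeq_dEnv (F := F) k h1 h2
      have h3 := hge (k - 1)
      have h4 := hge (k + 1)
      linarith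
  have hl : ∀ k ∈ Icc A B, h k ≤ F k := by
    intro k hk; simp only [h]; split_ifs with hkn
    · subst hkn; exact hF
    · exact dEnv_le hk
  have := le_dEnv hc hl hn
  simp only [h, if_true] at this
  linarith

theorem isEnv_dEnv (hAB : A ≤ B) : IsEnv F A B (dEnv F A B) where
  convex := convexSeq_dEnv
  le := fun _ hk => dEnv_le hk
  left := by
    have hm : A ∈ Icc A B := ⟨le_rfl, hAB⟩
    refine le_antisymm (dEnv_le hm) ?_
    by_contra! h
    have := dEnv_raise hm (sub_pos.2 h) (by linarith)
    omega
  right := by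
    have hm : B ∈ Icc A B := ⟨hAB, le_rfl⟩
    refine le_antisymm (dEnv_le hm) ?_
    by_contra! h
    have := dEnv_raise hm (sub_pos.2 h) (by linarith)
    omega
  contact := by
    intro k h1 h2
    have hm : k ∈ Icc A B := ⟨h1.le, h2.le⟩
    by_contra! hcon
    have h3 : dEnv F A B k < F k := lt_of_le_of_ne (dEnv_le hm) hcon.1
    have h4 : 2 * dEnv F A B k < dEnv F A B (k - 1) + dEnv F A B (k + 1) :=
      lt_of_le_of_ne (convexSeq_dEnv k h1 h2) hcon.2
    set η := min (F k - dEnv F A B k)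
      ((dEnv F A B (k - 1) + dEnv F A B (k + 1) - 2 * dEnv F A B k) / 2) with hη
    have h5 : 0 < η := lt_min (by linarith) (by linarith)
    have h6 : η ≤ F k - dEnv F A B k := min_le_left _ _
    have h7 : η ≤ (dEnv F A B (k - 1) + dEnv F A B (k + 1) - 2 * dEnv F A B k) / 2 :=
      min_le_right _ _
    have h8 := dEnv_raise hm h5 (by linarith)
    linarith [h8.2.2]

theorem dEnv_left (hAB : A ≤ B) : dEnv F A B A = F A := (isEnv_dEnv hAB).left

theorem dEnv_right (hAB : A ≤ B) : dEnv F A B B = F B := (isEnv_dEnv hAB).right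

theorem IsEnv.restrict {H : ℤ → ℝ} (hH : IsEnv F A B H) {A' B' : ℤ} (h1 : A ≤ A') (h2 : B' ≤ B)
    (hA' : H A' = F A') (hB' : H B' = F B') : IsEnv F A' B' H where
  convex := fun k hk hk' => hH.convex k (by omega) (by omega)
  le := fun k hk => hH.le k ⟨by linarith [hk.1], by linarith [hk.2]⟩
  left := hA'
  right := hB'
  contact := fun k hk hk' => hH.contact k (by omega) (by omega)

theorem sl_succ_le {m : ℤ} (h1 : A < m) (h2 : m < B) : sl F A B m ≤ sl F A B (m + 1) := by
  have := convexSeq_dEnv (F := F) m h1 h2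
  simp only [sl, add_sub_cancel_right]; linarith

theorem sl_mono {m m' : ℤ} (h1 : A < m) (h2 : m ≤ m') (h3 : m' ≤ B) :
    sl F A B m ≤ sl F A B m' := by
  induction m', h2 using Int.leInduction with
  | base => exact le_rfl
  | succ n hn ih => exact (ih (by omega)).trans (sl_succ_le (by omega) (by omega))

/-- Where its slope changes, the envelope touches the function. -/
theorem dEnv_eq_of_sl_lt {d : ℤ} (h1 : A < d) (h2 : d < B)
    (h : sl F A B d < sl F A B (d + 1)) : dEnv F A B d = F d := by
  rcases (isEnv_dEnv (F := F) (by omega : A ≤ B)).contact d h1 h2 with h3 | h3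
  · exact h3
  · simp only [sl, add_sub_cancel_right] at h; linarith

/-- Locality: between two contact points of the envelope on a large interval, it coincides with
the envelope on the interval between them. -/
theorem dEnv_restrict {A' B' : ℤ} (hAB : A ≤ B) (h1 : A ≤ A') (h2 : B' ≤ B)
    (hA' : dEnv F A B A' = F A') (hB' : dEnv F A B B' = F B') {n : ℤ} (hn : n ∈ Icc A' B') :
    dEnv F A' B' n = dEnv F A B n :=
  ((isEnv_dEnv hAB).restrict h1 h2 hA' hB').eq_dEnv n hn

theorem sl_restrict {A' B' : ℤ} (hAB : A ≤ B) (h1 : A ≤ A') (h2 : B' ≤ B)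
    (hA' : dEnv F A B A' = F A') (hB' : dEnv F A B B' = F B') {n : ℤ} (hn : A' < n)
    (hn' : n ≤ B') : sl F A' B' n = sl F A B n := by
  rw [sl, sl, dEnv_restrict hAB h1 h2 hA' hB' ⟨hn.le, hn'⟩,
    dEnv_restrict hAB h1 h2 hA' hB' (n := n - 1) ⟨by omega, by omega⟩]

/-- On a smaller interval the envelope is larger. -/
theorem dEnv_anti {A' B' : ℤ} (h1 : A ≤ A') (h2 : B' ≤ B) {n : ℤ} (hn : n ∈ Icc A' B') :
    dEnv F A B n ≤ dEnv F A' B' n :=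
  le_dEnv (fun k hk hk' => convexSeq_dEnv k (by omega) (by omega))
    (fun k hk => dEnv_le ⟨by linarith [hk.1], by linarith [hk.2]⟩) hn

/-- The gain of the envelope under restriction to a smaller interval is convex: where the gain is
positive, the envelope on the large interval is affine. -/
theorem convexSeq_dEnv_sub {A' B' : ℤ} (h1 : A ≤ A') (h2 : B' ≤ B) :
    ConvexSeq A' B' (fun n => dEnv F A' B' n - dEnv F A B n) := by
  intro k hk hk'
  have hl := dEnv_anti (F := F) h1 h2 (n := k - 1) ⟨by omega, by omega⟩
  have hm := dEnv_anti (F := F) h1 h2 (n := k) ⟨by omega, by omega⟩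
  have hr := dEnv_anti (F := F) h1 h2 (n := k + 1) ⟨by omega, by omega⟩
  have hc := convexSeq_dEnv (F := F) k hk hk'
  simp only
  rcases (isEnv_dEnv (F := F) (by omega : A ≤ B)).contact k (by omega) (by omega) with h | h
  · have := dEnv_le (F := F) (A := A') (B := B') (n := k) ⟨by omega, by omega⟩
    linarith
  · linarith

/-- Passing to a smaller interval changes the slopes by an amount that increases with the cell. -/
theorem sl_sub_sl_mono {A' B' : ℤ} (h1 : A ≤ A') (h2 : B' ≤ B) {m m' : ℤ} (hm : A' < m)
    (hmm : m ≤ m') (hm' : m' ≤ B') :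
    sl F A' B' m - sl F A B m ≤ sl F A' B' m' - sl F A B m' := by
  induction m', hmm using Int.leInduction with
  | base => exact le_rfl
  | succ n hn ih =>
    refine (ih (by omega)).trans ?_
    have := convexSeq_dEnv_sub (F := F) h1 h2 n (by omega) (by omega)
    simp only [sl, add_sub_cancel_right]; linarith

/-- A strict change of slope persists on smaller intervals. -/
theorem sl_lt_of_subinterval {A' B' d : ℤ} (h1 : A ≤ A') (h2 : B' ≤ B) (hd : A' < d)
    (hd' : d < B') (h : sl F A B d < sl F A B (d + 1)) :
    sl F A' B' d < sl F A' B' (d + 1) := by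
  have := sl_sub_sl_mono (F := F) h1 h2 (m := d) (m' := d + 1) hd (by omega) (by omega)
  linarith

/-- Cutting off the top of the interval raises the slopes. -/
theorem sl_trim_top {B' m : ℤ} (h2 : B' ≤ B) (hm : A < m) (hm' : m ≤ B') :
    sl F A B m ≤ sl F A B' m := by
  have h := sl_sub_sl_mono (F := F) (le_refl A) h2 (m := A + 1) (m' := m) (by omega) (by omega) hm'
  have h3 := dEnv_anti (F := F) (le_refl A) h2 (n := A + 1) ⟨by omega, by omega⟩
  have h4 := dEnv_left (F := F) (by omega : A ≤ B)
  have h5 := dEnv_left (F := F) (by omega : A ≤ B')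
  have : 0 ≤ sl F A B' (A + 1) - sl F A B (A + 1) := by
    simp only [sl, add_sub_cancel_right]; linarith
  linarith

theorem sl_reflect {m : ℤ} (hm : A < m) (hm' : m ≤ B) :
    sl (fun n => F (-n)) (-B) (-A) (1 - m) = - sl F A B m := by
  have hE : IsEnv (fun n => F (-n)) (-B) (-A) (fun n => dEnv F A B (-n)) := by
    have h := isEnv_dEnv (F := F) (by omega : A ≤ B)
    refine ⟨fun k hk hk' => ?_, fun k hk => ?_, ?_, ?_, fun k hk hk' => ?_⟩
    · have := h.convex (-k) (by omega) (by omega)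
      rw [show -(k - 1) = -k + 1 by ring, show -(k + 1) = -k - 1 by ring]; linarith
    · exact h.le (-k) ⟨by linarith [hk.2], by linarith [hk.1]⟩
    · simpa using h.right
    · simpa using h.left
    · have := h.contact (-k) (by omega) (by omega)
      rw [show -(k - 1) = -k + 1 by ring, show -(k + 1) = -k - 1 by ring]
      rcases this with h | h
      · exact Or.inl h
      · right; linarith
  rw [sl, sl, hE.eq_dEnv _ ⟨by omega, by omega⟩, hE.eq_dEnv _ ⟨by omega, by omega⟩]
  rw [show -(1 - m) = m - 1 by ring, show -(1 - m - 1) = m by ring]; ring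

/-- A strict change of slope at `d` in the envelope on `[c, B]` persists on the larger interval
`[A, B]` if `c` is shielded by a strict change of slope in the envelope on `[A, e]` with `d < e`. -/
theorem sl_lt_glue {c d e : ℤ} (hAc : A < c) (hcd : c < d) (hde : d < e) (heB : e ≤ B)
    (hc : sl F A e c < sl F A e (c + 1)) (hd : sl F c B d < sl F c B (d + 1)) :
    sl F A B d < sl F A B (d + 1) := by
  -- The envelopes on `[A, e]` and `[c, B]` agree on `[c, d]`, hence glue to a convex function.
  have cc := dEnv_eq_of_sl_lt hAc (by omega) hc
  have cd := dEnv_eq_of_sl_lt hcd (by omega) hd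
  have hd' : sl F c e d < sl F c e (d + 1) := sl_lt_of_subinterval le_rfl heB hcd hde hd
  have cd' := dEnv_eq_of_sl_lt hcd hde hd'
  have hagree : ∀ n ∈ Icc c d, dEnv F A e n = dEnv F c B n := by
    intro n hn
    rw [← dEnv_restrict (by omega) le_rfl (by omega : d ≤ B) (dEnv_left (by omega)) cd hn,
      dEnv_restrict (by omega) le_rfl (by omega : d ≤ e) (dEnv_left (by omega)) cd' hn,
      dEnv_restrict (by omega) (by omega : A ≤ c) le_rfl cc (dEnv_right (by omega))
        ⟨hn.1, by linarith [hn.2]⟩]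
  have h1 := isEnv_dEnv (F := F) (by omega : A ≤ e)
  have h2 := isEnv_dEnv (F := F) (by omega : c ≤ B)
  let H : ℤ → ℝ := fun n => if n ≤ d then dEnv F A e n else dEnv F c B n
  have hHl : ∀ n, n ≤ d → H n = dEnv F A e n := fun n hn => by simp [H, hn]
  have hHr : ∀ n, c ≤ n → H n = dEnv F c B n := fun n hn => by
    by_cases h : n ≤ d
    · rw [hHl n h]; exact hagree n ⟨hn, h⟩
    · simp [H, h]
  have hH : IsEnv F A B H := by
    refine ⟨fun k hk hk' => ?_, fun k hk => ?_, ?_, ?_, fun k hk hk' => ?_⟩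
    · rcases lt_or_ge k d with h | h
      · rw [hHl _ h.le, hHl _ (by omega : k - 1 ≤ d), hHl _ (by omega : k + 1 ≤ d)]
        exact h1.convex k hk (by omega)
      · rw [hHr _ (by omega : c ≤ k), hHr _ (by omega : c ≤ k - 1), hHr _ (by omega : c ≤ k + 1)]
        exact h2.convex k (by omega) hk'
    · rcases lt_or_ge k d with h | h
      · rw [hHl _ h.le]; exact h1.le k ⟨hk.1, by omega⟩
      · rw [hHr _ (by omega : c ≤ k)]; exact h2.le k ⟨by omega, hk.2⟩
    · rw [hHl _ (by omega)]; exact h1.left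
    · rw [hHr _ (by omega)]; exact h2.right
    · rcases lt_or_ge k d with h | h
      · rw [hHl _ h.le, hHl _ (by omega : k - 1 ≤ d), hHl _ (by omega : k + 1 ≤ d)]
        exact h1.contact k hk (by omega)
      · rw [hHr _ (by omega : c ≤ k), hHr _ (by omega : c ≤ k - 1), hHr _ (by omega : c ≤ k + 1)]
        exact h2.contact k (by omega) hk'
  have key : ∀ n, c ≤ n → n ≤ B → dEnv F A B n = dEnv F c B n := fun n hn hn' => by
    rw [hH.eq_dEnv n ⟨by omega, hn'⟩, hHr n hn]
  simp only [sl, add_sub_cancel_right] at hd ⊢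
  rw [key _ (by omega) (by omega), key _ (by omega) (by omega), key _ (by omega) (by omega)]
  exact hd

/-- The mirror image of `sl_lt_glue`. -/
theorem sl_lt_glue' {c d e : ℤ} (hcB : c < B) (hdc : d < c) (hed : e < d) (hAe : A ≤ e)
    (hc : sl F e B c < sl F e B (c + 1)) (hd : sl F A c d < sl F A c (d + 1)) :
    sl F A B d < sl F A B (d + 1) := by
  have key : ∀ {A' B' m : ℤ}, A' < m → m < B' → (sl F A' B' m < sl F A' B' (m + 1) ↔
      sl (fun n => F (-n)) (-B') (-A') (-m) < sl (fun n => F (-n)) (-B') (-A') (-m + 1)) := by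
    intro A' B' m h1 h2
    have e1 := sl_reflect (F := F) h1 h2.le
    have e2 := sl_reflect (F := F) (A := A') (B := B') (m := m + 1) (by omega) (by omega)
    rw [show (1 : ℤ) - m = -m + 1 by ring] at e1
    rw [show (1 : ℤ) - (m + 1) = -m by ring] at e2
    rw [e1, e2]; constructor <;> intro h <;> linarith
  rw [key (by omega) (by omega)] at hc hd ⊢
  exact sl_lt_glue (by omega : -B < -c) (by omega) (by omega : -d < -e) (by omega) hc hd

theorem sub_eq_of_const_slope {G : ℤ → ℝ} {a b : ℤ} {l : ℝ} (hab : a ≤ b)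
    (h : ∀ k, a < k → k ≤ b → G k - G (k - 1) = l) : G b - G a = l * (b - a) := by
  induction b, hab using Int.leInduction with
  | base => simp
  | succ n hn ih =>
    have h1 := h (n + 1) (by omega) le_rfl
    have h2 := ih (fun k hk hk' => h k hk (by omega))
    rw [add_sub_cancel_right] at h1
    push_cast; linarith

/-- The mean slopes of `F` on two adjacent intervals differ at most by `K` times their total
length. -/
def SlopeLip (K : ℝ) (F : ℤ → ℝ) : Prop :=
  ∀ a b c : ℤ, a < b → b < c →
    |(F b - F a) / (b - a) - (F c - F b) / (c - b)| ≤ K * (c - a)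

theorem SlopeLip.reflect {K : ℝ} (h : SlopeLip K F) : SlopeLip K (fun n => F (-n)) := by
  intro a b c hab hbc
  have := h (-c) (-b) (-a) (by omega) (by omega)
  push_cast at this
  have e1 : (F (-b) - F (-a)) / ((b : ℝ) - a) = - ((F (-a) - F (-b)) / (-a - -b)) := by
    rw [← neg_div]; congr 1 <;> ring
  have e2 : (F (-c) - F (-b)) / ((c : ℝ) - b) = - ((F (-b) - F (-c)) / (-b - -c)) := by
    rw [← neg_div]; congr 1 <;> ring
  rw [e1, e2]
  convert this using 1
  · congr 1; ring
  · ring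

/-- If the envelope on `[A, B]` is affine with slope `l`, cutting off the top `(B', B]` raises the
slopes at most by `K * (B - B')`. -/
theorem sl_trim_top_le {K l : ℝ} (hF : SlopeLip K F) {B' m : ℤ} (hB : B' < B)
    (hl : ∀ k, A < k → k ≤ B → sl F A B k = l) (hm : A < m) (hm' : m ≤ B') :
    sl F A B' m ≤ l + K * (B - B') := by
  refine (sl_mono hm hm' le_rfl).trans ?_
  have hE := isEnv_dEnv (F := F) (by omega : A ≤ B')
  -- `e` is the last contact point before `B'`.
  obtain ⟨e, he, hemax⟩ := Finset.exists_max_image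
    ((Finset.Ico A B').filter (fun k => dEnv F A B' k = F k)) id
    ⟨A, by simp only [Finset.mem_filter, Finset.mem_Ico]; exact ⟨⟨le_rfl, by omega⟩, hE.left⟩⟩
  simp only [Finset.mem_filter, Finset.mem_Ico, id] at he hemax
  have hconst : ∀ k, e < k → k ≤ B' → sl F A B' k = sl F A B' B' := by
    intro k hk hk'
    refine le_antisymm (sl_mono (by omega) hk' le_rfl) ?_
    by_contra! hlt
    -- otherwise the slope changes strictly somewhere between `k` and `B'`
    have : ∀ n, k ≤ n → n ≤ B' → sl F A B' n ≤ sl F A B' k := by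
      intro n hn
      induction n, hn using Int.leInduction with
      | base => exact fun _ => le_rfl
      | succ n hn ih =>
        intro hn'
        refine le_trans ?_ (ih (by omega))
        by_contra! hlt
        have hc := dEnv_eq_of_sl_lt (by omega) (by omega) hlt
        have := hemax n ⟨⟨by omega, by omega⟩, hc⟩
        omega
    linarith [this B' hk' le_rfl]
  set μ := sl F A B' B' with hμ
  have h1 : F B' - F e = μ * (B' - e) := by
    rw [← he.2, ← hE.right]
    exact sub_eq_of_const_slope he.1.2.le hconst
  have h2 : F B - dEnv F A B e = l * (B - e) := by
    rw [← dEnv_right (F := F) (by omega : A ≤ B)]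
    exact sub_eq_of_const_slope (by omega) (fun k hk hk' => hl k (by omega) hk')
  have h3 : dEnv F A B e ≤ F e := dEnv_le ⟨he.1.1, by omega⟩
  have h4 := hF e B' B he.1.2 hB
  have p1 : (0 : ℝ) < B' - e := by
    have : (e : ℝ) < B' := by exact_mod_cast he.1.2
    linarith
  have p2 : (0 : ℝ) < B - B' := by
    have : (B' : ℝ) < B := by exact_mod_cast hB
    linarith
  have h5 := (abs_le.1 h4).2
  have h6 : (F B' - F e) / ((B' : ℝ) - e) = μ := by rw [h1]; field_simp
  rw [h6] at h5
  have h7 : (F B - F B') / ((B : ℝ) - B') ≤ (l * (B - e) - μ * (B' - e)) / (B - B') := by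
    apply div_le_div_of_nonneg_right _ p2.le
    linarith
  have h8 : μ - (l * (B - e) - μ * (B' - e)) / (B - B') ≤ K * (B - e) := by linarith
  have h9 : μ - (l * (B - e) - μ * (B' - e)) / ((B : ℝ) - B') = (μ - l) * (B - e) / (B - B') := by
    field_simp; ring
  rw [h9, div_le_iff₀ p2] at h8
  have p3 : (0 : ℝ) < B - e := by linarith
  have h10 : μ - l ≤ K * (B - B') := by
    refine le_of_mul_le_mul_right ?_ p3
    linarith
  linarith

end WFT

namespace WFT

/-! ### Abstract systems of waves -/

/-- The combinatorial content of a wavefront tracking approximation. At stage `i` the waves in the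
finite set `W i` are alive; the wave `s` has position `x i s` and speed `v i s`. In suitable units
it occupies the cell `(y s - 1, y s]`, and its speed is the slope of the convex envelope of the
flux `F s` on the union of the cells of the waves at the same position. The reflection `u ↦ -u`
being built into `F` and `y`, waves of both signs are treated alike. -/
structure WaveSystem (α : Type*) [LinearOrder α] where
  /-- the waves alive at stage `i` -/
  W : ℕ → Finset α
  /-- positions -/
  x : ℕ → α → ℝ
  /-- speeds -/
  v : ℕ → α → ℝ
  /-- cell indices -/
  y : α → ℤ
  /-- fluxes, up to reflection -/
  F : α → ℤ → ℝ
  W_succ : ∀ i, W (i + 1) ⊆ W i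
  x_mono : ∀ i, MonotoneOn (x i) (W i)
  F_eq : ∀ i, ∀ s ∈ W i, ∀ s' ∈ W i, x i s = x i s' → F s = F s'
  card_class : ∀ i, ∀ s ∈ W i, ∀ s' ∈ W i, s ≤ s' → x i s = x i s' →
    y s' - y s + 1 = ((W i).filter (fun z => s ≤ z ∧ z ≤ s')).card
  card_le : ∀ i, ∀ s ∈ W i, ∀ s' ∈ W i, s ≤ s' → (∃ k ≤ i, x k s = x k s') →
    y s' - y s + 1 ≤ ((W i).filter (fun z => s ≤ z ∧ z ≤ s')).card
  speed : ∀ i, ∀ s ∈ W i, ∀ a ∈ W i, ∀ b ∈ W i, x i a = x i s → x i b = x i s →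
    (∀ z ∈ W i, x i z = x i s → a ≤ z ∧ z ≤ b) → v i s = sl (F s) (y a - 1) (y b) (y s)
  motion : ∀ i, ∀ s ∈ W (i + 1), ∀ s' ∈ W (i + 1), x i s = x i s' → v i s = v i s' →
    x (i + 1) s = x (i + 1) s'

namespace WaveSystem

variable {α : Type*} [LinearOrder α] (S : WaveSystem α)

/-- The waves `s`, `s'` are alive at stage `i` and have been at the same position by then. -/
def Inter (i : ℕ) (s s' : α) : Prop := s ∈ S.W i ∧ s' ∈ S.W i ∧ ∃ k ≤ i, S.x k s = S.x k s'

/-- The waves `s`, `s'` belong to the same wavefront at stage `i`. -/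
def SameFront (i : ℕ) (s s' : α) : Prop := S.x i s = S.x i s' ∧ S.v i s = S.v i s'

open Classical in
/-- The waves that have interacted both with `s` and with `s'`. -/
noncomputable def common (i : ℕ) (s s' : α) : Finset α :=
  (S.W i).filter (fun p => S.Inter i p s ∧ S.Inter i p s')

/-- `p < p'` are consecutive waves at stage `i`. -/
def Cons (i : ℕ) (p p' : α) : Prop :=
  p ∈ S.W i ∧ p' ∈ S.W i ∧ p < p' ∧ ∀ z ∈ S.W i, z ≤ p ∨ p' ≤ z

/-- `a` and `b` are the least and the greatest element of `K`. -/
def _root_.WFT.Ext (K : Finset α) (a b : α) : Prop := a ∈ K ∧ b ∈ K ∧ ∀ z ∈ K, a ≤ z ∧ z ≤ b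

theorem _root_.WFT.exists_ext {K : Finset α} (hK : K.Nonempty) : ∃ a b, Ext K a b :=
  ⟨K.min' hK, K.max' hK, K.min'_mem hK, K.max'_mem hK,
    fun z hz => ⟨K.min'_le z hz, K.le_max' z hz⟩⟩

variable {S} {i : ℕ} {s s' z z' p p' : α}

theorem W_anti {k i : ℕ} (h : k ≤ i) : S.W i ⊆ S.W k := by
  induction i, h using Nat.le_induction with
  | base => exact Finset.Subset.refl _
  | succ n _ ih => exact (S.W_succ n).trans ih

theorem mem_common : p ∈ S.common i s s' ↔ S.Inter i p s ∧ S.Inter i p s' := by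
  simp only [common, Finset.mem_filter, and_iff_right_iff_imp]
  exact fun h => h.1.1

theorem Inter.symm (h : S.Inter i s s') : S.Inter i s' s := by
  obtain ⟨h1, h2, k, hk, h⟩ := h
  exact ⟨h2, h1, k, hk, h.symm⟩

theorem inter_of_eq (hs : s ∈ S.W i) (hs' : s' ∈ S.W i) (h : S.x i s = S.x i s') :
    S.Inter i s s' := ⟨hs, hs', i, le_rfl, h⟩

theorem Inter.flux_eq (h : S.Inter i s s') : S.F s = S.F s' := by
  obtain ⟨h1, h2, k, hk, h⟩ := h
  exact S.F_eq k s (W_anti hk h1) s' (W_anti hk h2) h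

theorem eq_of_btw {k : ℕ} (hs : s ∈ S.W k) (hs' : s' ∈ S.W k) (h : S.x k s = S.x k s')
    (hz : z ∈ S.W k) (h1 : s ≤ z) (h2 : z ≤ s') : S.x k z = S.x k s :=
  le_antisymm (h ▸ S.x_mono k hz hs' h2) (S.x_mono k hs hz h1)

/-- Waves between two waves that have interacted have interacted, too. -/
theorem Inter.btw (h : S.Inter i s s') (hz : z ∈ S.W i) (hz' : z' ∈ S.W i) (h1 : s ≤ z)
    (h2 : z ≤ s') (h3 : s ≤ z') (h4 : z' ≤ s') : S.Inter i z z' := by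
  obtain ⟨hs, hs', k, hk, h⟩ := h
  have w := W_anti (S := S) hk
  exact ⟨hz, hz', k, hk, (eq_of_btw (w hs) (w hs') h (w hz) h1 h2).trans
    (eq_of_btw (w hs) (w hs') h (w hz') h3 h4).symm⟩

/-- The cells of the waves between two waves that have interacted are contiguous. -/
theorem Inter.card (h : S.Inter i s s') (hle : s ≤ s') :
    S.y s' - S.y s + 1 = ((S.W i).filter (fun z => s ≤ z ∧ z ≤ s')).card := by
  obtain ⟨hs, hs', k, hk, h⟩ := h
  have w := W_anti (S := S) hk
  refine le_antisymm (S.card_le i s hs s' hs' hle ⟨k, hk, h⟩) ?_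
  rw [S.card_class k s (w hs) s' (w hs') hle h]
  exact_mod_cast Finset.card_le_card (Finset.filter_subset_filter _ w)

theorem Inter.y_le (h : S.Inter i s s') (hle : s ≤ s') : S.y s ≤ S.y s' := by
  have h1 := h.card hle
  have : 0 < ((S.W i).filter (fun z => s ≤ z ∧ z ≤ s')).card :=
    Finset.card_pos.2 ⟨s, by simp [h.1, hle]⟩
  omega

theorem Inter.y_lt (h : S.Inter i s s') (hlt : s < s') : S.y s < S.y s' := by
  have h1 := h.card hlt.le
  have : 1 < ((S.W i).filter (fun z => s ≤ z ∧ z ≤ s')).card :=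
    Finset.one_lt_card.2 ⟨s, by simp [h.1, hlt.le], s', by simp [h.2.1, hlt.le], hlt.ne⟩
  omega

theorem Cons.y_eq (hc : S.Cons i p p') (h : S.Inter i p p') : S.y p' = S.y p + 1 := by
  have h1 := h.card hc.2.2.1.le
  have : ((S.W i).filter (fun z => p ≤ z ∧ z ≤ p')) = {p, p'} := by
    ext z
    simp only [Finset.mem_filter, Finset.mem_insert, Finset.mem_singleton]
    constructor
    · rintro ⟨hz, h1, h2⟩
      rcases hc.2.2.2 z hz with h | h
      · exact Or.inl (le_antisymm h h1)
      · exact Or.inr (le_antisymm h2 h)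
    · rintro (rfl | rfl)
      · exact ⟨hc.1, le_rfl, hc.2.2.1.le⟩
      · exact ⟨hc.2.1, hc.2.2.1.le, le_rfl⟩
  rw [this, Finset.card_pair hc.2.2.1.ne] at h1
  push_cast at h1; omega

theorem exists_cons_left (hz : z ∈ S.W i) (hp : p ∈ S.W i) (h : p < z) :
    ∃ q, S.Cons i q z ∧ p ≤ q := by
  obtain ⟨q, hq, hmax⟩ := Finset.exists_max_image ((S.W i).filter (· < z)) id ⟨p, by simp [hp, h]⟩
  simp only [Finset.mem_filter, id] at hq hmax
  refine ⟨q, ⟨hq.1, hz, hq.2, fun w hw => ?_⟩, hmax p ⟨hp, h⟩⟩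
  rcases lt_or_ge w z with h | h
  · exact Or.inl (hmax w ⟨hw, h⟩)
  · exact Or.inr h

theorem exists_cons_right (hz : z ∈ S.W i) (hp : p ∈ S.W i) (h : z < p) :
    ∃ q, S.Cons i z q ∧ q ≤ p := by
  obtain ⟨q, hq, hmin⟩ := Finset.exists_min_image ((S.W i).filter (z < ·)) id ⟨p, by simp [hp, h]⟩
  simp only [Finset.mem_filter, id] at hq hmin
  refine ⟨q, ⟨hz, hq.1, hq.2, fun w hw => ?_⟩, hmin p ⟨hp, h⟩⟩
  rcases lt_or_ge z w with h | h
  · exact Or.inr (hmin w ⟨hw, h⟩)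
  · exact Or.inl h

theorem left_mem_common (h : S.Inter i s s') : s ∈ S.common i s s' :=
  mem_common.2 ⟨inter_of_eq h.1 h.1 rfl, h⟩

theorem right_mem_common (h : S.Inter i s s') : s' ∈ S.common i s s' :=
  mem_common.2 ⟨h.symm, inter_of_eq h.2.1 h.2.1 rfl⟩

theorem mem_common_of_btw (h : S.Inter i s s') (hz : z ∈ S.W i) (h1 : s ≤ z) (h2 : z ≤ s') :
    z ∈ S.common i s s' :=
  mem_common.2 ⟨h.btw hz h.1 h1 h2 le_rfl (h1.trans h2), h.btw hz h.2.1 h1 h2 (h1.trans h2) le_rfl⟩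

theorem common_convex (hp : p ∈ S.common i s s') (hp' : p' ∈ S.common i s s') (hz : z ∈ S.W i)
    (h1 : p ≤ z) (h2 : z ≤ p') : z ∈ S.common i s s' := by
  rw [mem_common] at hp hp' ⊢
  have key : ∀ t, S.Inter i p t → S.Inter i p' t → S.Inter i z t := by
    intro t ht ht'
    rcases le_total z t with h | h
    · exact ht.btw hz ht.2.1 h1 h (h1.trans h) le_rfl
    · exact ht'.symm.btw hz ht.2.1 h h2 le_rfl (h.trans h2)
  exact ⟨key s hp.1 hp'.1, key s' hp.2 hp'.2⟩

/-- On the waves that have interacted with both `s` and `s'` the cell index is increasing. -/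
theorem y_le_of_mem_common (hp : p ∈ S.common i s s') (hp' : p' ∈ S.common i s s') (h : p ≤ p') :
    S.y p ≤ S.y p' := by
  rw [mem_common] at hp hp'
  rcases le_total p s with h1 | h1
  · rcases le_total s p' with h2 | h2
    · exact (hp.1.y_le h1).trans (hp'.1.symm.y_le h2)
    · exact (hp.1.btw hp.1.1 hp'.1.1 le_rfl h1 h h2).y_le h
  · exact (hp'.1.symm.btw hp.1.1 hp'.1.1 h1 h (h1.trans h) le_rfl).y_le h

theorem v_mono (hs : s ∈ S.W i) (hs' : s' ∈ S.W i) (h : S.x i s = S.x i s') (hle : s ≤ s') :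
    S.v i s ≤ S.v i s' := by
  obtain ⟨a, b, ha, hb, hab⟩ := exists_ext (K := (S.W i).filter (fun z => S.x i z = S.x i s))
    ⟨s, by simp [hs]⟩
  simp only [Finset.mem_filter] at ha hb hab
  have h1 := S.speed i s hs a ha.1 b hb.1 ha.2 hb.2 (fun z hz hz' => hab z ⟨hz, hz'⟩)
  have h2 := S.speed i s' hs' a ha.1 b hb.1 (ha.2.trans h) (hb.2.trans h)
    (fun z hz hz' => hab z ⟨hz, hz'.trans h.symm⟩)
  rw [h1, h2, S.F_eq i s hs s' hs' h]
  have e1 := (inter_of_eq ha.1 hs ha.2).y_le (hab s ⟨hs, rfl⟩).1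
  have e2 := (inter_of_eq hs' hb.1 (h.symm.trans hb.2.symm)).y_le (hab s' ⟨hs', h.symm⟩).2
  have e3 := (inter_of_eq hs hs' h).y_le hle
  exact sl_mono (by omega) e3 e2

theorem SameFront.symm (h : S.SameFront i s s') : S.SameFront i s' s := ⟨h.1.symm, h.2.symm⟩

theorem SameFront.trans (h : S.SameFront i s s') (h' : S.SameFront i s' z) : S.SameFront i s z :=
  ⟨h.1.trans h'.1, h.2.trans h'.2⟩

theorem SameFront.btw (hs : s ∈ S.W i) (hs' : s' ∈ S.W i) (h : S.SameFront i s s')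
    (hz : z ∈ S.W i) (h1 : s ≤ z) (h2 : z ≤ s') : S.SameFront i z s := by
  have hx := eq_of_btw hs hs' h.1 hz h1 h2
  refine ⟨hx, le_antisymm ?_ (v_mono hs hz hx.symm h1)⟩
  rw [h.2]
  exact v_mono hz hs' (hx.trans h.1) h2

/-! ### Wavefronts are separated by contact points -/

/-- The statement that the boundary between the consecutive waves `p`, `p'` is a strict contact
point of the envelope on the interval of the waves that have interacted with both. -/
def Divided (S : WaveSystem α) (i : ℕ) (p p' : α) : Prop :=
  ∀ a b, Ext (S.common i p p') a b →
    sl (S.F p) (S.y a - 1) (S.y b) (S.y p) < sl (S.F p) (S.y a - 1) (S.y b) (S.y p')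

/-- A strict contact point of the envelope on a large interval of waves is one on each smaller
interval. -/
theorem Divided.restrict (hc : S.Cons i p p') (hi : S.Inter i p p') (h : S.Divided i p p')
    {A B : ℤ} (ha : z ∈ S.common i p p') (hb : z' ∈ S.common i p p') (hA : A = S.y z - 1)
    (hB : B = S.y z') (h1 : z ≤ p) (h2 : p' ≤ z') :
    sl (S.F p) A B (S.y p) < sl (S.F p) A B (S.y p + 1) := by
  obtain ⟨a, b, hab⟩ := exists_ext ⟨z, ha⟩
  have h3 := h a b hab
  rw [hc.y_eq hi] at h3
  have e1 := y_le_of_mem_common hab.1 ha (hab.2.2 z ha).1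
  have e2 := y_le_of_mem_common hb hab.2.1 (hab.2.2 z' hb).2
  have e3 := y_le_of_mem_common ha (left_mem_common hi) h1
  have e4 := y_le_of_mem_common (right_mem_common hi) hb h2
  have e5 := hc.y_eq hi
  exact sl_lt_of_subinterval (by omega) (by omega) (by omega) (by omega) h3

/-- Boundaries between waves at the same position: if the boundaries between different positions
are contact points, then gluing the envelopes on the two sides shows the same for the boundaries
created by the Riemann solver. -/
theorem divided_of_same_position
    (hdiff : ∀ q q', S.Cons i q q' → S.Inter i q q' → S.x i q ≠ S.x i q' → S.Divided i q q')
    (hc : S.Cons i p p') (hx : S.x i p = S.x i p') (hv : S.v i p ≠ S.v i p') :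
    S.Divided i p p' := by
  intro a b hab
  have hp := hc.1
  have hp' := hc.2.1
  have hpp := hc.2.2.1
  have hi : S.Inter i p p' := inter_of_eq hp hp' hx
  have hy := hc.y_eq hi
  rw [hy]
  obtain ⟨z1, z2, hz1, hz2, hz⟩ := exists_ext (K := (S.W i).filter (fun z => S.x i z = S.x i p))
    ⟨p, by simp [hp]⟩
  simp only [Finset.mem_filter] at hz1 hz2 hz
  have ez1 := (hz p ⟨hp, rfl⟩).1
  have ez2 := (hz p' ⟨hp', hx.symm⟩).2
  have mz1 : z1 ∈ S.common i p p' :=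
    mem_common.2 ⟨inter_of_eq hz1.1 hp hz1.2, inter_of_eq hz1.1 hp' (hz1.2.trans hx)⟩
  have mz2 : z2 ∈ S.common i p p' :=
    mem_common.2 ⟨inter_of_eq hz2.1 hp hz2.2, inter_of_eq hz2.1 hp' (hz2.2.trans hx)⟩
  have mp := left_mem_common hi
  have mp' := right_mem_common hi
  have haz := (hab.2.2 z1 mz1).1
  have hbz := (hab.2.2 z2 mz2).2
  have ia := mem_common.1 hab.1
  have ib := mem_common.1 hab.2.1
  have y1 := y_le_of_mem_common hab.1 mz1 haz
  have y2 := y_le_of_mem_common mz2 hab.2.1 hbz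
  have y3 := y_le_of_mem_common mz1 mp ez1
  have y4 := y_le_of_mem_common mp' mz2 ez2
  -- the envelope on the waves at this position
  have base : sl (S.F p) (S.y z1 - 1) (S.y z2) (S.y p) <
      sl (S.F p) (S.y z1 - 1) (S.y z2) (S.y p + 1) := by
    have h1 := S.speed i p hp z1 hz1.1 z2 hz2.1 hz1.2 hz2.2 (fun z hz' hz'' => hz z ⟨hz', hz''⟩)
    have h2 := S.speed i p' hp' z1 hz1.1 z2 hz2.1 (hz1.2.trans hx) (hz2.2.trans hx)
      (fun z hz' hz'' => hz z ⟨hz', hz''.trans hx.symm⟩)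
    have h3 := v_mono hp hp' hx hpp.le
    rw [← hi.flux_eq] at h2
    rw [← hy, ← h1, ← h2]
    exact lt_of_le_of_ne h3 hv
  -- gluing at the lower end
  have low : sl (S.F p) (S.y a - 1) (S.y z2) (S.y p) <
      sl (S.F p) (S.y a - 1) (S.y z2) (S.y p + 1) := by
    rcases haz.eq_or_lt with rfl | hlt
    · exact base
    obtain ⟨q, hq, haq⟩ := exists_cons_left hz1.1 ia.1.1 hlt
    have hqz := hq.2.2.1
    have hqp' : q ≤ p' := (hqz.le.trans ez1).trans hpp.le
    have hiq : S.Inter i q z1 :=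
      ia.2.btw hq.1 hz1.1 haq hqp' haz (ez1.trans hpp.le)
    have hxq : S.x i q ≠ S.x i z1 := fun h =>
      absurd (hz q ⟨hq.1, h.trans hz1.2⟩).1 (not_le.2 hqz)
    have hyq := hq.y_eq hiq
    have hF : S.F q = S.F p := (hiq.flux_eq).trans (mem_common.1 mz1).1.flux_eq
    have g := (hdiff q z1 hq hiq hxq).restrict hq hiq (z := a) (z' := p')
      (mem_common.2 ⟨ia.2.btw ia.2.1 hq.1 le_rfl (haq.trans hqp') haq hqp',
        ia.2.btw ia.2.1 hz1.1 le_rfl (haq.trans hqp') haz (ez1.trans hpp.le)⟩)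
      (mem_common.2 ⟨ia.2.btw ia.2.2.1 hq.1 (haq.trans hqp') le_rfl haq hqp',
        ia.2.btw ia.2.2.1 hz1.1 (haq.trans hqp') le_rfl haz (ez1.trans hpp.le)⟩)
      rfl rfl haq (ez1.trans hpp.le)
    rw [hF] at g
    have e : S.y z1 - 1 = S.y q := by omega
    rw [e] at base
    have ya := (ia.2.btw ia.2.1 hq.1 le_rfl (haq.trans hqp') haq hqp').y_le haq
    exact sl_lt_glue (by omega) (by omega) (by omega) (by omega) g base
  -- gluing at the upper end
  rcases hbz.eq_or_lt with rfl | hlt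
  · exact low
  obtain ⟨q, hq, hqb⟩ := exists_cons_right hz2.1 ib.1.1 hlt
  have hzq := hq.2.2.1
  have hpq : p ≤ q := (hpp.le.trans ez2).trans hzq.le
  have hpz : p ≤ z2 := hpp.le.trans ez2
  have hib := ib.1.symm
  have hiq : S.Inter i z2 q := hib.btw hz2.1 hq.2.1 hpz hbz hpq hqb
  have hxq : S.x i z2 ≠ S.x i q := fun h =>
    absurd (hz q ⟨hq.2.1, h.symm.trans hz2.2⟩).2 (not_le.2 hzq)
  have hyq := hq.y_eq hiq
  have hF : S.F z2 = S.F p := (mem_common.1 mz2).1.flux_eq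
  have g := (hdiff z2 q hq hiq hxq).restrict hq hiq (z := p) (z' := b)
    (mem_common.2 ⟨hib.btw hp hz2.1 le_rfl (hpz.trans hbz) hpz hbz,
      hib.btw hp hq.2.1 le_rfl (hpz.trans hbz) hpq hqb⟩)
    (mem_common.2 ⟨hib.btw ib.1.1 hz2.1 (hpz.trans hbz) le_rfl hpz hbz,
      hib.btw ib.1.1 hq.2.1 (hpz.trans hbz) le_rfl hpq hqb⟩)
    rfl rfl hpz hqb
  rw [hF] at g
  have yb := (hib.btw hq.2.1 ib.1.1 hpq hqb (hpq.trans hqb) le_rfl).y_le hqb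
  exact sl_lt_glue' (by omega) (by omega) (by omega) (by omega) g low

/-- Different wavefronts made of waves that have interacted are separated by a strict contact point
of the envelope on the interval of the waves that have interacted with both neighbours. -/
theorem divided_of_not_sameFront (i : ℕ) : ∀ p p' : α, S.Cons i p p' → S.Inter i p p' →
    ¬ S.SameFront i p p' → S.Divided i p p' := by
  induction i with
  | zero =>
    intro p p' hc hi hf
    have key : ∀ q q' : α, S.Inter 0 q q' → S.x 0 q = S.x 0 q' := by
      rintro q q' ⟨-, -, k, hk, h⟩
      rwa [Nat.le_zero.1 hk] at h
    exact divided_of_same_position (fun q q' _ hq hx => absurd (key q q' hq) hx) hc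
      (key p p' hi) (fun hv => hf ⟨key p p' hi, hv⟩)
  | succ i ih =>
    have hdiff : ∀ q q', S.Cons (i + 1) q q' → S.Inter (i + 1) q q' →
        S.x (i + 1) q ≠ S.x (i + 1) q' → S.Divided (i + 1) q q' := by
      intro q q' hc hi hx a b hab
      have back : ∀ {t t' : α}, S.Inter (i + 1) t t' → S.x (i + 1) t ≠ S.x (i + 1) t' →
          S.Inter i t t' := by
        rintro t t' ⟨ht, ht', k, hk, h⟩ hne
        refine ⟨S.W_succ i ht, S.W_succ i ht', k, ?_, h⟩
        rcases Nat.le_succ_iff.1 hk with hk | rfl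
        · exact hk
        · exact absurd h hne
      have hi' := back hi hx
      have hqq := hc.2.2.1
      -- no wave between `q` and `q'` has been removed
      have hc' : S.Cons i q q' := by
        refine ⟨hi'.1, hi'.2.1, hqq, fun z hz => ?_⟩
        by_contra! hcon
        have h1 := hc.y_eq hi
        have h2 := (hi'.btw hi'.1 hz le_rfl hqq.le hcon.1.le hcon.2.le).y_lt hcon.1
        have h3 := (hi'.btw hz hi'.2.1 hcon.1.le hcon.2.le hqq.le le_rfl).y_lt hcon.2
        omega
      have hf' : ¬ S.SameFront i q q' := fun h =>
        hx (S.motion i q hi.1 q' hi.2.1 h.1 h.2)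
      -- the interval of common waves does not grow
      have hsub : S.common (i + 1) q q' ⊆ S.common i q q' := by
        intro z hz
        obtain ⟨h1, h2⟩ := mem_common.1 hz
        rcases hc.2.2.2 z h1.1 with h | h
        · have hne : S.x (i + 1) z ≠ S.x (i + 1) q' := fun he =>
            hx ((eq_of_btw h1.1 h2.2.1 he hc.1 h hqq.le).trans he)
          have h3 := back h2 hne
          exact mem_common.2 ⟨h3.btw h3.1 hi'.1 le_rfl (h.trans hqq.le) h hqq.le, h3⟩
        · have hne : S.x (i + 1) z ≠ S.x (i + 1) q := fun he =>
            hx (eq_of_btw h1.2.1 h1.1 he.symm hc.2.1 hqq.le h).symm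
          have h3 := back h1 hne
          exact mem_common.2 ⟨h3, h3.symm.btw h3.1 hi'.2.1 (hqq.le.trans h) le_rfl hqq.le h⟩
      rw [hc.y_eq hi]
      exact (ih q q' hc' hi' hf').restrict hc' hi' (hsub hab.1) (hsub hab.2.1) rfl rfl
        (hab.2.2 q (left_mem_common hi)).1 (hab.2.2 q' (right_mem_common hi)).2
    intro p p' hc hi hf
    by_cases hx : S.x (i + 1) p = S.x (i + 1) p'
    · exact divided_of_same_position hdiff hc hx (fun hv => hf ⟨hx, hv⟩)
    · exact hdiff p p' hc hi hx

end WaveSystem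

end WFT

namespace WFT

namespace WaveSystem

variable {α : Type*} [LinearOrder α] {S : WaveSystem α} {i : ℕ} {s s' z z' p p' a b : α}

/-- `divided_of_not_sameFront` on the interval that belongs to a pair of waves on both sides of the
boundary: their common waves have also interacted with the neighbours of the boundary. -/
theorem sl_lt_of_btw (h : S.Inter i s s') (hc : S.Cons i p p') (hsp : s ≤ p) (hps : p' ≤ s')
    (hf : ¬ S.SameFront i p p') (hab : Ext (S.common i s s') a b) :
    sl (S.F s) (S.y a - 1) (S.y b) (S.y p) < sl (S.F s) (S.y a - 1) (S.y b) (S.y p + 1) := by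
  have hpp := hc.2.2.1.le
  have hi : S.Inter i p p' := h.btw hc.1 hc.2.1 hsp (hpp.trans hps) (hsp.trans hpp) hps
  have hsub : ∀ z ∈ S.common i s s', z ∈ S.common i p p' := by
    intro z hz
    obtain ⟨h1, h2⟩ := mem_common.1 hz
    rcases hc.2.2.2 z h1.1 with hzp | hzp
    · have l := hzp.trans (hpp.trans hps)
      exact mem_common.2 ⟨h2.btw h1.1 hc.1 le_rfl l hzp (hpp.trans hps),
        h2.btw h1.1 hc.2.1 le_rfl l (hzp.trans hpp) hps⟩
    · have l := hsp.trans (hpp.trans hzp)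
      exact mem_common.2 ⟨h1.symm.btw h1.1 hc.1 l le_rfl hsp (hpp.trans hzp),
        h1.symm.btw h1.1 hc.2.1 l le_rfl (hsp.trans hpp) hzp⟩
  have hF : S.F s = S.F p :=
    (h.btw h.1 hc.1 le_rfl (hsp.trans (hpp.trans hps)) hsp (hpp.trans hps)).flux_eq
  rw [hF]
  exact (divided_of_not_sameFront i p p' hc hi hf).restrict hc hi (hsub a hab.1) (hsub b hab.2.1)
    rfl rfl ((hab.2.2 s (left_mem_common h)).1.trans hsp)
    (hps.trans (hab.2.2 s' (right_mem_common h)).2)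

/-- Between waves of different fronts there are two consecutive waves of different fronts. -/
theorem exists_cons_not_sameFront (hs : s ∈ S.W i) (hs' : s' ∈ S.W i) (hlt : s < s')
    (hf : ¬ S.SameFront i s s') :
    ∃ p p', S.Cons i p p' ∧ s ≤ p ∧ p' ≤ s' ∧ ¬ S.SameFront i p p' := by
  classical
  obtain ⟨p', hp', hmin⟩ := Finset.exists_min_image
    ((S.W i).filter (fun z => s < z ∧ ¬ S.SameFront i s z)) id ⟨s', by simp [hs', hlt, hf]⟩
  simp only [Finset.mem_filter, id] at hp' hmin
  obtain ⟨p, hc, hsp⟩ := exists_cons_left hp'.1 hs hp'.2.1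
  refine ⟨p, p', hc, hsp, hmin s' ⟨hs', hlt, hf⟩, fun h => ?_⟩
  rcases hsp.eq_or_lt with rfl | hsp
  · exact hp'.2.2 h
  · have : S.SameFront i s p := by
      by_contra hn
      exact absurd (hmin p ⟨hc.1, hsp, hn⟩) (not_le.2 hc.2.2.1)
    exact hp'.2.2 (this.trans h)

/-- If `s`, `s'` belong to different fronts, then every boundary between fronts in the interval
of the waves that have interacted with both is a strict contact point. -/
theorem sl_lt_of_mem_common (h : S.Inter i s s') (hlt : s < s') (hf : ¬ S.SameFront i s s')
    (hc : S.Cons i p p') (hp : p ∈ S.common i s s') (hp' : p' ∈ S.common i s s')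
    (hfp : ¬ S.SameFront i p p') (hab : Ext (S.common i s s') a b) :
    sl (S.F s) (S.y a - 1) (S.y b) (S.y p) < sl (S.F s) (S.y a - 1) (S.y b) (S.y p + 1) := by
  have hpp := hc.2.2.1.le
  have ma := mem_common.1 hab.1
  have mb := mem_common.1 hab.2.1
  have mp := mem_common.1 hp
  have mp' := mem_common.1 hp'
  have ha := hab.2.2 p hp
  have hb := hab.2.2 p' hp'
  have has := (hab.2.2 s (left_mem_common h)).1
  have hsb := (hab.2.2 s' (right_mem_common h)).2
  have hFp : S.F s = S.F p := mp.1.flux_eq.symm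
  obtain ⟨q, q', hq, hsq, hqs, hfq⟩ := exists_cons_not_sameFront h.1 h.2.1 hlt hf
  have hqq := hq.2.2.1.le
  have g := sl_lt_of_btw h hq hsq hqs hfq hab
  have mq := mem_common_of_btw h hq.1 hsq (hqq.trans hqs)
  have mq' := mem_common_of_btw h hq.2.1 (hsq.trans hqq) hqs
  have hyq : S.y q' = S.y q + 1 :=
    hq.y_eq (h.btw hq.1 hq.2.1 hsq (hqq.trans hqs) (hsq.trans hqq) hqs)
  have ya := y_le_of_mem_common hab.1 mq (hab.2.2 q mq).1
  have yb := y_le_of_mem_common mq' hab.2.1 (hab.2.2 q' mq').2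
  have gq := dEnv_eq_of_sl_lt (by omega) (by omega) g
  rcases hc.2.2.2 s' h.2.1 with h1 | h1
  · -- the boundary lies above `s'`
    have hsp : s ≤ p := hlt.le.trans h1
    have key : ∀ t ∈ S.W i, s ≤ t → t ≤ b → ∀ t' ∈ S.W i, s ≤ t' → t' ≤ b → S.Inter i t t' :=
      fun t ht l1 l2 t' ht' l1' l2' => mb.1.symm.btw ht ht' l1 l2 l1' l2'
    have hpb : p ≤ b := hpp.trans hb.2
    have hsp' : s ≤ p' := hsp.trans hpp
    have hq'p : q' ≤ p := hqs.trans h1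
    have hsq' : s ≤ q' := hsq.trans hqq
    have hq'b : q' ≤ b := hq'p.trans hpb
    have hi := key p hc.1 hsp hpb p' hc.2.1 hsp' hb.2
    have e := (divided_of_not_sameFront i p p' hc hi hfp).restrict hc hi (z := q') (z' := b)
      (mem_common.2 ⟨key q' hq.2.1 hsq' hq'b p hc.1 hsp hpb,
        key q' hq.2.1 hsq' hq'b p' hc.2.1 hsp' hb.2⟩)
      (mem_common.2 ⟨key b mb.1.1 (hsp.trans hpb) le_rfl p hc.1 hsp hpb,
        key b mb.1.1 (hsp.trans hpb) le_rfl p' hc.2.1 hsp' hb.2⟩)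
      (A := S.y q) (by omega) rfl hq'p hb.2
    have y1 := (key q' hq.2.1 hsq' hq'b p hc.1 hsp hpb).y_le hq'p
    have y2 := (key p' hc.2.1 hsp' hb.2 b mb.1.1 (hsp.trans hpb) le_rfl).y_le hb.2
    have y3 := hc.y_eq hi
    rw [← hFp] at e
    rwa [sl_restrict (by omega) (by omega) le_rfl gq (dEnv_right (by omega)) (by omega) (by omega),
      sl_restrict (by omega) (by omega) le_rfl gq (dEnv_right (by omega)) (by omega) (by omega)]
      at e
  · rcases hc.2.2.2 s h.1 with h2 | h2
    · exact sl_lt_of_btw h hc h2 h1 hfp hab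
    · -- the boundary lies below `s`
      have hps : p' ≤ s' := h2.trans hlt.le
      have key : ∀ t ∈ S.W i, a ≤ t → t ≤ s' → ∀ t' ∈ S.W i, a ≤ t' → t' ≤ s' → S.Inter i t t' :=
        fun t ht l1 l2 t' ht' l1' l2' => ma.2.btw ht ht' l1 l2 l1' l2'
      have hap' : a ≤ p' := ha.1.trans hpp
      have hpq : p' ≤ q := h2.trans hsq
      have hqs' : q ≤ s' := hqq.trans hqs
      have haq : a ≤ q := hap'.trans hpq
      have hi := key p hc.1 ha.1 (hpp.trans hps) p' hc.2.1 hap' hps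
      have e := (divided_of_not_sameFront i p p' hc hi hfp).restrict hc hi (z := a) (z' := q)
        (mem_common.2 ⟨key a ma.1.1 le_rfl (has.trans hlt.le) p hc.1 ha.1 (hpp.trans hps),
          key a ma.1.1 le_rfl (has.trans hlt.le) p' hc.2.1 hap' hps⟩)
        (mem_common.2 ⟨key q hq.1 haq hqs' p hc.1 ha.1 (hpp.trans hps),
          key q hq.1 haq hqs' p' hc.2.1 hap' hps⟩)
        (B := S.y q) rfl rfl ha.1 hpq
      have y1 := (key p' hc.2.1 hap' hps q hq.1 haq hqs').y_le hpq
      have y2 := (key a ma.1.1 le_rfl (has.trans hlt.le) p hc.1 ha.1 (hpp.trans hps)).y_le ha.1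
      have y3 := hc.y_eq hi
      rw [← hFp] at e
      rwa [sl_restrict (by omega) le_rfl (by omega) (dEnv_left (by omega)) gq (by omega) (by omega),
        sl_restrict (by omega) le_rfl (by omega) (dEnv_left (by omega)) gq (by omega) (by omega)]
        at e

open Classical in
/-- The waves in the front of `s`. -/
noncomputable def front (S : WaveSystem α) (i : ℕ) (s : α) : Finset α :=
  (S.W i).filter (fun z => S.SameFront i z s)

theorem mem_front : z ∈ S.front i s ↔ z ∈ S.W i ∧ S.SameFront i z s := by
  simp [front]

/-- The envelope on the interval of a wavefront is affine; its slope is the speed. -/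
theorem sl_front (hs : s ∈ S.W i) (hab : Ext (S.front i s) a b) {m : ℤ} (h1 : S.y a - 1 < m)
    (h2 : m ≤ S.y b) : sl (S.F s) (S.y a - 1) (S.y b) m = S.v i s := by
  obtain ⟨ha, hb, hz⟩ := hab
  rw [mem_front] at ha hb
  obtain ⟨z1, z2, hz1, hz2, hzz⟩ := exists_ext (K := (S.W i).filter (fun z => S.x i z = S.x i s))
    ⟨s, by simp [hs]⟩
  simp only [Finset.mem_filter] at hz1 hz2 hzz
  have sp : ∀ t ∈ S.W i, S.x i t = S.x i s →
      S.v i t = sl (S.F s) (S.y z1 - 1) (S.y z2) (S.y t) := by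
    intro t ht htx
    rw [S.speed i t ht z1 hz1.1 z2 hz2.1 (hz1.2.trans htx.symm) (hz2.2.trans htx.symm)
      (fun z hz hz' => hzz z ⟨hz, hz'.trans htx⟩), S.F_eq i t ht s hs htx]
  have key : ∀ t ∈ S.W i, S.x i t = S.x i s → ∀ t' ∈ S.W i, S.x i t' = S.x i s → S.Inter i t t' :=
    fun t ht h t' ht' h' => inter_of_eq ht ht' (h.trans h'.symm)
  have l1 := (hzz a ⟨ha.1, ha.2.1⟩).1
  have l2 := (hzz b ⟨hb.1, hb.2.1⟩).2
  have l3 := hz s (mem_front.2 ⟨hs, rfl, rfl⟩)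
  have y1 := (key z1 hz1.1 hz1.2 a ha.1 ha.2.1).y_le l1
  have y2 := (key b hb.1 hb.2.1 z2 hz2.1 hz2.2).y_le l2
  have y3 := (key a ha.1 ha.2.1 b hb.1 hb.2.1).y_le (l3.1.trans l3.2)
  -- both ends of the front are contact points of the envelope that the Riemann problem uses
  have ca : dEnv (S.F s) (S.y z1 - 1) (S.y z2) (S.y a - 1) = S.F s (S.y a - 1) := by
    rcases l1.eq_or_lt with h | hlt
    · rw [h]; exact dEnv_left (by omega)
    obtain ⟨q, hq, hzq⟩ := exists_cons_left ha.1 hz1.1 hlt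
    have hxq := eq_of_btw hz1.1 hs hz1.2 hq.1 hzq (hq.2.2.1.le.trans l3.1)
    have hxq' := hxq.trans hz1.2
    have hyq := hq.y_eq (key q hq.1 hxq' a ha.1 ha.2.1)
    have y4 := (key z1 hz1.1 hz1.2 q hq.1 hxq').y_le hzq
    have hlt : sl (S.F s) (S.y z1 - 1) (S.y z2) (S.y q) <
        sl (S.F s) (S.y z1 - 1) (S.y z2) (S.y q + 1) := by
      rw [← hyq, ← sp q hq.1 hxq', ← sp a ha.1 ha.2.1]
      refine lt_of_le_of_ne (v_mono hq.1 ha.1 (hxq'.trans ha.2.1.symm) hq.2.2.1.le) fun he => ?_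
      exact absurd (hz q (mem_front.2 ⟨hq.1, hxq', he.trans ha.2.2⟩)).1 (not_le.2 hq.2.2.1)
    have := dEnv_eq_of_sl_lt (by omega) (by omega) hlt
    rwa [show S.y a - 1 = S.y q by omega]
  have cb : dEnv (S.F s) (S.y z1 - 1) (S.y z2) (S.y b) = S.F s (S.y b) := by
    rcases l2.eq_or_lt with h | hlt
    · rw [h]; exact dEnv_right (by omega)
    obtain ⟨q, hq, hqz⟩ := exists_cons_right hb.1 hz2.1 hlt
    have hxq' := eq_of_btw hs hz2.1 hz2.2.symm hq.2.1 (l3.2.trans hq.2.2.1.le) hqz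
    have hyq := hq.y_eq (key b hb.1 hb.2.1 q hq.2.1 hxq')
    have y4 := (key q hq.2.1 hxq' z2 hz2.1 hz2.2).y_le hqz
    have hlt : sl (S.F s) (S.y z1 - 1) (S.y z2) (S.y b) <
        sl (S.F s) (S.y z1 - 1) (S.y z2) (S.y b + 1) := by
      rw [← hyq, ← sp q hq.2.1 hxq', ← sp b hb.1 hb.2.1]
      refine lt_of_le_of_ne (v_mono hb.1 hq.2.1 (hb.2.1.trans hxq'.symm) hq.2.2.1.le) fun he => ?_
      exact absurd (hz q (mem_front.2 ⟨hq.2.1, hxq', he.symm.trans hb.2.2⟩)).2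
        (not_le.2 hq.2.2.1)
    exact dEnv_eq_of_sl_lt (by omega) (by omega) hlt
  rw [sl_restrict (by omega) (by omega) y2 ca cb h1 h2]
  have e1 := sl_mono (F := S.F s) (A := S.y z1 - 1) (B := S.y z2) (m := S.y a) (m' := m)
    (by omega) (by omega) (by omega)
  have e2 := sl_mono (F := S.F s) (A := S.y z1 - 1) (B := S.y z2) (m := m) (m' := S.y b)
    (by omega) (by omega) (by omega)
  rw [← sp a ha.1 ha.2.1, ha.2.2] at e1
  rw [← sp b hb.1 hb.2.1, hb.2.2] at e2
  exact le_antisymm e2 e1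

/-- The waves of a wavefront have equal slopes in the envelope on every larger interval. -/
theorem sl_eq_of_sameFront (hs : s ∈ S.W i) (hs' : s' ∈ S.W i) (hle : s ≤ s')
    (hf : S.SameFront i s s') (hab : Ext (S.front i s) a b) {A B : ℤ} (hA : A ≤ S.y a - 1)
    (hB : S.y b ≤ B) : sl (S.F s) A B (S.y s) = sl (S.F s) A B (S.y s') := by
  have ms := mem_front.2 ⟨hs, (⟨rfl, rfl⟩ : S.SameFront i s s)⟩
  have ms' := mem_front.2 ⟨hs', hf.symm⟩
  have ma := mem_front.1 hab.1
  have mb := mem_front.1 hab.2.1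
  have y1 := (inter_of_eq ma.1 hs ma.2.1).y_le (hab.2.2 s ms).1
  have y2 := (inter_of_eq hs' mb.1 (hf.1.symm.trans mb.2.1.symm)).y_le (hab.2.2 s' ms').2
  have y3 := (inter_of_eq hs hs' hf.1).y_le hle
  refine le_antisymm (sl_mono (by omega) y3 (by omega)) ?_
  have := sl_sub_sl_mono (F := S.F s) hA hB (m := S.y s) (m' := S.y s') (by omega) y3 y2
  rw [sl_front hs hab (by omega) (by omega), sl_front hs hab (by omega) (by omega)] at this
  linarith

/-! ### The increment of the weights at a cancellation -/

/-- The step from stage `j` to stage `j + 1` is a cancellation between the front of `zl` on the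
left and the front of `zr` on the right: waves are removed from the right end of the first and
from the left end of the second, and the waves that meet at stage `j + 1` come from the same
front. -/
structure Cancels (S : WaveSystem α) (j : ℕ) (zl zr : α) : Prop where
  left_mem : zl ∈ S.W j
  right_mem : zr ∈ S.W j
  lt : S.x j zl < S.x j zr
  removed : ∀ r ∈ S.W j, r ∉ S.W (j + 1) → S.SameFront j r zl ∨ S.SameFront j r zr
  left_lt : ∀ r ∈ S.W j, r ∉ S.W (j + 1) → S.SameFront j r zl →
    ∀ s ∈ S.W (j + 1), S.Inter j r s → s < r
  right_lt : ∀ r ∈ S.W j, r ∉ S.W (j + 1) → S.SameFront j r zr →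
    ∀ s ∈ S.W (j + 1), S.Inter j r s → r < s
  no_new : ∀ s ∈ S.W (j + 1), ∀ s' ∈ S.W (j + 1), S.x (j + 1) s = S.x (j + 1) s' →
    S.SameFront j s s'

variable {j : ℕ} {zl zr : α} {a' b' q : α}

theorem Cancels.inter_iff (hC : S.Cancels j zl zr) (hs : s ∈ S.W (j + 1)) (hs' : s' ∈ S.W (j + 1)) :
    S.Inter (j + 1) s s' ↔ S.Inter j s s' := by
  constructor
  · rintro ⟨-, -, k, hk, h⟩
    refine ⟨S.W_succ j hs, S.W_succ j hs', ?_⟩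
    rcases Nat.le_succ_iff.1 hk with hk | rfl
    · exact ⟨k, hk, h⟩
    · exact ⟨j, le_rfl, (hC.no_new s hs s' hs' h).1⟩
  · rintro ⟨-, -, k, hk, h⟩
    exact ⟨hs, hs', k, hk.trans (Nat.le_succ j), h⟩

theorem Cancels.mem_common_iff (hC : S.Cancels j zl zr) (hs : s ∈ S.W (j + 1))
    (hs' : s' ∈ S.W (j + 1)) :
    z ∈ S.common (j + 1) s s' ↔ z ∈ S.common j s s' ∧ z ∈ S.W (j + 1) := by
  rw [mem_common, mem_common]
  constructor
  · rintro ⟨h1, h2⟩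
    exact ⟨⟨(hC.inter_iff h1.1 hs).1 h1, (hC.inter_iff h1.1 hs').1 h2⟩, h1.1⟩
  · rintro ⟨⟨h1, h2⟩, h⟩
    exact ⟨(hC.inter_iff h hs).2 h1, (hC.inter_iff h hs').2 h2⟩

/-- If a wave of the left front has been removed from `common j s s'`, then so have been only waves
of the left front. -/
theorem Cancels.removed_left (hC : S.Cancels j zl zr) (hs : s ∈ S.W (j + 1))
    (hq : q ∈ S.common j s s') (hqr : q ∉ S.W (j + 1)) (hql : S.SameFront j q zl)
    (hz : z ∈ S.common j s s') (hzr : z ∉ S.W (j + 1)) : S.SameFront j z zl := by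
  have mq := mem_common.1 hq
  have mz := mem_common.1 hz
  rcases hC.removed z mz.1.1 hzr with h | h
  · exact h
  · have h1 := hC.left_lt q mq.1.1 hqr hql s hs mq.1
    have h2 := hC.right_lt z mz.1.1 hzr h s hs mz.1
    have := S.x_mono j mz.1.1 mq.1.1 (h2.trans h1).le
    rw [h.1, hql.1] at this
    exact absurd hC.lt (not_lt.2 this)

/-- The lower end of the interval of common waves is not affected by a removal from the left
front. -/
theorem Cancels.ext_left_eq (hC : S.Cancels j zl zr) (hs : s ∈ S.W (j + 1)) (hs' : s' ∈ S.W (j + 1))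
    (h : S.Inter j s s') (hq : q ∈ S.common j s s') (hqr : q ∉ S.W (j + 1))
    (hql : S.SameFront j q zl) (hab : Ext (S.common j s s') a b)
    (hab' : Ext (S.common (j + 1) s s') a' b') : a' = a := by
  have ma := mem_common.1 hab.1
  have hasW : a ∈ S.W (j + 1) := by
    by_contra har
    have h1 := hC.removed_left hs hq hqr hql hab.1 har
    exact absurd (hab.2.2 s (left_mem_common h)).1
      (not_le.2 (hC.left_lt a ma.1.1 har h1 s hs ma.1))
  have m' := (hC.mem_common_iff hs hs').1 hab'.1
  exact le_antisymm (hab'.2.2 a ((hC.mem_common_iff hs hs').2 ⟨hab.1, hasW⟩)).1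
    (hab.2.2 a' m'.1).1

/-- The lowest wave of the left front is not below `s` if `s` is not in that front. -/
theorem exists_front_boundary (hqW : q ∈ S.W j) (hsW : s ∈ S.W j) (hsq : s < q)
    (hsf : ¬ S.SameFront j s q) :
    ∃ p f, S.Cons j p f ∧ s ≤ p ∧ f ≤ q ∧ S.SameFront j f q ∧ ¬ S.SameFront j p q ∧
      ∀ z ∈ S.W j, S.SameFront j z q → f ≤ z := by
  obtain ⟨f, g, hf, -, hfg⟩ := exists_ext (K := S.front j q) ⟨q, mem_front.2 ⟨hqW, rfl, rfl⟩⟩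
  rw [mem_front] at hf
  have hfq := (hfg q (mem_front.2 ⟨hqW, rfl, rfl⟩)).1
  have hsf' : s < f := by
    by_contra! hfs
    exact hsf ((SameFront.btw hf.1 hqW hf.2 hsW hfs hsq.le).trans hf.2)
  obtain ⟨p, hc, hsp⟩ := exists_cons_left hf.1 hsW hsf'
  refine ⟨p, f, hc, hsp, hfq, hf.2, fun hp => ?_, fun z hz hzq => (hfg z (mem_front.2 ⟨hz, hzq⟩)).1⟩
  exact absurd (hfg p (mem_front.2 ⟨hc.1, hp⟩)).1 (not_le.2 hc.2.2.1)

/-- A removal from the left front does not change the slopes of waves of other fronts. -/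
theorem Cancels.sl_eq_of_not_left (hC : S.Cancels j zl zr) (hs : s ∈ S.W (j + 1))
    (hs' : s' ∈ S.W (j + 1)) (h : S.Inter j s s') (hlt : s < s') (hf : ¬ S.SameFront j s s')
    (hq : q ∈ S.common j s s') (hqr : q ∉ S.W (j + 1)) (hql : S.SameFront j q zl)
    (hs'l : ¬ S.SameFront j s' zl) (hab : Ext (S.common j s s') a b)
    (hab' : Ext (S.common (j + 1) s s') a' b') :
    sl (S.F s) (S.y a' - 1) (S.y b') (S.y s) = sl (S.F s) (S.y a - 1) (S.y b) (S.y s) ∧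
    sl (S.F s) (S.y a' - 1) (S.y b') (S.y s') = sl (S.F s) (S.y a - 1) (S.y b) (S.y s') := by
  have mq := mem_common.1 hq
  have hs'q := hC.left_lt q mq.1.1 hqr hql s' hs' mq.2
  obtain ⟨p, f, hc, hsp, hfq, hff, hpf, -⟩ := exists_front_boundary mq.1.1 h.2.1 hs'q
    (fun h' => hs'l (h'.trans hql))
  have hpq : p ≤ q := hc.2.2.1.le.trans hfq
  have mp := common_convex (right_mem_common h) hq hc.1 hsp hpq
  have mf := common_convex (right_mem_common h) hq hc.2.1 (hsp.trans hc.2.2.1.le) hfq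
  have g := sl_lt_of_mem_common h hlt hf hc mp mf (fun h' => hpf (h'.trans hff)) hab
  have hpW : p ∈ S.W (j + 1) := by
    by_contra hpr
    exact hpf ((hC.removed_left hs hq hqr hql mp hpr).trans hql.symm)
  have e := hC.ext_left_eq hs hs' h hq hqr hql hab hab'
  subst e
  have m' := (hC.mem_common_iff hs hs').1 hab'.2.1
  have hpb := (hab'.2.2 p ((hC.mem_common_iff hs hs').2 ⟨mp, hpW⟩)).2
  have hyf : S.y f = S.y p + 1 := hc.y_eq ⟨hc.1, hc.2.1, by
    obtain ⟨-, -, k, hk, hh⟩ := mq.2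
    have w := W_anti (S := S) hk
    refine ⟨k, hk, ?_⟩
    have e1 := eq_of_btw (w h.2.1) (w mq.1.1) hh.symm (w hc.1) hsp hpq
    have e2 := eq_of_btw (w h.2.1) (w mq.1.1) hh.symm (w hc.2.1) (hsp.trans hc.2.2.1.le) hfq
    rw [e1, e2]⟩
  have y0 := y_le_of_mem_common hab.1 (left_mem_common h) (hab.2.2 s (left_mem_common h)).1
  have y1 := h.y_lt hlt
  have y2 := y_le_of_mem_common (right_mem_common h) mp hsp
  have y3 := y_le_of_mem_common mp m'.1 hpb
  have y4 := y_le_of_mem_common m'.1 hab.2.1 (hab.2.2 b' m'.1).2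
  have y5 := y_le_of_mem_common mf hab.2.1 (hab.2.2 f mf).2
  have gc := dEnv_eq_of_sl_lt (by omega) (by omega) g
  have gc' : dEnv (S.F s) (S.y a' - 1) (S.y b') (S.y p) = S.F s (S.y p) := by
    rcases y3.eq_or_lt with h | h
    · rw [h]; exact dEnv_right (by omega)
    · exact dEnv_eq_of_sl_lt (by omega) h
        (sl_lt_of_subinterval le_rfl y4 (by omega) h g)
  have key : ∀ m, S.y a' - 1 < m → m ≤ S.y p →
      sl (S.F s) (S.y a' - 1) (S.y b') m = sl (S.F s) (S.y a' - 1) (S.y b) m := by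
    intro m h1 h2
    rw [← sl_restrict (by omega) le_rfl y3 (dEnv_left (by omega)) gc' h1 h2,
      ← sl_restrict (by omega) le_rfl (by omega) (dEnv_left (by omega)) gc h1 h2]
  exact ⟨key _ (by omega) (by omega), key _ (by omega) y2⟩

/-- A removal from the left front, the lower part of which survives: the interval of common waves
then ends at the last surviving wave `g` of the front. -/
theorem Cancels.ext_right_eq (hC : S.Cancels j zl zr) (hs : s ∈ S.W (j + 1))
    (hs' : s' ∈ S.W (j + 1)) (h : S.Inter j s s')
    (hq : q ∈ S.common j s s') (hqr : q ∉ S.W (j + 1)) (hql : S.SameFront j q zl)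
    (hs'l : S.SameFront j s' zl) (hab' : Ext (S.common (j + 1) s s') a' b')
    {g : α} (hg : g ∈ S.W (j + 1)) (hgl : S.SameFront j g zl)
    (hgmax : ∀ z ∈ S.W (j + 1), S.SameFront j z zl → z ≤ g) : b' = g := by
  have mq := mem_common.1 hq
  have w := S.W_succ j
  have hgq := hC.left_lt q mq.1.1 hqr hql g hg
    (inter_of_eq mq.1.1 (w hg) (hql.1.trans hgl.1.symm))
  have hs'g := hgmax s' hs' hs'l
  have mg := common_convex (right_mem_common h) hq (w hg) hs'g hgq.le
  have mb := (hC.mem_common_iff hs hs').1 hab'.2.1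
  have hgb := (hab'.2.2 g ((hC.mem_common_iff hs hs').2 ⟨mg, hg⟩)).2
  refine le_antisymm ?_ hgb
  rcases le_total b' q with hbq | hqb
  · exact hgmax b' mb.2 ((SameFront.btw (w hg) mq.1.1 (hgl.trans hql.symm) (w mb.2) hgb hbq).trans
      hgl)
  · have mb' := mem_common.1 mb.1
    have hsq := hC.left_lt q mq.1.1 hqr hql s hs mq.1
    have := hC.left_lt q mq.1.1 hqr hql b' mb.2
      (mb'.1.symm.btw mq.1.1 mb'.1.1 hsq.le hqb (hsq.le.trans hqb) le_rfl)
    exact absurd hqb (not_le.2 this)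

/-- The interval of common waves does not reach beyond the left front. -/
theorem Cancels.ext_right_le (hC : S.Cancels j zl zr) (hs : s ∈ S.W (j + 1))
    (hq : q ∈ S.common j s s') (hqr : q ∉ S.W (j + 1)) (hql : S.SameFront j q zl)
    (hab : Ext (S.common j s s') a b) : S.SameFront j b zl := by
  have mq := mem_common.1 hq
  have mb := mem_common.1 hab.2.1
  have hqb := (hab.2.2 q hq).2
  by_cases hbW : b ∈ S.W (j + 1)
  · have hsq := hC.left_lt q mq.1.1 hqr hql s hs mq.1
    have := hC.left_lt q mq.1.1 hqr hql b hbW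
      (mb.1.symm.btw mq.1.1 mb.1.1 hsq.le hqb (hsq.le.trans hqb) le_rfl)
    exact absurd hqb (not_le.2 this)
  · exact hC.removed_left hs hq hqr hql hab.2.1 hbW

end WaveSystem

end WFT

namespace WFT

namespace WaveSystem

open OrderDual

variable {α : Type*} [LinearOrder α] {S : WaveSystem α} {i : ℕ} {s s' z z' p p' a b : α}

/-- The mirror image of a system of waves: order, positions and cells are reflected. -/
def dual (S : WaveSystem α) : WaveSystem αᵒᵈ where
  W i := (S.W i).map toDual.toEmbedding
  x i s := - S.x i (ofDual s)
  v i s := - S.v i (ofDual s)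
  y s := 1 - S.y (ofDual s)
  F s m := S.F (ofDual s) (-m)
  W_succ i := Finset.map_subset_map.2 (S.W_succ i)
  x_mono i s hs s' hs' hle := by
    simp only [Finset.coe_map, Equiv.coe_toEmbedding, mem_image, Finset.mem_coe] at hs hs'
    obtain ⟨s, hs, rfl⟩ := hs
    obtain ⟨s', hs', rfl⟩ := hs'
    exact neg_le_neg (S.x_mono i hs' hs (toDual_le_toDual.1 hle))
  F_eq i s hs s' hs' h := by
    rw [Finset.mem_map_equiv] at hs hs'
    have := S.F_eq i _ hs _ hs' (neg_injective h)
    funext m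
    exact congrFun this (-m)
  card_class i s hs s' hs' hle h := by
    rw [Finset.mem_map_equiv] at hs hs'
    change ofDual s ∈ _ at hs
    change ofDual s' ∈ _ at hs'
    have := S.card_class i _ hs' _ hs hle (neg_injective h).symm
    rw [Finset.filter_map, Finset.card_map]
    have e : ((S.W i).filter (fun z => ofDual s' ≤ z ∧ z ≤ ofDual s)) =
        (S.W i).filter ((fun z => s ≤ z ∧ z ≤ s') ∘ toDual) := by
      ext z; simp only [Finset.mem_filter, Function.comp]; rw [and_comm (a := _ ≤ z)]; rfl
    exact e ▸ (by linarith [this] : (1 - S.y (ofDual s') - (1 - S.y (ofDual s)) + 1 : ℤ) =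
      (((S.W i).filter (fun z => ofDual s' ≤ z ∧ z ≤ ofDual s)).card : ℤ))
  card_le i s hs s' hs' hle h := by
    rw [Finset.mem_map_equiv] at hs hs'
    change ofDual s ∈ _ at hs
    change ofDual s' ∈ _ at hs'
    obtain ⟨k, hk, h⟩ := h
    have := S.card_le i _ hs' _ hs hle ⟨k, hk, (neg_injective h).symm⟩
    rw [Finset.filter_map, Finset.card_map]
    have e : ((S.W i).filter (fun z => ofDual s' ≤ z ∧ z ≤ ofDual s)) =
        (S.W i).filter ((fun z => s ≤ z ∧ z ≤ s') ∘ toDual) := by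
      ext z; simp only [Finset.mem_filter, Function.comp]; rw [and_comm (a := _ ≤ z)]; rfl
    exact e ▸ (by linarith [this] : (1 - S.y (ofDual s') - (1 - S.y (ofDual s)) + 1 : ℤ) ≤
      (((S.W i).filter (fun z => ofDual s' ≤ z ∧ z ≤ ofDual s)).card : ℤ))
  speed i s hs a ha b hb hxa hxb h := by
    rw [Finset.mem_map_equiv] at hs ha hb
    change ofDual s ∈ _ at hs
    change ofDual a ∈ _ at ha
    change ofDual b ∈ _ at hb
    have key : ∀ z ∈ S.W i, S.x i z = S.x i (ofDual s) → ofDual b ≤ z ∧ z ≤ ofDual a := by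
      intro z hz hzs
      have := h (toDual z) (by simpa using hz) (by simp [hzs])
      exact ⟨this.2, this.1⟩
    have h1 := S.speed i _ hs _ hb _ ha (neg_injective hxb) (neg_injective hxa) key
    have l := key _ hs rfl
    have y1 := (inter_of_eq hb hs (neg_injective hxb)).y_le l.1
    have y2 := (inter_of_eq hs ha (neg_injective hxa).symm).y_le l.2
    have h2 := sl_reflect (F := S.F (ofDual s)) (A := S.y (ofDual b) - 1) (B := S.y (ofDual a))
      (m := S.y (ofDual s)) (by omega) y2
    change - S.v i (ofDual s) = _
    have h3 : S.v i (ofDual s) = sl (S.F (ofDual s)) (S.y (ofDual b) - 1) (S.y (ofDual a))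
      (S.y (ofDual s)) := h1
    rw [h3, ← h2]
    congr 1 <;> ring
  motion i s hs s' hs' h h' := by
    rw [Finset.mem_map_equiv] at hs hs'
    have := S.motion i _ hs _ hs' (neg_injective h) (neg_injective h')
    exact congrArg Neg.neg this

theorem mem_dual_W {s : α} : toDual s ∈ S.dual.W i ↔ s ∈ S.W i := by
  simp [dual]

theorem inter_dual : S.dual.Inter i (toDual s) (toDual s') ↔ S.Inter i s s' := by
  simp only [Inter, mem_dual_W]
  simp [dual]

theorem sameFront_dual : S.dual.SameFront i (toDual s) (toDual s') ↔ S.SameFront i s s' := by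
  simp [SameFront, dual]

theorem mem_common_dual :
    toDual z ∈ S.dual.common i (toDual s') (toDual s) ↔ z ∈ S.common i s s' := by
  rw [mem_common, mem_common, inter_dual, inter_dual, and_comm]

theorem ext_common_dual :
    Ext (S.dual.common i (toDual s') (toDual s)) (toDual b) (toDual a) ↔
      Ext (S.common i s s') a b := by
  simp only [Ext, mem_common_dual]
  constructor
  · rintro ⟨h1, h2, h3⟩
    exact ⟨h2, h1, fun z hz => (h3 (toDual z) (mem_common_dual.2 hz)).symm⟩
  · rintro ⟨h1, h2, h3⟩
    exact ⟨h2, h1, fun z hz => (h3 (ofDual z) (mem_common_dual.1 hz)).symm⟩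

variable {j : ℕ} {zl zr : α} {a' b' q : α} {K : ℝ}

theorem Cancels.dual (hC : S.Cancels j zl zr) : S.dual.Cancels j (toDual zr) (toDual zl) where
  left_mem := mem_dual_W.2 hC.right_mem
  right_mem := mem_dual_W.2 hC.left_mem
  lt := neg_lt_neg hC.lt
  removed := fun r hr hr' => by
    rw [← toDual_ofDual r, sameFront_dual, sameFront_dual]
    exact (hC.removed (ofDual r) (mem_dual_W.1 hr) (fun h => hr' (mem_dual_W.2 h))).symm
  left_lt := fun r hr hr' hf s hs hi =>
    hC.right_lt (ofDual r) (mem_dual_W.1 hr) (fun h => hr' (mem_dual_W.2 h)) (sameFront_dual.1 hf)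
      (ofDual s) (mem_dual_W.1 hs) (inter_dual.1 hi)
  right_lt := fun r hr hr' hf s hs hi =>
    hC.left_lt (ofDual r) (mem_dual_W.1 hr) (fun h => hr' (mem_dual_W.2 h)) (sameFront_dual.1 hf)
      (ofDual s) (mem_dual_W.1 hs) (inter_dual.1 hi)
  no_new := fun s hs s' hs' h =>
    sameFront_dual.2 (hC.no_new (ofDual s) (mem_dual_W.1 hs) (ofDual s') (mem_dual_W.1 hs')
      (neg_injective h))

/-- The difference of the slopes that the interval from `a` to `b` gives to `s` and `s'`: the
numerator of the weight of the pair. -/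
noncomputable def gap (S : WaveSystem α) (a b s s' : α) : ℝ :=
  sl (S.F s) (S.y a - 1) (S.y b) (S.y s') - sl (S.F s) (S.y a - 1) (S.y b) (S.y s)

theorem gap_dual (h : S.Inter i s s') (hab : Ext (S.common i s s') a b) :
    S.dual.gap (toDual b) (toDual a) (toDual s') (toDual s) = S.gap a b s s' := by
  have e : ∀ t, t ∈ S.common i s s' →
      sl (fun n => S.F s' (-n)) (1 - S.y b - 1) (1 - S.y a) (1 - S.y t) =
      - sl (S.F s) (S.y a - 1) (S.y b) (S.y t) := by
    intro t ht
    have y1 := y_le_of_mem_common hab.1 ht (hab.2.2 t ht).1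
    have y2 := y_le_of_mem_common ht hab.2.1 (hab.2.2 t ht).2
    rw [h.flux_eq, ← sl_reflect (by omega) y2]
    congr 1 <;> ring
  change sl (fun n => S.F s' (-n)) (1 - S.y b - 1) (1 - S.y a) (1 - S.y s) -
    sl (fun n => S.F s' (-n)) (1 - S.y b - 1) (1 - S.y a) (1 - S.y s') = _
  rw [e s (left_mem_common h), e s' (right_mem_common h), gap]; ring

/-- A removal from the left front does not change the gap of waves of other fronts. -/
theorem Cancels.gap_eq_left (hC : S.Cancels j zl zr) (hs : s ∈ S.W (j + 1))
    (hs' : s' ∈ S.W (j + 1)) (h : S.Inter j s s') (hlt : s < s') (hf : ¬ S.SameFront j s s')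
    (hq : q ∈ S.common j s s') (hqr : q ∉ S.W (j + 1)) (hql : S.SameFront j q zl)
    (hs'l : ¬ S.SameFront j s' zl) (hab : Ext (S.common j s s') a b)
    (hab' : Ext (S.common (j + 1) s s') a' b') : S.gap a' b' s s' = S.gap a b s s' := by
  obtain ⟨h1, h2⟩ := hC.sl_eq_of_not_left hs hs' h hlt hf hq hqr hql hs'l hab hab'
  rw [gap, gap, h1, h2]

theorem Cancels.gap_eq_right (hC : S.Cancels j zl zr) (hs : s ∈ S.W (j + 1))
    (hs' : s' ∈ S.W (j + 1)) (h : S.Inter j s s') (hlt : s < s') (hf : ¬ S.SameFront j s s')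
    (hq : q ∈ S.common j s s') (hqr : q ∉ S.W (j + 1)) (hqrr : S.SameFront j q zr)
    (hsr : ¬ S.SameFront j s zr) (hab : Ext (S.common j s s') a b)
    (hab' : Ext (S.common (j + 1) s s') a' b') : S.gap a' b' s s' = S.gap a b s s' := by
  rw [← gap_dual h hab, ← gap_dual ((hC.inter_iff hs hs').2 h) hab']
  exact hC.dual.gap_eq_left (mem_dual_W.2 hs') (mem_dual_W.2 hs) (inter_dual.2 h.symm)
    (toDual_lt_toDual.2 hlt) (fun h' => hf (sameFront_dual.1 h').symm) (mem_common_dual.2 hq)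
    (fun h' => hqr (mem_dual_W.1 h')) (sameFront_dual.2 hqrr) (fun h' => hsr (sameFront_dual.1 h'))
    (ext_common_dual.2 hab) (ext_common_dual.2 hab')

theorem gap_nonneg (h : S.Inter i s s') (hle : s ≤ s') (hab : Ext (S.common i s s') a b) :
    0 ≤ S.gap a b s s' := by
  have ms := left_mem_common h
  have ms' := right_mem_common h
  have y1 := y_le_of_mem_common hab.1 ms (hab.2.2 s ms).1
  have y2 := y_le_of_mem_common ms' hab.2.1 (hab.2.2 s' ms').2
  exact sub_nonneg.2 (sl_mono (by omega) (h.y_le hle) y2)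

theorem gap_eq_zero_of_sameFront (hs : s ∈ S.W i) (hs' : s' ∈ S.W i) (hle : s ≤ s')
    (hf : S.SameFront i s s') {k : ℕ} (hab : Ext (S.common k s s') a b)
    (hsub : ∀ z ∈ S.W i, S.SameFront i z s → z ∈ S.common k s s') : S.gap a b s s' = 0 := by
  obtain ⟨f, g, hfg⟩ := exists_ext (K := S.front i s) ⟨s, mem_front.2 ⟨hs, rfl, rfl⟩⟩
  have mf := mem_front.1 hfg.1
  have mg := mem_front.1 hfg.2.1
  have mf' := hsub f mf.1 mf.2
  have mg' := hsub g mg.1 mg.2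
  have y1 := y_le_of_mem_common hab.1 mf' (hab.2.2 f mf').1
  have y2 := y_le_of_mem_common mg' hab.2.1 (hab.2.2 g mg').2
  rw [gap, sl_eq_of_sameFront hs hs' hle hf hfg (by omega) y2, sub_self]

/-- Two waves of one front have no gap before a cancellation, and none after it unless the front
takes part in the cancellation. -/
theorem gap_eq_zero (hs : s ∈ S.W i) (hs' : s' ∈ S.W i) (hle : s ≤ s')
    (hf : S.SameFront i s s') (hab : Ext (S.common i s s') a b) : S.gap a b s s' = 0 :=
  gap_eq_zero_of_sameFront hs hs' hle hf hab fun _ hz h => mem_common.2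
    ⟨inter_of_eq hz hs h.1, inter_of_eq hz hs' (h.1.trans hf.1)⟩

/-- The increment of the gaps is dominated by the increments of a monotone function `h`, namely the
change of speed of the front that survives the cancellation. Its oscillation is controlled by
the number of removed waves. Here the surviving front is the left one. -/
theorem Cancels.exists_monotoneOn_left (hC : S.Cancels j zl zr)
    (hright : ∀ s ∈ S.W (j + 1), ¬ S.SameFront j s zr) (hK : 0 ≤ K)
    (hF : ∀ s, SlopeLip K (S.F s)) :
    ∃ h : α → ℝ, MonotoneOn h (S.W (j + 1)) ∧
      (∀ s ∈ S.W (j + 1), ∀ s' ∈ S.W (j + 1),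
        h s' - h s ≤ K * ((S.W j \ S.W (j + 1)).card : ℝ)) ∧
      ∀ s ∈ S.W (j + 1), ∀ s' ∈ S.W (j + 1), s < s' → S.Inter j s s' →
        ∀ a b a' b', Ext (S.common j s s') a b → Ext (S.common (j + 1) s s') a' b' →
          S.gap a' b' s s' - S.gap a b s s' ≤ h s' - h s := by
  have w := S.W_succ j
  have hH : 0 ≤ K * ((S.W j \ S.W (j + 1)).card : ℝ) := by positivity
  -- the pairs whose gap does not increase
  have easy : ∀ s ∈ S.W (j + 1), ∀ s' ∈ S.W (j + 1), s < s' → S.Inter j s s' →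
      ∀ a b a' b', Ext (S.common j s s') a b → Ext (S.common (j + 1) s s') a' b' →
      (∀ q ∈ S.common j s s', q ∉ S.W (j + 1) → S.SameFront j q zl → ¬ S.SameFront j s' zl) →
      S.gap a' b' s s' - S.gap a b s s' ≤ 0 := by
    intro s hs s' hs' hlt hi a b a' b' hab hab' hnl
    by_cases hf : S.SameFront j s s'
    · have hgap : S.gap a b s s' = 0 := gap_eq_zero (w hs) (w hs') hlt.le hf hab
      by_cases hrem : ∀ z ∈ S.W j, S.SameFront j z s → z ∈ S.W (j + 1)
      · rw [hgap, gap_eq_zero_of_sameFront (w hs) (w hs') hlt.le hf hab' fun z hz hzs => ?_,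
          sub_zero]
        exact (hC.mem_common_iff hs hs').2 ⟨mem_common.2 ⟨inter_of_eq hz (w hs) hzs.1,
          inter_of_eq hz (w hs') (hzs.1.trans hf.1)⟩, hrem z hz hzs⟩
      · exfalso
        push Not at hrem
        obtain ⟨z, hz, hzs, hzr⟩ := hrem
        rcases hC.removed z hz hzr with h | h
        · exact hnl z (mem_common.2 ⟨inter_of_eq hz (w hs) hzs.1,
            inter_of_eq hz (w hs') (hzs.1.trans hf.1)⟩) hzr h ((hzs.trans hf).symm.trans h)
        · exact hright s hs (hzs.symm.trans h)
    · by_cases hq : ∃ q ∈ S.common j s s', q ∉ S.W (j + 1)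
      · obtain ⟨q, hq, hqr⟩ := hq
        rcases hC.removed q (mem_common.1 hq).1.1 hqr with h | h
        · rw [hC.gap_eq_left hs hs' hi hlt hf hq hqr h (hnl q hq hqr h) hab hab', sub_self]
        · rw [hC.gap_eq_right hs hs' hi hlt hf hq hqr h (hright s hs) hab hab', sub_self]
      · push Not at hq
        have ma := (hC.mem_common_iff hs hs').2 ⟨hab.1, hq a hab.1⟩
        have mb := (hC.mem_common_iff hs hs').2 ⟨hab.2.1, hq b hab.2.1⟩
        have ma' := ((hC.mem_common_iff hs hs').1 hab'.1).1
        have mb' := ((hC.mem_common_iff hs hs').1 hab'.2.1).1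
        have e1 : a' = a := le_antisymm (hab'.2.2 a ma).1 (hab.2.2 a' ma').1
        have e2 : b' = b := le_antisymm (hab.2.2 b' mb').2 (hab'.2.2 b mb).2
        rw [e1, e2, sub_self]
  by_cases hX : ∃ z ∈ S.W (j + 1), S.SameFront j z zl
  swap
  · push Not at hX
    refine ⟨fun _ => 0, fun _ _ _ _ _ => le_rfl, fun _ _ _ _ => by simpa using hH, ?_⟩
    intro s hs s' hs' hlt hi a b a' b' hab hab'
    simpa using easy s hs s' hs' hlt hi a b a' b' hab hab' (fun _ _ _ _ => hX s' hs')
  -- `f` and `t` are the extreme waves of the left front, `g` is the last one that survives.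
  obtain ⟨f, t, hft⟩ := exists_ext (K := S.front j zl)
    ⟨zl, mem_front.2 ⟨hC.left_mem, rfl, rfl⟩⟩
  have hf := mem_front.1 hft.1
  have ht := mem_front.1 hft.2.1
  obtain ⟨f', g, hfg'⟩ := exists_ext (K := (S.front j zl).filter (· ∈ S.W (j + 1))) (by
    obtain ⟨z, hz, hzl⟩ := hX
    exact ⟨z, Finset.mem_filter.2 ⟨mem_front.2 ⟨w hz, hzl⟩, hz⟩⟩)
  have hg := Finset.mem_filter.1 hfg'.2.1
  have hgl := (mem_front.1 hg.1).2
  have hgmax : ∀ z ∈ S.W (j + 1), S.SameFront j z zl → z ≤ g := fun z hz hzl =>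
    (hfg'.2.2 z (Finset.mem_filter.2 ⟨mem_front.2 ⟨w hz, hzl⟩, hz⟩)).2
  have hfW : f ∈ S.W (j + 1) := by
    by_contra hfr
    have h1 := hC.left_lt f hf.1 hfr hf.2 g hg.2
      (inter_of_eq hf.1 (w hg.2) (hf.2.1.trans hgl.1.symm))
    exact absurd (hft.2.2 g hg.1).1 (not_le.2 h1)
  have hfg : f ≤ g := (hft.2.2 g hg.1).1
  have hgt : g ≤ t := (hft.2.2 g hg.1).2
  have hxf : ∀ {z z'}, z ∈ S.W j → z' ∈ S.W j → S.SameFront j z zl → S.SameFront j z' zl →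
      S.Inter j z z' := fun hz hz' h h' => inter_of_eq hz hz' (h.1.trans h'.1.symm)
  have yfg := (hxf hf.1 (w hg.2) hf.2 hgl).y_le hfg
  have ygt := (hxf (w hg.2) ht.1 hgl ht.2).y_le hgt
  have hbtw : ∀ z ∈ S.W j, f ≤ z → z ≤ g → S.SameFront j z zl := fun z hz h1 h2 =>
    (SameFront.btw hf.1 (w hg.2) (hf.2.trans hgl.symm) hz h1 h2).trans hf.2
  set c := S.y f - 1 with hc
  set l := S.v j zl with hl
  have hlin : ∀ m, c < m → m ≤ S.y t → sl (S.F zl) c (S.y t) m = l := fun m h1 h2 =>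
    sl_front hC.left_mem hft h1 h2
  set σ : ℤ → ℝ := fun m => sl (S.F zl) c (S.y g) m with hσ
  set H : ℝ := K * ((S.y t : ℝ) - S.y g) with hHdef
  have hσl : ∀ m, c < m → m ≤ S.y g → l ≤ σ m := fun m h1 h2 => by
    rw [← hlin m h1 (h2.trans ygt)]
    exact sl_trim_top ygt h1 h2
  have hσH : ∀ m, c < m → m ≤ S.y g → σ m - l ≤ H := fun m h1 h2 => by
    rcases ygt.eq_or_lt with h | h
    · simp only [hσ, hHdef, h]
      rw [hlin m h1 (h2.trans ygt)]; simp
    · have := sl_trim_top_le (hF zl) h hlin h1 h2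
      simp only [hσ, hHdef]; linarith
  have hH0 : 0 ≤ H := mul_nonneg hK (sub_nonneg.2 (by exact_mod_cast ygt))
  have hHR : H ≤ K * ((S.W j \ S.W (j + 1)).card : ℝ) := by
    refine mul_le_mul_of_nonneg_left ?_ hK
    have h1 := (hxf (w hg.2) ht.1 hgl ht.2).card hgt
    have h2 : ((S.W j).filter (fun z => g ≤ z ∧ z ≤ t)) ⊆ insert g (S.W j \ S.W (j + 1)) := by
      intro z hz
      simp only [Finset.mem_filter] at hz
      rw [Finset.mem_insert, Finset.mem_sdiff]
      rcases hz.2.1.eq_or_lt with h | h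
      · exact Or.inl h.symm
      · refine Or.inr ⟨hz.1, fun hzW => ?_⟩
        exact absurd (hgmax z hzW ((SameFront.btw (w hg.2) ht.1 (hgl.trans ht.2.symm) hz.1 hz.2.1
          hz.2.2).trans hgl)) (not_le.2 h)
    have h3 := (Finset.card_le_card h2).trans (Finset.card_insert_le _ _)
    have h4 : S.y t - S.y g ≤ ((S.W j \ S.W (j + 1)).card : ℤ) := by omega
    exact_mod_cast h4
  classical
  let h : α → ℝ := fun s => if s < f then 0 else if s ≤ g then σ (S.y s) - l else H
  have hlow : ∀ s, s < f → h s = 0 := fun s hs => by simp [h, hs]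
  have hmid : ∀ s, f ≤ s → s ≤ g → h s = σ (S.y s) - l := fun s h1 h2 => by
    simp [h, not_lt.2 h1, h2]
  have hup : ∀ s, g < s → h s = H := fun s h1 => by
    simp [h, not_lt.2 (hfg.trans h1.le), not_le.2 h1]
  have hyr : ∀ s ∈ S.W j, f ≤ s → s ≤ g → c < S.y s ∧ S.y s ≤ S.y g := fun s hs h1 h2 => by
    have e1 := (hxf hf.1 hs hf.2 (hbtw s hs h1 h2)).y_le h1
    exact ⟨by omega, (hxf hs (w hg.2) (hbtw s hs h1 h2) hgl).y_le h2⟩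
  have hrange : ∀ s ∈ S.W j, 0 ≤ h s ∧ h s ≤ H := by
    intro s hs
    rcases lt_or_ge s f with h1 | h1
    · rw [hlow s h1]; exact ⟨le_rfl, hH0⟩
    rcases le_or_gt s g with h2 | h2
    · obtain ⟨e1, e2⟩ := hyr s hs h1 h2
      rw [hmid s h1 h2]
      exact ⟨sub_nonneg.2 (hσl _ e1 e2), hσH _ e1 e2⟩
    · rw [hup s h2]; exact ⟨hH0, le_rfl⟩
  have hmono : ∀ s ∈ S.W j, ∀ s' ∈ S.W j, s ≤ s' → h s ≤ h s' := by
    intro s hs s' hs' hle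
    rcases lt_or_ge s f with h1 | h1
    · rw [hlow s h1]; exact (hrange s' hs').1
    rcases le_or_gt s' g with h2 | h2
    · have e1 := hyr s hs h1 (hle.trans h2)
      have e2 := hyr s' hs' (h1.trans hle) h2
      rw [hmid s h1 (hle.trans h2), hmid s' (h1.trans hle) h2]
      have := (hxf hs hs' (hbtw s hs h1 (hle.trans h2)) (hbtw s' hs' (h1.trans hle) h2)).y_le hle
      exact sub_le_sub_right (sl_mono e1.1 this e2.2) _
    · rw [hup s' h2]; exact (hrange s hs).2
  refine ⟨h, fun s hs s' hs' hle => hmono s (w hs) s' (w hs') hle, fun s hs s' hs' => ?_, ?_⟩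
  · linarith [(hrange s (w hs)).1, (hrange s' (w hs')).2]
  intro s hs s' hs' hlt hi a b a' b' hab hab'
  by_cases hex : ∃ q ∈ S.common j s s', q ∉ S.W (j + 1) ∧ S.SameFront j q zl ∧ S.SameFront j s' zl
  swap
  · push Not at hex
    exact (easy s hs s' hs' hlt hi a b a' b' hab hab' hex).trans
      (sub_nonneg.2 (hmono s (w hs) s' (w hs') hlt.le))
  obtain ⟨q, hq, hqr, hql, hs'l⟩ := hex
  have mq := mem_common.1 hq
  have hfs' : f ≤ s' := (hft.2.2 s' (mem_front.2 ⟨w hs', hs'l⟩)).1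
  have hs'g := hgmax s' hs' hs'l
  have eF : S.F s = S.F zl :=
    hi.flux_eq.trans (S.F_eq j s' (w hs') zl hC.left_mem hs'l.1)
  have eb : b' = g := hC.ext_right_eq hs hs' hi hq hqr hql hs'l hab' hg.2 hgl hgmax
  have ys' := hyr s' (w hs') hfs' hs'g
  have ma' := (hC.mem_common_iff hs hs').1 hab'.1
  rw [hmid s' hfs' hs'g]
  subst eb
  rcases le_or_gt f s with hfs | hsf
  · -- both waves belong to the left front
    have hsg := hlt.le.trans hs'g
    have hsl := hbtw s (w hs) hfs hsg
    have ys := hyr s (w hs) hfs hsg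
    have mf : f ∈ S.common (j + 1) s s' := (hC.mem_common_iff hs hs').2
      ⟨mem_common.2 ⟨hxf hf.1 (w hs) hf.2 hsl, hxf hf.1 (w hs') hf.2 hs'l⟩, hfW⟩
    have yaf := y_le_of_mem_common hab'.1 mf (hab'.2.2 f mf).1
    rw [gap_eq_zero (w hs) (w hs') hlt.le (hsl.trans hs'l.symm) hab, sub_zero, hmid s hfs hsg,
      gap, eF]
    have := sl_sub_sl_mono (F := S.F zl) (A := S.y a' - 1) (B := S.y b') (A' := c) (B' := S.y b')
      (m := S.y s) (m' := S.y s') (by omega) le_rfl ys.1 (hi.y_le hlt.le) ys'.2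
    simp only [hσ]; linarith
  · -- only `s'` belongs to the left front
    have hsl : ¬ S.SameFront j s zl := fun hsl =>
      absurd (hft.2.2 s (mem_front.2 ⟨w hs, hsl⟩)).1 (not_le.2 hsf)
    rw [hlow s hsf]
    obtain ⟨p, hcons, hsp⟩ := exists_cons_left hf.1 (w hs) hsf
    have hpl : ¬ S.SameFront j p f := fun hpl =>
      absurd (hft.2.2 p (mem_front.2 ⟨hcons.1, hpl.trans hf.2⟩)).1 (not_le.2 hcons.2.2.1)
    have hps' := hcons.2.2.1.le.trans hfs'
    have e := hC.ext_left_eq hs hs' hi hq hqr hql hab hab'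
    subst e
    have gp := sl_lt_of_btw hi hcons hsp hfs' hpl hab
    have mp := mem_common_of_btw hi hcons.1 hsp hps'
    have mf := mem_common_of_btw hi hcons.2.1 hsf.le hfs'
    have hyf : S.y f = S.y p + 1 := hcons.y_eq
      (hi.btw hcons.1 hcons.2.1 hsp hps' hsf.le hfs')
    have hbl := hC.ext_right_le hs hq hqr hql hab
    have mb := mem_common.1 hab.2.1
    have ybt := (hxf mb.1.1 ht.1 hbl ht.2).y_le (hft.2.2 b (mem_front.2 ⟨mb.1.1, hbl⟩)).2
    have mb' := (hC.mem_common_iff hs hs').1 hab'.2.1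
    have yb := y_le_of_mem_common mb'.1 hab.2.1 (hab.2.2 b' mb'.1).2
    have ya := y_le_of_mem_common hab.1 (left_mem_common hi) (hab.2.2 s (left_mem_common hi)).1
    have ysp := y_le_of_mem_common (left_mem_common hi) mp hsp
    have ecp : c = S.y p := by omega
    rw [← ecp] at gp ysp
    have gc := dEnv_eq_of_sl_lt (by omega) (by omega) gp
    have gp' := sl_lt_of_subinterval (le_refl (S.y a' - 1)) yb (by omega) (by omega) gp
    have gc' := dEnv_eq_of_sl_lt (by omega) (by omega) gp'
    rw [gap, gap,
      ← sl_restrict (n := S.y s) (by omega) le_rfl (by omega) (dEnv_left (by omega)) gc (by omega)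
        (by omega),
      ← sl_restrict (n := S.y s) (by omega) le_rfl (by omega) (dEnv_left (by omega)) gc' (by omega)
        (by omega),
      ← sl_restrict (n := S.y s') (by omega) (by omega) le_rfl gc (dEnv_right (by omega)) (by omega)
        (by omega),
      ← sl_restrict (n := S.y s') (by omega) (by omega) le_rfl gc' (dEnv_right (by omega))
        (by omega) (by omega), eF]
    have h1 := sl_trim_top (F := S.F zl) (A := c) ybt ys'.1 (by omega)
    rw [hlin _ ys'.1 (by omega)] at h1
    simp only [hσ]; linarith

/-- As `exists_monotoneOn_left`, with the surviving front on either side. -/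
theorem Cancels.exists_monotoneOn (hC : S.Cancels j zl zr)
    (hone : (∀ s ∈ S.W (j + 1), ¬ S.SameFront j s zr) ∨ (∀ s ∈ S.W (j + 1), ¬ S.SameFront j s zl))
    (hK : 0 ≤ K) (hF : ∀ s, SlopeLip K (S.F s)) :
    ∃ h : α → ℝ, MonotoneOn h (S.W (j + 1)) ∧
      (∀ s ∈ S.W (j + 1), ∀ s' ∈ S.W (j + 1),
        h s' - h s ≤ K * ((S.W j \ S.W (j + 1)).card : ℝ)) ∧
      ∀ s ∈ S.W (j + 1), ∀ s' ∈ S.W (j + 1), s < s' → S.Inter j s s' →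
        ∀ a b a' b', Ext (S.common j s s') a b → Ext (S.common (j + 1) s s') a' b' →
          S.gap a' b' s s' - S.gap a b s s' ≤ h s' - h s := by
  rcases hone with hone | hone
  · exact hC.exists_monotoneOn_left hone hK hF
  obtain ⟨h, h1, h2, h3⟩ := hC.dual.exists_monotoneOn_left
    (fun s hs hf => hone (ofDual s) (mem_dual_W.1 hs) (sameFront_dual.1 hf)) hK
    (fun s => (hF (ofDual s)).reflect)
  refine ⟨fun s => - h (toDual s), ?_, ?_, ?_⟩
  · intro s hs s' hs' hle
    exact neg_le_neg (h1 (mem_dual_W.2 hs') (mem_dual_W.2 hs) (toDual_le_toDual.2 hle))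
  · intro s hs s' hs'
    have := h2 (toDual s') (mem_dual_W.2 hs') (toDual s) (mem_dual_W.2 hs)
    have e : (S.dual.W j \ S.dual.W (j + 1)).card = (S.W j \ S.W (j + 1)).card := by
      simp only [WaveSystem.dual, ← Finset.map_sdiff, Finset.card_map]
    rw [e] at this
    linarith
  · intro s hs s' hs' hlt hi a b a' b' hab hab'
    have := h3 (toDual s') (mem_dual_W.2 hs') (toDual s) (mem_dual_W.2 hs)
      (toDual_lt_toDual.2 hlt) (inter_dual.2 hi.symm) _ _ _ _ (ext_common_dual.2 hab)
      (ext_common_dual.2 hab')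
    rw [gap_dual hi hab, gap_dual ((hC.inter_iff hs hs').2 hi) hab'] at this
    linarith

end WaveSystem

end WFT

namespace WFT

/-! ### Summation over pairs of waves -/

theorem inv_succ_le_log_sub (n : ℕ) (hn : 0 < n) :
    1 / ((n : ℝ) + 1) ≤ Real.log (n + 1) - Real.log n := by
  have hn' : (0 : ℝ) < n := by exact_mod_cast hn
  have h := Real.add_one_le_exp (Real.log (n / (n + 1)))
  rw [Real.exp_log (by positivity), Real.log_div (by positivity) (by positivity)] at h
  have e : (n : ℝ) / (n + 1) = 1 - 1 / (n + 1) := by field_simp; ring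
  rw [e] at h
  linarith

theorem sum_range_inv_le (a B : ℕ) :
    ∑ b ∈ Finset.range B, 1 / ((a : ℝ) + b + 2) ≤ Real.log (a + 1 + B) - Real.log (a + 1) := by
  induction B with
  | zero => simp
  | succ B ih =>
    rw [Finset.sum_range_succ]
    have := inv_succ_le_log_sub (a + 1 + B) (by omega)
    push_cast at this ⊢
    rw [show (a : ℝ) + 1 + (B + 1) = a + 1 + B + 1 by ring]
    rw [show (a : ℝ) + B + 2 = a + 1 + B + 1 by ring]
    linarith

theorem sum_log_sub_eq (A B : ℕ) :
    ∑ a ∈ Finset.range A, (Real.log (a + 1 + B) - Real.log (a + 1)) =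
      Real.log ((A + B).choose A) := by
  induction A with
  | zero => simp
  | succ A ih =>
    rw [Finset.sum_range_succ, ih]
    have h := Nat.add_one_mul_choose_eq (A + B) A
    have h1 : 0 < (A + B).choose A := Nat.choose_pos (by omega)
    have h2 : 0 < (A + B + 1).choose (A + 1) := Nat.choose_pos (by omega)
    have h' : ((A : ℝ) + B + 1) * (A + B).choose A = (A + B + 1).choose (A + 1) * (A + 1) := by
      exact_mod_cast h
    have h3 : (0 : ℝ) < (A + B).choose A := by exact_mod_cast h1
    have h4 : (0 : ℝ) < (A + B + 1).choose (A + 1) := by exact_mod_cast h2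
    have h5 := congrArg Real.log h'
    rw [Real.log_mul (by positivity) h3.ne', Real.log_mul h4.ne' (by positivity)] at h5
    rw [show A + 1 + B = A + B + 1 by ring, show (A : ℝ) + 1 + B = A + B + 1 by ring]
    linarith

/-- The double sum is dominated by the logarithm of a binomial coefficient. -/
theorem sum_sum_inv_le (A B : ℕ) :
    ∑ a ∈ Finset.range A, ∑ b ∈ Finset.range B, 1 / ((a : ℝ) + b + 2) ≤
      (A + B : ℕ) * Real.log 2 := by
  refine (Finset.sum_le_sum fun a _ => sum_range_inv_le a B).trans ?_
  rw [sum_log_sub_eq, ← Real.log_pow]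
  have h1 : 0 < (A + B).choose A := Nat.choose_pos (by omega)
  apply Real.log_le_log (by exact_mod_cast h1)
  exact_mod_cast Nat.choose_le_two_pow _ _

/-- Summation by parts: only increments over a boundary between neighbours count, and the pairs
separated by a given boundary contribute at most `n * log 2`. -/
theorem sum_pairs_nat_le (n : ℕ) (g : ℕ → ℝ) (H : ℝ)
    (hg : ∀ i k, i ≤ k → k < n → g i ≤ g k) (hH : ∀ i k, i < n → k < n → g k - g i ≤ H) :
    ∑ i ∈ Finset.range n, ∑ k ∈ Finset.range n,
      (if i < k then (g k - g i) / ((k : ℝ) - i + 1) else 0) ≤ H * n * Real.log 2 := by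
  rcases Nat.eq_zero_or_pos n with rfl | hn
  · simp
  have step : ∀ i ∈ Finset.range n, ∀ k ∈ Finset.range n,
      (if i < k then (g k - g i) / ((k : ℝ) - i + 1) else 0) =
      ∑ m ∈ Finset.range (n - 1), (if i ≤ m ∧ m < k then
        (g (m + 1) - g m) * (1 / ((k : ℝ) - i + 1)) else 0) := by
    intro i _ k hk
    rw [Finset.mem_range] at hk
    split_ifs with h
    · rw [← Finset.sum_filter, ← Finset.sum_mul]
      have : (Finset.range (n - 1)).filter (fun m => i ≤ m ∧ m < k) = Finset.Ico i k := by
        ext m; simp only [Finset.mem_filter, Finset.mem_range, Finset.mem_Ico]; omega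
      rw [this, Finset.sum_Ico_sub g h.le, mul_one_div]
    · symm
      refine Finset.sum_eq_zero fun m _ => if_neg (by omega)
  rw [Finset.sum_congr rfl fun i hi => Finset.sum_congr rfl fun k hk => step i hi k hk]
  rw [Finset.sum_congr rfl fun i _ => Finset.sum_comm, Finset.sum_comm]
  have inner : ∀ m ∈ Finset.range (n - 1),
      (∑ i ∈ Finset.range n, ∑ k ∈ Finset.range n, (if i ≤ m ∧ m < k then
        (g (m + 1) - g m) * (1 / ((k : ℝ) - i + 1)) else 0)) ≤
      (g (m + 1) - g m) * (n * Real.log 2) := by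
    intro m hm
    rw [Finset.mem_range] at hm
    have e : (∑ i ∈ Finset.range n, ∑ k ∈ Finset.range n, (if i ≤ m ∧ m < k then
        (g (m + 1) - g m) * (1 / ((k : ℝ) - i + 1)) else 0)) =
        (g (m + 1) - g m) * ∑ i ∈ Finset.range (m + 1), ∑ k ∈ Finset.Ico (m + 1) n,
          1 / ((k : ℝ) - i + 1) := by
      rw [Finset.mul_sum]
      have h1 : (Finset.range n).filter (fun i => i ≤ m) = Finset.range (m + 1) := by
        ext i; simp only [Finset.mem_filter, Finset.mem_range]; omega
      have h2 : (Finset.range n).filter (fun k => m < k) = Finset.Ico (m + 1) n := by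
        ext i; simp only [Finset.mem_filter, Finset.mem_range, Finset.mem_Ico]; omega
      rw [← h1, ← h2, Finset.sum_filter]
      refine Finset.sum_congr rfl fun i _ => ?_
      by_cases h : i ≤ m
      · simp only [h, true_and, if_true]
        rw [← Finset.sum_filter, Finset.mul_sum]
      · simp [h]
    rw [e]
    refine mul_le_mul_of_nonneg_left ?_ (sub_nonneg.2 (hg m (m + 1) (by omega) (by omega)))
    have h3 := sum_sum_inv_le (m + 1) (n - (m + 1))
    rw [show m + 1 + (n - (m + 1)) = n by omega] at h3
    refine le_trans (le_of_eq ?_) h3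
    rw [← Finset.sum_range_reflect]
    refine Finset.sum_congr rfl fun a ha => ?_
    rw [Finset.mem_range] at ha
    rw [Finset.sum_Ico_eq_sum_range]
    refine Finset.sum_congr rfl fun b _ => ?_
    congr 1
    rw [Nat.sub_sub, Nat.cast_sub (by omega)]
    push_cast; ring
  refine (Finset.sum_le_sum inner).trans ?_
  rw [← Finset.sum_mul, Finset.sum_range_sub]
  have := hH 0 (n - 1) hn (by omega)
  have hl : 0 ≤ (n : ℝ) * Real.log 2 :=
    mul_nonneg (Nat.cast_nonneg _) (Real.log_nonneg (by norm_num))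
  calc (g (n - 1) - g 0) * (n * Real.log 2) ≤ H * (n * Real.log 2) :=
        mul_le_mul_of_nonneg_right this hl
    _ = H * n * Real.log 2 := by ring

/-- The increments of a monotone function, weighted by the number of elements from `s` to `s'`. -/
theorem sum_pairs_le {α : Type*} [LinearOrder α] (W : Finset α) (h : α → ℝ) (H : ℝ)
    (hh : MonotoneOn h W) (hH : ∀ s ∈ W, ∀ s' ∈ W, h s' - h s ≤ H) :
    ∑ p ∈ (W ×ˢ W).filter (fun p => p.1 < p.2),
      (h p.2 - h p.1) / ((W.filter (fun z => p.1 ≤ z ∧ z ≤ p.2)).card : ℝ) ≤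
      H * W.card * Real.log 2 := by
  set n := W.card with hn
  let e := W.orderEmbOfFin hn.symm
  have he : ∀ i, e i ∈ W := fun i => W.orderEmbOfFin_mem hn.symm i
  have hW : W = Finset.univ.map e.toEmbedding := (W.map_orderEmbOfFin_univ hn.symm).symm
  let g : ℕ → ℝ := fun i => if hi : i < n then h (e ⟨i, hi⟩) else 0
  have hge : ∀ i (hi : i < n), g i = h (e ⟨i, hi⟩) := fun i hi => by simp [g, hi]
  refine le_trans (le_of_eq ?_) (sum_pairs_nat_le n g H ?_ ?_)
  · rw [Finset.sum_filter, Finset.sum_product, ← Fin.sum_univ_eq_sum_range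
      (fun i => ∑ k ∈ Finset.range n, (if i < k then (g k - g i) / ((k : ℝ) - i + 1) else 0))]
    have hs : ∀ φ : α → ℝ, ∑ s ∈ W, φ s = ∑ i : Fin n, φ (e i) := by
      intro φ
      conv_lhs => rw [hW, Finset.sum_map]
      rfl
    rw [hs]
    refine Finset.sum_congr rfl fun i _ => ?_
    rw [hs, ← Fin.sum_univ_eq_sum_range
      (fun k => (if (i : ℕ) < k then (g k - g i) / ((k : ℝ) - i + 1) else 0))]
    refine Finset.sum_congr rfl fun k _ => ?_
    simp only [e.lt_iff_lt, Fin.lt_def]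
    split_ifs with hik
    · have hc : (W.filter (fun z => e i ≤ z ∧ z ≤ e k)) = (Finset.Icc i k).map e.toEmbedding := by
        ext z
        simp only [Finset.mem_filter, Finset.mem_map, Finset.mem_Icc, RelEmbedding.coe_toEmbedding]
        constructor
        · rintro ⟨hz, h1, h2⟩
          rw [hW] at hz
          obtain ⟨t, -, rfl⟩ := Finset.mem_map.1 hz
          exact ⟨t, ⟨e.le_iff_le.1 h1, e.le_iff_le.1 h2⟩, rfl⟩
        · rintro ⟨t, ⟨h1, h2⟩, rfl⟩
          exact ⟨he t, e.le_iff_le.2 h1, e.le_iff_le.2 h2⟩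
      rw [hc, Finset.card_map, Fin.card_Icc, hge i i.2, hge k k.2, Nat.cast_sub (by omega)]
      congr 1
      push_cast; ring
    · rfl
  · intro i k hik hk
    rw [hge i (by omega), hge k hk]
    exact hh (he _) (he _) (e.le_iff_le.2 hik)
  · intro i k hi hk
    rw [hge i hi, hge k hk]
    exact hH _ (he _) _ (he _)

end WFT

namespace WFT

/-! ### Envelopes of piecewise affine interpolations -/

section Envelope

variable {f : ℝ → ℝ} {ε : ℝ}

theorem interp_cell (hε : 0 < ε) {n : ℤ} {u : ℝ} (h1 : ((n : ℝ) - 1) * ε ≤ u) (h2 : u ≤ n * ε) :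
    interp f ε u = f (((n : ℝ) - 1) * ε) +
      (u - ((n : ℝ) - 1) * ε) * ((f (n * ε) - f (((n : ℝ) - 1) * ε)) / ε) := by
  rcases h2.eq_or_lt with rfl | h2
  · have : ⌊(n : ℝ) * ε / ε⌋ = n := by rw [mul_div_cancel_right₀ _ hε.ne', Int.floor_intCast]
    rw [interp, this]; field_simp; ring
  · have : ⌊u / ε⌋ = n - 1 := by
      rw [Int.floor_eq_iff]
      push_cast
      rw [le_div_iff₀ hε, div_lt_iff₀ hε]
      exact ⟨h1, by linarith⟩
    rw [interp, this]; push_cast; simp only [sub_add_cancel]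

/-- The affine function that coincides with the envelope in the cell `[(n - 1)ε, nε]`. -/
noncomputable def cellLine (F : ℤ → ℝ) (ε : ℝ) (A B n : ℤ) (u : ℝ) : ℝ :=
  ε * dEnv F A B n + sl F A B n * (u - n * ε)

theorem cellLine_succ_sub (F : ℤ → ℝ) (A B n : ℤ) (u : ℝ) :
    cellLine F ε A B (n + 1) u - cellLine F ε A B n u =
      (sl F A B (n + 1) - sl F A B n) * (u - n * ε) := by
  simp only [cellLine, sl, add_sub_cancel_right]; push_cast; ring

theorem cellLine_le {F : ℤ → ℝ} {A B n k : ℤ} {u : ℝ} (hε : 0 < ε) (hn : A < n) (hnB : n ≤ B)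
    (hk : A < k) (hkB : k ≤ B) (h1 : ((k : ℝ) - 1) * ε ≤ u) (h2 : u ≤ k * ε) :
    cellLine F ε A B n u ≤ cellLine F ε A B k u := by
  rcases le_total n k with h | h
  · have : ∀ m, n ≤ m → m ≤ k → cellLine F ε A B n u ≤ cellLine F ε A B m u := by
      intro m hm
      induction m, hm using Int.leInduction with
      | base => exact fun _ => le_rfl
      | succ m hm ih =>
        intro hmk
        refine (ih (by omega)).trans (sub_nonneg.1 ?_)
        rw [cellLine_succ_sub]
        refine mul_nonneg (sub_nonneg.2 (sl_succ_le (by omega) (by omega))) (sub_nonneg.2 ?_)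
        refine le_trans ?_ h1
        have : (m : ℝ) + 1 ≤ k := by exact_mod_cast hmk
        nlinarith
    exact this k h le_rfl
  · have : ∀ m, k ≤ m → m ≤ B → cellLine F ε A B m u ≤ cellLine F ε A B k u := by
      intro m hm
      induction m, hm using Int.leInduction with
      | base => exact fun _ => le_rfl
      | succ m hm ih =>
        intro hmB
        refine le_trans (sub_nonpos.1 ?_) (ih (by omega))
        rw [cellLine_succ_sub]
        refine mul_nonpos_of_nonneg_of_nonpos
          (sub_nonneg.2 (sl_succ_le (by omega) (by omega))) (sub_nonpos.2 ?_)
        refine h2.trans ?_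
        have : (k : ℝ) ≤ m := by exact_mod_cast hm
        nlinarith
    exact this n h hnB

theorem exists_cell (hε : 0 < ε) {A B : ℤ} (hAB : A < B) {u : ℝ} (hu : u ∈ Icc (A * ε) (B * ε)) :
    ∃ k : ℤ, A < k ∧ k ≤ B ∧ ((k : ℝ) - 1) * ε ≤ u ∧ u ≤ k * ε := by
  rcases hu.1.eq_or_lt with h | h
  · refine ⟨A + 1, by omega, by omega, ?_, ?_⟩
    · push_cast; rw [add_sub_cancel_right]; exact hu.1
    · rw [← h]; push_cast; nlinarith
  · refine ⟨⌈u / ε⌉, ?_, ?_, ?_, ?_⟩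
    · rw [Int.lt_ceil, lt_div_iff₀ hε]; exact h
    · rw [Int.ceil_le, div_le_iff₀ hε]; exact hu.2
    · have := Int.ceil_lt_add_one (u / ε)
      rw [← le_div_iff₀ hε]; linarith
    · rw [← div_le_iff₀ hε]; exact Int.le_ceil _

/-- In the cell `m`, the convex envelope of the interpolation is the affine function given by the
envelope on the integers. -/
theorem convEnv_interp (hε : 0 < ε) {A B m : ℤ} (hA : A < m) (hB : m ≤ B) {u : ℝ}
    (h1 : ((m : ℝ) - 1) * ε ≤ u) (h2 : u ≤ m * ε) :
    convEnv (interp f ε) (A * ε) (B * ε) u =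
      cellLine (fun n => f (n * ε) / ε) ε A B m u := by
  set F : ℤ → ℝ := fun n => f (n * ε) / ε with hF
  have hFf : ∀ n : ℤ, f (n * ε) = ε * F n := fun n => by simp only [hF]; field_simp
  have hFf' : ∀ n : ℤ, f (((n : ℝ) - 1) * ε) = ε * F (n - 1) := fun n => by
    rw [← hFf]; push_cast; rfl
  have hgrid : ∀ k : ℤ, A ≤ k → k ≤ B → (k : ℝ) * ε ∈ Icc (A * ε) (B * ε) := by
    intro k h h'
    have h1 : (A : ℝ) ≤ k := by exact_mod_cast h
    have h2 : (k : ℝ) ≤ B := by exact_mod_cast h'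
    exact ⟨by nlinarith, by nlinarith⟩
  have hne : (Finset.Ioc A B).Nonempty := ⟨m, by simp [hA, hB]⟩
  refine IsGreatest.csSup_eq ⟨⟨fun w => (Finset.Ioc A B).sup' hne
    (fun n => cellLine F ε A B n w), ⟨convex_Icc _ _, ?_⟩, ?_, ?_⟩, ?_⟩
  · intro x _ y _ a b ha hb hab
    refine Finset.sup'_le hne _ fun n hn => ?_
    have e : cellLine F ε A B n (a • x + b • y) =
        a • cellLine F ε A B n x + b • cellLine F ε A B n y := by
      simp only [cellLine, smul_eq_mul]
      have : b = 1 - a := by linarith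
      rw [this]; ring
    rw [e]
    exact add_le_add
      (smul_le_smul_of_nonneg_left (Finset.le_sup' (fun n => cellLine F ε A B n x) hn) ha)
      (smul_le_smul_of_nonneg_left (Finset.le_sup' (fun n => cellLine F ε A B n y) hn) hb)
  · intro w hw
    obtain ⟨k, hk1, hk2, hk3, hk4⟩ := exists_cell hε (hA.trans_le hB) hw
    refine Finset.sup'_le hne _ fun n hn => ?_
    rw [Finset.mem_Ioc] at hn
    refine (cellLine_le hε hn.1 hn.2 hk1 hk2 hk3 hk4).trans ?_
    rw [interp_cell hε hk3 hk4, hFf, hFf']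
    have g1 := dEnv_le (F := F) (A := A) (B := B) (n := k) ⟨hk1.le, hk2⟩
    have g2 := dEnv_le (F := F) (A := A) (B := B) (n := k - 1) ⟨by omega, by omega⟩
    -- write `w` as a convex combination of the end points of its cell
    obtain ⟨t, rfl⟩ : ∃ t, w = ((k : ℝ) - 1 + t) * ε := ⟨w / ε - (k - 1), by field_simp; ring⟩
    have t0 : 0 ≤ t := by
      have : 0 ≤ t * ε := by linarith
      exact nonneg_of_mul_nonneg_left this hε
    have t1 : t ≤ 1 := by
      have : 0 ≤ (1 - t) * ε := by linarith
      linarith [nonneg_of_mul_nonneg_left this hε]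
    have e : ε * F (k - 1) + (((k : ℝ) - 1 + t) * ε - ((k : ℝ) - 1) * ε) *
        ((ε * F k - ε * F (k - 1)) / ε) = ε * ((1 - t) * F (k - 1) + t * F k) := by
      field_simp; ring
    have e2 : cellLine F ε A B k (((k : ℝ) - 1 + t) * ε) =
        ε * ((1 - t) * dEnv F A B (k - 1) + t * dEnv F A B k) := by
      simp only [cellLine, sl]; ring
    rw [e, e2]
    refine mul_le_mul_of_nonneg_left (add_le_add ?_ ?_) hε.le
    · exact mul_le_mul_of_nonneg_left g2 (by linarith)
    · exact mul_le_mul_of_nonneg_left g1 t0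
  · refine le_antisymm (Finset.le_sup' (fun n => cellLine F ε A B n u) (by simp [hA, hB])) ?_
    refine Finset.sup'_le hne _ fun n hn => ?_
    rw [Finset.mem_Ioc] at hn
    exact cellLine_le hε hn.1 hn.2 hA hB h1 h2
  · rintro y ⟨h, hc, hl, rfl⟩
    have hseq : ∀ n ∈ Icc A B, h (n * ε) / ε ≤ dEnv F A B n := by
      intro n hn
      refine le_dEnv (h := fun n : ℤ => h (n * ε) / ε) (fun k hk hk' => ?_) (fun k hk => ?_) hn
      · have := hc.2 (hgrid (k - 1) (by omega) (by omega)) (hgrid (k + 1) (by omega) (by omega))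
          (by norm_num : (0 : ℝ) ≤ 1 / 2) (by norm_num : (0 : ℝ) ≤ 1 / 2) (by norm_num)
        simp only [smul_eq_mul] at this
        have e : (1 : ℝ) / 2 * (((k - 1 : ℤ) : ℝ) * ε) + 1 / 2 * (((k + 1 : ℤ) : ℝ) * ε) =
            k * ε := by
          push_cast; ring
        rw [e] at this
        rw [← add_div, mul_div_assoc']
        exact div_le_div_of_nonneg_right (by linarith) hε.le
      · simp only [hF]
        refine div_le_div_of_nonneg_right ?_ hε.le
        have := hl _ (hgrid k hk.1 hk.2)
        rw [interp_cell (n := k) hε (by nlinarith) le_rfl] at this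
        refine this.trans (le_of_eq ?_)
        field_simp; ring
    obtain ⟨t, rfl⟩ : ∃ t, u = ((m : ℝ) - 1 + t) * ε := ⟨u / ε - (m - 1), by field_simp; ring⟩
    have t0 : 0 ≤ t := by
      have : 0 ≤ t * ε := by linarith
      exact nonneg_of_mul_nonneg_left this hε
    have t1 : t ≤ 1 := by
      have : 0 ≤ (1 - t) * ε := by linarith
      linarith [nonneg_of_mul_nonneg_left this hε]
    have := hc.2 (hgrid (m - 1) (by omega) (by omega)) (hgrid m (by omega) (by omega))
      (by linarith : (0 : ℝ) ≤ 1 - t) t0 (by ring)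
    simp only [smul_eq_mul] at this
    have e : (1 - t) * (((m - 1 : ℤ) : ℝ) * ε) + t * ((m : ℝ) * ε) = ((m : ℝ) - 1 + t) * ε := by
      push_cast; ring
    rw [e] at this
    have g1 := hseq m ⟨hA.le, hB⟩
    have g2 := hseq (m - 1) ⟨by omega, by omega⟩
    rw [div_le_iff₀ hε] at g1 g2
    have e2 : cellLine F ε A B m (((m : ℝ) - 1 + t) * ε) =
        (1 - t) * (dEnv F A B (m - 1) * ε) + t * (dEnv F A B m * ε) := by
      simp only [cellLine, sl]; ring
    rw [e2]
    exact this.trans (add_le_add (mul_le_mul_of_nonneg_left g2 (by linarith))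
      (mul_le_mul_of_nonneg_left g1 t0))

/-- The flux on the grid, reflected for negative waves (`σ = -1`) and scaled so that its slopes
are speeds. -/
noncomputable def gridFlux (f : ℝ → ℝ) (ε σ : ℝ) (n : ℤ) : ℝ := σ * f (σ * (n * ε)) / ε

theorem convSpeed_eq (hε : 0 < ε) {A B m : ℤ} (hA : A < m) (hB : m ≤ B) :
    convSpeed f ε (A * ε) (B * ε) (m * ε) = sl (fun n => f (n * ε) / ε) A B m := by
  set F : ℤ → ℝ := fun n => f (n * ε) / ε with hF
  have h1 : ((m : ℝ) - 1) * ε < m * ε - ε / 2 := by linarith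
  have h2 : m * ε - ε / 2 < m * ε := by linarith
  have he : convEnv (interp f ε) (A * ε) (B * ε) =ᶠ[𝓝 (m * ε - ε / 2)] cellLine F ε A B m := by
    filter_upwards [Ioo_mem_nhds h1 h2] with u hu
    exact convEnv_interp hε hA hB hu.1.le hu.2.le
  have hd : HasDerivAt (cellLine F ε A B m) (sl F A B m) (m * ε - ε / 2) := by
    have := (((hasDerivAt_id (m * ε - ε / 2)).sub_const ((m : ℝ) * ε)).const_mul
      (sl F A B m)).const_add (ε * dEnv F A B m)
    rw [mul_one] at this
    exact this
  rw [convSpeed, he.deriv_eq, hd.deriv]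

theorem concEnv_eq_neg (g : ℝ → ℝ) (a b u : ℝ) :
    concEnv g a b u = - convEnv (fun w => - g w) a b u := by
  rw [concEnv, convEnv, Real.sInf_def]
  congr 2
  ext y
  simp only [Set.mem_neg, mem_ofPred_eq]
  constructor
  · rintro ⟨h, hc, hl, hy⟩
    exact ⟨-h, hc.neg, fun w hw => neg_le_neg (hl w hw), by simp [← hy]⟩
  · rintro ⟨h, hc, hl, rfl⟩
    exact ⟨-h, hc.neg, fun w hw => le_neg.1 (hl w hw), rfl⟩

theorem concSpeed_eq (hε : 0 < ε) {A B m : ℤ} (hA : A < m) (hB : m ≤ B) :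
    concSpeed f ε (-(B * ε)) (-(A * ε)) (-(m * ε)) = sl (gridFlux f ε (-1)) A B m := by
  have h1 : concEnv (interp f ε) (-(B * ε)) (-(A * ε)) =
      fun u => - convEnv (interp (fun w => - f w) ε) (((-B : ℤ) : ℝ) * ε)
        (((-A : ℤ) : ℝ) * ε) u := by
    funext u
    rw [concEnv_eq_neg]
    congr 2
    · funext w; simp only [interp]; ring
    · push_cast; ring
    · push_cast; ring
  have h2 := convSpeed_eq (f := fun w => - f w) hε (A := -B) (B := -A) (m := 1 - m)
    (by omega) (by omega)
  rw [convSpeed] at h2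
  rw [concSpeed, h1, deriv.fun_neg,
    show -((m : ℝ) * ε) + ε / 2 = ((1 - m : ℤ) : ℝ) * ε - ε / 2 by push_cast; ring, h2,
    neg_eq_iff_eq_neg, ← sl_reflect hA hB]
  congr 1
  funext n
  simp [gridFlux]

theorem gridFlux_one : gridFlux f ε 1 = fun n : ℤ => f (n * ε) / ε := by
  funext n; simp [gridFlux]

end Envelope

section Lipschitz

variable {f : ℝ → ℝ}

theorem abs_deriv_sub_le (hf : ContDiff ℝ 2 f)
    (hf2 : BddAbove (range fun u : ℝ => |iteratedDeriv 2 f u|)) (a b : ℝ) :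
    |deriv f a - deriv f b| ≤ secondDerivNorm f * |a - b| := by
  have hd : Differentiable ℝ (deriv f) := by
    have : ContDiff ℝ 1 (deriv f) :=
      ((contDiff_succ_iff_deriv (n := 1)).1 (by rwa [one_add_one_eq_two])).2.2
    exact this.differentiable one_ne_zero
  have := Convex.norm_image_sub_le_of_norm_deriv_le (f := deriv f) (s := univ) (x := b) (y := a)
    (C := secondDerivNorm f) (fun x _ => hd x) (fun x _ => ?_) convex_univ trivial trivial
  · simpa [Real.norm_eq_abs] using this
  · have e : deriv (deriv f) x = iteratedDeriv 2 f x := by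
      rw [iteratedDeriv_succ, iteratedDeriv_one]
    rw [Real.norm_eq_abs, e]
    exact le_ciSup hf2 x

theorem secondDerivNorm_nonneg : 0 ≤ secondDerivNorm f :=
  Real.iSup_nonneg fun _ => abs_nonneg _

theorem slopeLip_gridFlux (hf : ContDiff ℝ 2 f)
    (hf2 : BddAbove (range fun u : ℝ => |iteratedDeriv 2 f u|)) {ε σ : ℝ} (hε : 0 < ε)
    (hσ : σ = 1 ∨ σ = -1) : SlopeLip (secondDerivNorm f * ε) (gridFlux f ε σ) := by
  have hdf : Differentiable ℝ f := hf.differentiable (by norm_num)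
  have hσ2 : σ * σ = 1 := by rcases hσ with rfl | rfl <;> norm_num
  have hσa : |σ| = 1 := by rcases hσ with rfl | rfl <;> norm_num
  have hder : ∀ u, HasDerivAt (fun u => σ * f (σ * u)) (deriv f (σ * u)) u := by
    intro u
    have h := ((hdf (σ * u)).hasDerivAt.comp u ((hasDerivAt_id u).const_mul σ)).const_mul σ
    refine h.congr_deriv ?_
    linear_combination deriv f (σ * u) * hσ2
  have mvt : ∀ a b : ℤ, a < b → ∃ ξ ∈ Ioo (a * ε) (b * ε),
      (gridFlux f ε σ b - gridFlux f ε σ a) / (b - a) = deriv f (σ * ξ) := by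
    intro a b hab
    have hab' : (a : ℝ) < b := by exact_mod_cast hab
    have hlt : (a : ℝ) * ε < b * ε := by nlinarith
    obtain ⟨ξ, hξ, h⟩ := exists_hasDerivAt_eq_slope (fun u => σ * f (σ * u))
      (fun u => deriv f (σ * u)) hlt
      (fun u _ => (hder u).continuousAt.continuousWithinAt) (fun u _ => hder u)
    refine ⟨ξ, hξ, ?_⟩
    rw [h, gridFlux, gridFlux, ← sub_div, div_div, ← sub_mul, mul_comm ((b : ℝ) - a)]
  intro a b c hab hbc
  obtain ⟨ξ, hξ, h1⟩ := mvt a b hab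
  obtain ⟨η, hη, h2⟩ := mvt b c hbc
  rw [h1, h2]
  refine (abs_deriv_sub_le hf hf2 _ _).trans ?_
  rw [← mul_sub, abs_mul, hσa, one_mul, mul_assoc]
  refine mul_le_mul_of_nonneg_left ?_ secondDerivNorm_nonneg
  rw [abs_le]
  constructor <;> nlinarith [hξ.1, hξ.2, hη.1, hη.2]

end Lipschitz

end WFT

namespace WFT

/-! ### Profiles described by waves -/

/-- The profile `v` is described by the waves in `W`: the wave `s` lies at `x s` and crossing it
changes the value by `ε * σ s`; summing up the signs of the waves up to `s` gives the integer `n s`,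
so that `ε * n s` is the right state of `s`. -/
structure IsConfig (ε : ℝ) (σ n : ℕ → ℤ) (W : Finset ℕ) (x : ℕ → ℝ) (v : ℝ → ℝ) : Prop where
  sign : ∀ s ∈ W, σ s = 1 ∨ σ s = -1
  state : ∀ s ∈ W, ∑ q ∈ W.filter (· ≤ s), σ q = n s
  profile : ∀ z, v z = ε * ((∑ q ∈ W.filter (fun q => x q ≤ z), σ q : ℤ) : ℝ)
  mono : MonotoneOn x W
  sign_eq : ∀ s ∈ W, ∀ s' ∈ W, x s = x s' → σ s = σ s'

namespace IsConfig

variable {f : ℝ → ℝ} {ε : ℝ} {σ n : ℕ → ℤ} {W : Finset ℕ} {x : ℕ → ℝ} {v : ℝ → ℝ} {s s' a b : ℕ}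

theorem _root_.WFT.leftLim_step
    (hv : ∀ z, v z = ε * ((∑ q ∈ W.filter (fun q => x q ≤ z), σ q : ℤ) : ℝ))
    (z : ℝ) :
    Function.leftLim v z = ε * ((∑ q ∈ W.filter (fun q => x q < z), σ q : ℤ) : ℝ) := by
  refine leftLim_eq_of_tendsto ?_
  have h1 : ∀ᶠ y in 𝓝[<] z, ∀ q ∈ W, (x q ≤ y ↔ x q < z) := by
    rw [Filter.eventually_all_finset]
    intro q _
    rcases lt_or_ge (x q) z with hq | hq
    · filter_upwards [Ioo_mem_nhdsLT hq] with y hy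
      simp [hq, hy.1.le]
    · filter_upwards [self_mem_nhdsWithin] with y hy
      have hy : y < z := hy
      simp [not_lt.2 hq, not_le.2 (hy.trans_le hq)]
  refine tendsto_const_nhds.congr' ?_
  filter_upwards [h1] with y hy
  rw [hv y, Finset.filter_congr hy]

theorem leftLim_eq (h : IsConfig ε σ n W x v) (z : ℝ) :
    Function.leftLim v z = ε * ((∑ q ∈ W.filter (fun q => x q < z), σ q : ℤ) : ℝ) :=
  leftLim_step h.profile z

/-- Waves at the same position have contiguous states. -/
theorem state_sub (h : IsConfig ε σ n W x v) (hs : s ∈ W) (hs' : s' ∈ W) (hle : s ≤ s') :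
    n s' - n s = ∑ q ∈ W.filter (fun q => s < q ∧ q ≤ s'), σ q := by
  rw [← h.state s hs, ← h.state s' hs', sub_eq_iff_eq_add, ← Finset.sum_union]
  · congr 1
    ext q
    simp only [Finset.mem_filter, Finset.mem_union]
    constructor
    · rintro ⟨h1, h2⟩
      rcases le_or_gt q s with h3 | h3
      · exact Or.inr ⟨h1, h3⟩
      · exact Or.inl ⟨h1, h3, h2⟩
    · rintro (⟨h1, h2, h3⟩ | ⟨h1, h2⟩)
      · exact ⟨h1, h3⟩
      · exact ⟨h1, h2.trans hle⟩
  · rw [Finset.disjoint_filter]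
    rintro q _ ⟨h1, _⟩ h2
    omega

theorem card_Icc (hs : s ∈ W) (hle : s ≤ s') :
    (W.filter (fun q => s ≤ q ∧ q ≤ s')).card =
      (W.filter (fun q => s < q ∧ q ≤ s')).card + 1 := by
  rw [← Finset.card_insert_of_notMem (a := s) (by simp)]
  congr 1
  ext q
  simp only [Finset.mem_filter, Finset.mem_insert]
  constructor
  · rintro ⟨h1, h2, h3⟩
    rcases h2.eq_or_lt with h | h
    · exact Or.inl h.symm
    · exact Or.inr ⟨h1, h, h3⟩
  · rintro (rfl | ⟨h1, h2, h3⟩)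
    · exact ⟨hs, le_rfl, hle⟩
    · exact ⟨h1, h2.le, h3⟩

theorem card_le (h : IsConfig ε σ n W x v) (hs : s ∈ W) (hs' : s' ∈ W) (hle : s ≤ s')
    (hσ : σ s = σ s') :
    σ s' * n s' - σ s * n s + 1 ≤ (W.filter (fun q => s ≤ q ∧ q ≤ s')).card := by
  rw [← hσ, ← mul_sub, h.state_sub hs hs' hle, Finset.mul_sum, card_Icc hs hle]
  push_cast
  refine add_le_add_left ((Finset.sum_le_card_nsmul _ _ 1 fun q hq => ?_).trans (by simp)) 1
  rw [Finset.mem_filter] at hq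
  rcases h.sign s hs with h1 | h1 <;> rcases h.sign q hq.1 with h2 | h2 <;> rw [h1, h2] <;> norm_num

theorem eq_of_btw (h : IsConfig ε σ n W x v) {q : ℕ} (hs : s ∈ W) (hs' : s' ∈ W) (hq : q ∈ W)
    (hx : x s = x s') (h1 : s ≤ q) (h2 : q ≤ s') : x q = x s :=
  le_antisymm (hx ▸ h.mono hq hs' h2) (h.mono hs hq h1)

theorem card_class (h : IsConfig ε σ n W x v) (hs : s ∈ W) (hs' : s' ∈ W) (hle : s ≤ s')
    (hx : x s = x s') :
    σ s' * n s' - σ s * n s + 1 = (W.filter (fun q => s ≤ q ∧ q ≤ s')).card := by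
  have hσ := h.sign_eq s hs s' hs' hx
  rw [← hσ, ← mul_sub, h.state_sub hs hs' hle, Finset.mul_sum, card_Icc hs hle]
  have : ∀ q ∈ W.filter (fun q => s < q ∧ q ≤ s'), σ s * σ q = 1 := by
    intro q hq
    rw [Finset.mem_filter] at hq
    rw [h.sign_eq q hq.1 s hs (h.eq_of_btw hs hs' hq.1 hx hq.2.1.le hq.2.2)]
    rcases h.sign s hs with h1 | h1 <;> rw [h1] <;> norm_num
  rw [Finset.sum_congr rfl this]
  simp

/-- `a` and `b` are the first and the last wave at the position of `s`. -/
def IsClass (W : Finset ℕ) (x : ℕ → ℝ) (s a b : ℕ) : Prop :=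
  s ∈ W ∧ a ∈ W ∧ b ∈ W ∧ x a = x s ∧ x b = x s ∧ ∀ z ∈ W, x z = x s → a ≤ z ∧ z ≤ b

theorem exists_class (hs : s ∈ W) : ∃ a b, IsClass W x s a b := by
  obtain ⟨a, b, ha, hb, hab⟩ := exists_ext (K := W.filter (fun z => x z = x s)) ⟨s, by simp [hs]⟩
  simp only [Finset.mem_filter] at ha hb hab
  exact ⟨a, b, hs, ha.1, hb.1, ha.2, hb.2, fun z hz hzs => hab z ⟨hz, hzs⟩⟩

theorem leftLim_class (h : IsConfig ε σ n W x v) (hc : IsClass W x s a b) :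
    Function.leftLim v (x s) = ε * ((n a - σ s : ℤ) : ℝ) := by
  obtain ⟨hs, ha, hb, hxa, hxb, hz⟩ := hc
  have key : W.filter (fun q => q ≤ a) = insert a (W.filter (fun q => x q < x s)) := by
    ext q
    simp only [Finset.mem_filter, Finset.mem_insert]
    constructor
    · rintro ⟨h1, h2⟩
      rcases h2.eq_or_lt with h3 | h3
      · exact Or.inl h3
      · refine Or.inr ⟨h1, lt_of_le_of_ne (hxa ▸ h.mono h1 ha h2) fun he => ?_⟩
        exact absurd (hz q h1 he).1 (not_le.2 h3)
    · rintro (rfl | ⟨h1, h2⟩)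
      · exact ⟨ha, le_rfl⟩
      · refine ⟨h1, le_of_not_ge fun h3 => ?_⟩
        exact absurd (h.mono ha h1 h3) (not_le.2 (hxa ▸ h2))
  have e := h.state a ha
  rw [key, Finset.sum_insert (by simp [hxa]), h.sign_eq a ha s hs hxa] at e
  rw [h.leftLim_eq]
  congr 2
  linarith

theorem right_class (h : IsConfig ε σ n W x v) (hc : IsClass W x s a b) :
    v (x s) = ε * (n b : ℝ) := by
  obtain ⟨hs, ha, hb, hxa, hxb, hz⟩ := hc
  rw [h.profile, ← h.state b hb]
  congr 3
  ext q
  simp only [Finset.mem_filter, and_congr_right_iff]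
  intro hq
  constructor
  · intro h1
    rcases h1.eq_or_lt with h2 | h2
    · exact (hz q hq h2).2
    · refine le_of_not_ge fun h3 => ?_
      exact absurd (h.mono hb hq h3) (not_le.2 (hxb ▸ h2))
  · intro h1
    rw [← hxb]; exact h.mono hq hb h1

theorem eq_of_no_wave (h : IsConfig ε σ n W x v) {z : ℝ} (hz : ∀ q ∈ W, x q ≠ z) :
    Function.leftLim v z = v z := by
  rw [h.leftLim_eq, h.profile]
  congr 3
  ext q
  simp only [Finset.mem_filter, and_congr_right_iff]
  intro hq
  exact ⟨le_of_lt, fun h1 => lt_of_le_of_ne h1 (hz q hq)⟩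

/-- The cell index, increasing along the waves at one position. -/
theorem y_le (h : IsConfig ε σ n W x v) (hs : s ∈ W) (hs' : s' ∈ W) (hle : s ≤ s')
    (hx : x s = x s') : σ s * n s ≤ σ s' * n s' := by
  have h1 := h.card_class hs hs' hle hx
  have h2 : 0 < (W.filter (fun q => s ≤ q ∧ q ≤ s')).card :=
    Finset.card_pos.2 ⟨s, by simp [hs, hle]⟩
  omega

/-- The fan at the position of `s` in terms of cell indices. -/
theorem mem_fanStates_iff (h : IsConfig ε σ n W x v) (hε : 0 < ε) (hc : IsClass W x s a b) (w : ℝ) :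
    w ∈ fanStates ε (Function.leftLim v (x s)) (v (x s)) ↔
      ∃ m : ℤ, w = ε * ((σ s * m : ℤ) : ℝ) ∧ σ a * n a ≤ m ∧ m ≤ σ b * n b := by
  have hab := h.y_le hc.2.1 hc.2.2.1 (hc.2.2.2.2.2 a hc.2.1 hc.2.2.2.1).2
    (hc.2.2.2.1.trans hc.2.2.2.2.1.symm)
  have hσa := h.sign_eq a hc.2.1 s hc.1 hc.2.2.2.1
  have hσb := h.sign_eq b hc.2.2.1 s hc.1 hc.2.2.2.2.1
  rw [fanStates, h.leftLim_class hc, h.right_class hc, mem_ofPred_eq, hσa, hσb]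
  rw [hσa, hσb] at hab
  have key : ∀ i k : ℤ, (ε * (i : ℝ) < k * ε ↔ i < k) ∧ (ε * (i : ℝ) ≤ k * ε ↔ i ≤ k) ∧
      (k * ε < ε * (i : ℝ) ↔ k < i) ∧ (k * ε ≤ ε * (i : ℝ) ↔ k ≤ i) := by
    intro i k
    rw [mul_comm ε, mul_lt_mul_iff_left₀ hε, mul_le_mul_iff_left₀ hε, mul_lt_mul_iff_left₀ hε,
      mul_le_mul_iff_left₀ hε]
    exact ⟨Int.cast_lt, Int.cast_le, Int.cast_lt, Int.cast_le⟩
  constructor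
  · rintro ⟨⟨m, rfl⟩, hm⟩
    rw [(key _ _).1, (key _ _).2.1, (key _ _).2.2.1, (key _ _).2.2.2] at hm
    refine ⟨σ s * m, ?_, ?_⟩
    · rw [← mul_assoc]
      have : σ s * σ s = 1 := by rcases h.sign s hc.1 with h1 | h1 <;> rw [h1] <;> norm_num
      rw [this]; push_cast; ring
    · rcases h.sign s hc.1 with h1 | h1 <;> rw [h1] at hm hab ⊢ <;> omega
  · rintro ⟨m, rfl, h1, h2⟩
    refine ⟨⟨σ s * m, by ring⟩, ?_⟩
    rw [mul_comm ε ((σ s * m : ℤ) : ℝ), (key _ _).1, (key _ _).2.1, (key _ _).2.2.1,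
      (key _ _).2.2.2]
    rcases h.sign s hc.1 with h3 | h3 <;> rw [h3] at h1 h2 hab ⊢ <;> omega

/-- The cells of the waves at one position fill an interval. -/
theorem image_y (h : IsConfig ε σ n W x v) (hc : IsClass W x s a b) :
    (W.filter (fun q => x q = x s)).image (fun q => σ q * n q) =
      Finset.Icc (σ a * n a) (σ b * n b) := by
  obtain ⟨hs, ha, hb, hxa, hxb, hz⟩ := hc
  have hlt : ∀ q ∈ W, ∀ q' ∈ W, x q = x s → x q' = x s → q < q' → σ q * n q < σ q' * n q' := by
    intro q hq q' hq' hx hx' hlt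
    have h1 := h.card_class hq hq' hlt.le (hx.trans hx'.symm)
    have h2 : 1 < (W.filter (fun z => q ≤ z ∧ z ≤ q')).card :=
      Finset.one_lt_card.2 ⟨q, by simp [hq, hlt.le], q', by simp [hq', hlt.le], hlt.ne⟩
    omega
  refine Finset.eq_of_subset_of_card_le ?_ ?_
  · intro m hm
    obtain ⟨q, hq, rfl⟩ := Finset.mem_image.1 hm
    rw [Finset.mem_filter] at hq
    rw [Finset.mem_Icc]
    exact ⟨h.y_le ha hq.1 (hz q hq.1 hq.2).1 (hxa.trans hq.2.symm),
      h.y_le hq.1 hb (hz q hq.1 hq.2).2 (hq.2.trans hxb.symm)⟩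
  · rw [Finset.card_image_of_injOn]
    · have hab := (hz a ha hxa).2
      have h1 := h.card_class ha hb hab (hxa.trans hxb.symm)
      have h2 : W.filter (fun q => a ≤ q ∧ q ≤ b) = W.filter (fun q => x q = x s) := by
        ext q
        simp only [Finset.mem_filter, and_congr_right_iff]
        exact fun hq => ⟨fun hh => (h.eq_of_btw ha hb hq (hxa.trans hxb.symm) hh.1 hh.2).trans hxa,
          hz q hq⟩
      rw [h2] at h1
      rw [Int.card_Icc]
      omega
    · intro q hq q' hq' he
      simp only [Finset.coe_filter, mem_ofPred_eq] at hq hq'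
      rcases lt_trichotomy q q' with h3 | h3 | h3
      · exact absurd he (hlt q hq.1 q' hq'.1 hq.2 hq'.2 h3).ne
      · exact h3
      · exact absurd he (hlt q' hq'.1 q hq.1 hq'.2 hq.2 h3).ne'

/-- The elementary waves emerging from a discontinuity are the waves at that position. -/
theorem mem_fanStates_iff_exists (h : IsConfig ε σ n W x v) (hε : 0 < ε) (z w : ℝ) :
    w ∈ fanStates ε (Function.leftLim v z) (v z) ↔ ∃ q ∈ W, x q = z ∧ w = ε * (n q : ℝ) := by
  by_cases hz : ∃ s ∈ W, x s = z
  · obtain ⟨s, hs, rfl⟩ := hz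
    obtain ⟨a, b, hc⟩ := exists_class (x := x) hs
    rw [h.mem_fanStates_iff hε hc]
    have himg := h.image_y hc
    have hσ2 : ∀ q ∈ W, x q = x s → σ s * (σ q * n q) = n q := by
      intro q hq hx
      rw [h.sign_eq q hq s hs hx, ← mul_assoc]
      rcases h.sign s hs with h1 | h1 <;> rw [h1] <;> norm_num
    constructor
    · rintro ⟨m, rfl, hm⟩
      rw [← Finset.mem_Icc, ← himg, Finset.mem_image] at hm
      obtain ⟨q, hq, rfl⟩ := hm
      rw [Finset.mem_filter] at hq
      exact ⟨q, hq.1, hq.2, by rw [hσ2 q hq.1 hq.2]⟩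
    · rintro ⟨q, hq, hx, rfl⟩
      refine ⟨σ q * n q, by rw [hσ2 q hq hx], ?_⟩
      rw [← Finset.mem_Icc, ← himg]
      exact Finset.mem_image_of_mem _ (Finset.mem_filter.2 ⟨hq, hx⟩)
  · push Not at hz
    rw [h.eq_of_no_wave hz]
    constructor
    · rintro ⟨-, hw | hw⟩
      · exact absurd (hw.1.trans_le hw.2) (lt_irrefl _)
      · exact absurd (lt_of_le_of_lt hw.1 hw.2) (lt_irrefl _)
    · rintro ⟨q, hq, hx, -⟩
      exact absurd hx (hz q hq)

/-- The speed that the Riemann problem gives to a wave, in terms of envelopes on the integers. -/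
theorem fanSpeed_eq (h : IsConfig ε σ n W x v) (hε : 0 < ε) (hc : IsClass W x s a b) :
    fanSpeed f ε (Function.leftLim v (x s)) (v (x s)) (ε * (n s : ℝ)) =
      sl (gridFlux f ε (σ s)) (σ a * n a - 1) (σ b * n b) (σ s * n s) := by
  obtain ⟨hs, ha, hb, hxa, hxb, hz⟩ := id hc
  have hl := hz s hs rfl
  have y1 := h.y_le ha hs hl.1 hxa
  have y2 := h.y_le hs hb hl.2 hxb.symm
  have hσa := h.sign_eq a ha s hs hxa
  have hσb := h.sign_eq b hb s hs hxb
  rw [h.leftLim_class hc, h.right_class hc, fanSpeed]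
  rw [hσa] at y1
  rw [hσb] at y2
  rw [hσa, hσb]
  rcases h.sign s hs with h1 | h1
  · rw [h1] at y1 y2 ⊢
    have : n a - 1 < n b := by omega
    rw [if_pos (mul_lt_mul_of_pos_left (by exact_mod_cast this) hε), Int.cast_one, gridFlux_one,
      ← convSpeed_eq hε (by omega) (by omega)]
    congr 1 <;> push_cast <;> ring
  · rw [h1] at y1 y2 ⊢
    have : n b ≤ n a - -1 := by omega
    rw [if_neg (not_lt.2 (mul_le_mul_of_nonneg_left (by exact_mod_cast this) hε.le)),
      show ((-1 : ℤ) : ℝ) = -1 by norm_num, ← concSpeed_eq hε (by omega) (by omega)]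
    congr 1 <;> push_cast <;> ring

/-- The velocity of the wave `s`. -/
noncomputable def vel (f : ℝ → ℝ) (ε : ℝ) (n : ℕ → ℤ) (x : ℕ → ℝ) (v : ℝ → ℝ) (s : ℕ) : ℝ :=
  fanSpeed f ε (Function.leftLim v (x s)) (v (x s)) (ε * (n s : ℝ))

theorem fronts_eq (h : IsConfig ε σ n W x v) (hε : 0 < ε) :
    fronts f ε v = (fun s => (x s, vel f ε n x v s)) '' (W : Set ℕ) := by
  ext p
  simp only [fronts, mem_ofPred_eq, mem_image, Finset.mem_coe]
  constructor
  · rintro ⟨w, hw, hp⟩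
    obtain ⟨q, hq, hx, rfl⟩ := (h.mem_fanStates_iff_exists hε _ _).1 hw
    refine ⟨q, hq, Prod.ext hx ?_⟩
    rw [← hp, vel, hx]
  · rintro ⟨q, hq, rfl⟩
    exact ⟨ε * n q, (h.mem_fanStates_iff_exists hε _ _).2 ⟨q, hq, rfl, rfl⟩, rfl⟩

/-- As long as the waves move along straight lines, they describe the solution. -/
theorem evolve_eq (h : IsConfig ε σ n W x v) (hε : 0 < ε) (τ z : ℝ) :
    evolve f ε v τ z = ε * ((∑ q ∈ W.filter (fun q => x q + vel f ε n x v q * τ ≤ z),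
      σ q : ℤ) : ℝ) := by
  set φ : ℕ → ℤ := fun q => if x q + vel f ε n x v q * τ ≤ z then σ q else 0 with hφ
  have hterm : ∀ ξ : ℝ, riemannSol f ε (Function.leftLim v ξ) (v ξ) τ (z - ξ) -
      Function.leftLim v ξ = ε * ((∑ q ∈ W.filter (fun q => x q = ξ), φ q : ℤ) : ℝ) := by
    intro ξ
    by_cases hξ : ∃ s ∈ W, x s = ξ
    · obtain ⟨s, hs, rfl⟩ := hξ
      obtain ⟨a, b, hc⟩ := exists_class (x := x) hs
      have hab := h.y_le hc.2.1 hc.2.2.1 (hc.2.2.2.2.2 a hc.2.1 hc.2.2.2.1).2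
        (hc.2.2.2.1.trans hc.2.2.2.2.1.symm)
      have hσa := h.sign_eq a hc.2.1 s hs hc.2.2.2.1
      have hσb := h.sign_eq b hc.2.2.1 s hs hc.2.2.2.2.1
      have hsign : Real.sign (v (x s) - Function.leftLim v (x s)) = σ s := by
        rw [h.right_class hc, h.leftLim_class hc, ← mul_sub]
        rw [hσa, hσb] at hab
        rcases h.sign s hs with h1 | h1
        · rw [h1] at hab ⊢
          rw [Real.sign_of_pos, Int.cast_one]
          refine mul_pos hε (sub_pos.2 ?_)
          exact_mod_cast (by omega : n a - 1 < n b)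
        · rw [h1] at hab ⊢
          rw [Real.sign_of_neg]; · norm_num
          refine mul_neg_of_pos_of_neg hε (sub_neg.2 ?_)
          exact_mod_cast (by omega : n b < n a - -1)
      set T := (W.filter (fun q => x q = x s)).filter
        (fun q => x q + vel f ε n x v q * τ ≤ z) with hT
      have hset : {w ∈ fanStates ε (Function.leftLim v (x s)) (v (x s)) |
          fanSpeed f ε (Function.leftLim v (x s)) (v (x s)) w * τ ≤ z - x s} =
          (fun q => ε * (n q : ℝ)) '' (T : Set ℕ) := by
        ext w
        simp only [mem_ofPred_eq, mem_image, Finset.mem_coe, hT, Finset.mem_filter]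
        rw [h.mem_fanStates_iff_exists hε]
        constructor
        · rintro ⟨⟨q, hq, hx, rfl⟩, hw⟩
          refine ⟨q, ⟨⟨hq, hx⟩, ?_⟩, rfl⟩
          rw [vel, hx]; linarith
        · rintro ⟨q, ⟨⟨hq, hx⟩, hw⟩, rfl⟩
          refine ⟨⟨q, hq, hx, rfl⟩, ?_⟩
          rw [vel, hx] at hw; linarith
      have hinj : InjOn (fun q => ε * (n q : ℝ)) (T : Set ℕ) := by
        intro q hq q' hq' he
        simp only [Finset.mem_coe, hT, Finset.mem_filter] at hq hq'
        have he : n q = n q' := by exact_mod_cast mul_left_cancel₀ hε.ne' he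
        have key : ∀ q q', ((q ∈ W ∧ x q = x s) ∧ x q + vel f ε n x v q * τ ≤ z) →
            ((q' ∈ W ∧ x q' = x s) ∧ x q' + vel f ε n x v q' * τ ≤ z) → n q = n q' → ¬ q < q' := by
          intro q q' hq hq' he hlt
          have hx := hq.1.2.trans hq'.1.2.symm
          have h1 := h.card_class hq.1.1 hq'.1.1 hlt.le hx
          rw [h.sign_eq q hq.1.1 q' hq'.1.1 hx, he] at h1
          have h2 : 1 < (W.filter (fun z => q ≤ z ∧ z ≤ q')).card :=
            Finset.one_lt_card.2
              ⟨q, by simp [hq.1.1, hlt.le], q', by simp [hq'.1.1, hlt.le], hlt.ne⟩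
          omega
        exact le_antisymm (not_lt.1 (key q' q hq' hq he.symm)) (not_lt.1 (key q q' hq hq' he))
      rw [riemannSol, hset, hinj.ncard_image, ncard_coe_finset, hsign]
      have hsum : ∑ q ∈ W.filter (fun q => x q = x s), φ q = σ s * T.card := by
        rw [hφ, ← Finset.sum_filter, ← hT, Finset.sum_congr rfl (g := fun _ => σ s)]
        · simp [mul_comm]
        · intro q hq
          simp only [hT, Finset.mem_filter] at hq
          exact h.sign_eq q hq.1.1 s hs hq.1.2
      rw [hsum]; push_cast; ring
    · push Not at hξ
      rw [h.eq_of_no_wave hξ, riemannSol, sub_self, Real.sign_zero,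
        Finset.filter_eq_empty_iff.2 (fun q hq => hξ q hq)]
      simp
  rw [evolve, finsum_congr hterm, finsum_eq_sum_of_support_subset (s := W.image x)]
  · rw [← Finset.mul_sum, ← Int.cast_sum,
      Finset.sum_fiberwise_of_maps_to (fun q hq => Finset.mem_image_of_mem x hq), hφ,
      ← Finset.sum_filter]
  · intro ξ hξ
    rw [Function.mem_support] at hξ
    by_contra hn
    apply hξ
    rw [Finset.filter_eq_empty_iff.2]
    · simp
    · intro q hq he
      exact hn (by simpa using ⟨q, hq, he⟩)

end IsConfig

end WFT

namespace WFT

namespace IsConfig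

variable {f : ℝ → ℝ} {ε : ℝ} {σ n : ℕ → ℤ} {W : Finset ℕ} {x : ℕ → ℝ} {v : ℝ → ℝ} {s s' a b : ℕ}

/-! ### Motion of the waves up to the first collision -/

/-- The position of the wave `s` after the delay `τ`, before any collision. -/
noncomputable def move (f : ℝ → ℝ) (ε : ℝ) (n : ℕ → ℤ) (x : ℕ → ℝ) (v : ℝ → ℝ) (τ : ℝ) (s : ℕ) :
    ℝ := x s + vel f ε n x v s * τ

theorem vel_mono (h : IsConfig ε σ n W x v) (hε : 0 < ε) (hs : s ∈ W) (hs' : s' ∈ W)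
    (hx : x s = x s') (hle : s ≤ s') : vel f ε n x v s ≤ vel f ε n x v s' := by
  obtain ⟨a, b, hc⟩ := exists_class (x := x) hs
  obtain ⟨_, ha, hb, hxa, hxb, hz⟩ := id hc
  have hc' : IsClass W x s' a b :=
    ⟨hs', ha, hb, hxa.trans hx, hxb.trans hx, fun z hz' hzs => hz z hz' (hzs.trans hx.symm)⟩
  rw [vel, vel, h.fanSpeed_eq hε hc, h.fanSpeed_eq hε hc', h.sign_eq s hs s' hs' hx]
  have y1 := h.y_le ha hs (hz s hs rfl).1 hxa
  have y2 := h.y_le hs hs' hle hx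
  have y3 := h.y_le hs' hb (hz s' hs' hx.symm).2 (hx.symm.trans hxb.symm)
  rw [h.sign_eq s hs s' hs' hx] at y1 y2
  exact sl_mono (by omega) y2 y3

theorem mem_collisionDelays (h : IsConfig ε σ n W x v) (hε : 0 < ε) (τ : ℝ) :
    τ ∈ collisionDelays f ε v ↔ 0 < τ ∧ ∃ q ∈ W, ∃ q' ∈ W,
      ¬ (x q = x q' ∧ vel f ε n x v q = vel f ε n x v q') ∧
      move f ε n x v τ q = move f ε n x v τ q' := by
  rw [collisionDelays, h.fronts_eq hε]
  simp only [mem_ofPred_eq, mem_image, Finset.mem_coe, exists_exists_and_eq_and, ne_eq,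
    Prod.mk.injEq, move]

theorem finite_collisionDelays (h : IsConfig ε σ n W x v) (hε : 0 < ε) :
    (collisionDelays f ε v).Finite := by
  refine ((W ×ˢ W).image (fun p => (x p.2 - x p.1) /
    (vel f ε n x v p.1 - vel f ε n x v p.2))).finite_toSet.subset ?_
  intro τ hτ
  obtain ⟨hτ0, q, hq, q', hq', hne, he⟩ := (h.mem_collisionDelays hε τ).1 hτ
  simp only [move] at he
  have hv : vel f ε n x v q ≠ vel f ε n x v q' := fun hv => hne ⟨by rw [hv] at he; linarith, hv⟩
  rw [Finset.mem_coe, Finset.mem_image]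
  refine ⟨(q, q'), by simp [hq, hq'], ?_⟩
  rw [div_eq_iff (sub_ne_zero.2 hv)]
  linarith

theorem nextDelay_mem (h : IsConfig ε σ n W x v) (hε : 0 < ε)
    (hne : (collisionDelays f ε v).Nonempty) : nextDelay f ε v ∈ collisionDelays f ε v :=
  hne.csInf_mem (h.finite_collisionDelays hε)

theorem _root_.WFT.nextDelay_eq_zero (hne : ¬ (collisionDelays f ε v).Nonempty) :
    nextDelay f ε v = 0 := by
  rw [nextDelay, Set.not_nonempty_iff_eq_empty.1 hne, Real.sInf_empty]

theorem _root_.WFT.nextDelay_nonneg : 0 ≤ nextDelay f ε v :=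
  Real.sInf_nonneg fun _ hτ => hτ.1.le

theorem _root_.WFT.nextDelay_le {τ : ℝ} (hτ : τ ∈ collisionDelays f ε v) :
    nextDelay f ε v ≤ τ := csInf_le ⟨0, fun _ h => h.1.le⟩ hτ

/-- Before the first collision the waves keep their order. -/
theorem move_mono (h : IsConfig ε σ n W x v) (hε : 0 < ε) {τ : ℝ} (h0 : 0 ≤ τ)
    (hτ : τ ≤ nextDelay f ε v) : MonotoneOn (move f ε n x v τ) W := by
  intro s hs s' hs' hle
  simp only [move]
  rcases (h.mono hs hs' hle).eq_or_lt with hx | hx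
  · rw [hx]
    have := h.vel_mono (f := f) hε hs hs' hx hle
    nlinarith
  · by_contra! hlt
    set d := vel f ε n x v s - vel f ε n x v s' with hd
    have hd0 : 0 < d := by
      by_contra! hd0
      nlinarith
    have hmem : (x s' - x s) / d ∈ collisionDelays f ε v := by
      rw [h.mem_collisionDelays hε]
      refine ⟨div_pos (by linarith) hd0, s, hs, s', hs', fun he => hx.ne he.1, ?_⟩
      have : vel f ε n x v s = d + vel f ε n x v s' := by rw [hd]; ring
      simp only [move]
      rw [this]; field_simp; ring
    have h1 := nextDelay_le hmem
    have h2 : (x s' - x s) / d < τ := by rw [div_lt_iff₀ hd0]; linarith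
    linarith

/-- Waves at the same place strictly before the first collision belong to the same front. -/
theorem sameFront_of_move_eq (h : IsConfig ε σ n W x v) (hε : 0 < ε) {τ : ℝ} (h0 : 0 ≤ τ)
    (hτ : τ < nextDelay f ε v ∨ ¬ (collisionDelays f ε v).Nonempty)
    (hs : s ∈ W) (hs' : s' ∈ W) (he : move f ε n x v τ s = move f ε n x v τ s') :
    x s = x s' := by
  by_contra hx
  rcases h0.eq_or_lt with rfl | h0
  · simp only [move, mul_zero, add_zero] at he
    exact hx he
  · have hmem : τ ∈ collisionDelays f ε v :=
      (h.mem_collisionDelays hε τ).2 ⟨h0, s, hs, s', hs', fun hh => hx hh.1, he⟩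
    rcases hτ with hτ | hτ
    · exact absurd (nextDelay_le hmem) (not_le.2 hτ)
    · exact hτ ⟨τ, hmem⟩

/-- For waves with positions `x` and speeds `w`, `zl` and `zr` are representatives of the left and
the right front of the only collision, which takes place at `c` after the delay `τ`. -/
structure IsCollision (W : Finset ℕ) (x w : ℕ → ℝ) (τ c : ℝ) (zl zr : ℕ) : Prop where
  left_mem : zl ∈ W
  right_mem : zr ∈ W
  lt : x zl < x zr
  left_eq : x zl + w zl * τ = c
  right_eq : x zr + w zr * τ = c
  front : ∀ q ∈ W, x q + w q * τ = c → (x q = x zl ∧ w q = w zl) ∨ (x q = x zr ∧ w q = w zr)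
  only : ∀ q ∈ W, ∀ q' ∈ W, x q + w q * τ = x q' + w q' * τ →
    (x q = x q' ∧ w q = w q') ∨ (x q + w q * τ = c ∧ x q' + w q' * τ = c)

theorem exists_isCollision (h : IsConfig ε σ n W x v) (hε : 0 < ε)
    (hcoll : (collisionDelays f ε v).Nonempty) (hbin : (collidingFronts f ε v).encard = 2) :
    ∃ zl zr, IsCollision W x (vel f ε n x v) (nextDelay f ε v)
      (sInf ((fun p : ℝ × ℝ => p.1 + p.2 * nextDelay f ε v) '' collidingFronts f ε v)) zl zr := by
  set τ := nextDelay f ε v with hτ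
  set w := vel f ε n x v with hw
  have hfr := h.fronts_eq (f := f) hε
  have hmem : ∀ q ∈ W, (x q, w q) ∈ fronts f ε v := fun q hq => by
    rw [hfr]; exact ⟨q, hq, rfl⟩
  obtain ⟨P, Q, hPQ, hset⟩ := Set.encard_eq_two.1 hbin
  have key : ∀ P Q, P ≠ Q → collidingFronts f ε v = {P, Q} → P.1 < Q.1 →
      ∃ zl zr, IsCollision W x w τ (sInf ((fun p : ℝ × ℝ => p.1 + p.2 * τ) ''
        collidingFronts f ε v)) zl zr := by
    intro P Q hPQ hset hlt
    have hP : P ∈ collidingFronts f ε v := by rw [hset]; simp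
    have hQ : Q ∈ collidingFronts f ε v := by rw [hset]; simp
    obtain ⟨zl, hzl, hzlP⟩ := hfr ▸ hP.1
    obtain ⟨zr, hzr, hzrQ⟩ := hfr ▸ hQ.1
    have hmeet : P.1 + P.2 * τ = Q.1 + Q.2 * τ := by
      obtain ⟨hP1, q, hq, hne, he⟩ := hP
      have hqm : q ∈ collidingFronts f ε v := ⟨hq, P, hP1, hne.symm, he.symm⟩
      rw [hset] at hqm
      rcases hqm with rfl | rfl
      · exact absurd rfl hne
      · exact he
    have hc : sInf ((fun p : ℝ × ℝ => p.1 + p.2 * τ) '' collidingFronts f ε v) =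
        P.1 + P.2 * τ := by
      rw [hset, image_pair, ← hmeet, Set.pair_eq_singleton, csInf_singleton]
    rw [hc]
    have hcol : ∀ q ∈ W, ∀ q' ∈ W, ¬ (x q = x q' ∧ w q = w q') →
        x q + w q * τ = x q' + w q' * τ → (x q, w q) = P ∨ (x q, w q) = Q := by
      intro q hq q' hq' hne he
      have : (x q, w q) ∈ collidingFronts f ε v :=
        ⟨hmem q hq, (x q', w q'), hmem q' hq', fun hh => hne (Prod.mk.injEq _ _ _ _ ▸ hh), he⟩
      rw [hset] at this
      exact this
    subst hzlP hzrQ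
    refine ⟨zl, zr, hzl, hzr, hlt, rfl, hmeet.symm, ?_, ?_⟩
    · intro q hq he
      by_cases hf : x q = x zl ∧ w q = w zl
      · exact Or.inl hf
      · rcases hcol q hq zl hzl hf he with h1 | h1
        · exact Or.inl (Prod.mk.injEq _ _ _ _ ▸ h1)
        · exact Or.inr (Prod.mk.injEq _ _ _ _ ▸ h1)
    · intro q hq q' hq' he
      by_cases hf : x q = x q' ∧ w q = w q'
      · exact Or.inl hf
      · right
        have h1 : x q + w q * τ = x zl + w zl * τ := by
          rcases hcol q hq q' hq' hf he with h1 | h1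
          · rw [(Prod.mk.inj h1).1, (Prod.mk.inj h1).2]
          · rw [(Prod.mk.inj h1).1, (Prod.mk.inj h1).2]; exact hmeet.symm
        exact ⟨h1, he.symm.trans h1⟩
  have hne : P.1 ≠ Q.1 := by
    intro he
    have hP : P ∈ collidingFronts f ε v := by rw [hset]; simp
    obtain ⟨hP1, q, hq, hneq, hee⟩ := hP
    have hqm : q ∈ collidingFronts f ε v := ⟨hq, P, hP1, hneq.symm, hee.symm⟩
    rw [hset] at hqm
    rcases hqm with rfl | rfl
    · exact hneq rfl
    · rw [he] at hee
      have hτ0 : 0 < τ := (h.nextDelay_mem hε hcoll).1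
      have : P.2 = q.2 := by
        have := add_left_cancel hee
        exact mul_right_cancel₀ hτ0.ne' this
      exact hPQ (Prod.ext he this)
  rcases lt_or_gt_of_ne hne with hlt | hlt
  · exact key P Q hPQ hset hlt
  · exact key Q P hPQ.symm (hset.trans (Set.pair_comm P Q)) hlt

/-! ### A binary collision -/

/-- Numbering the elements of a finite set by their rank. -/
theorem card_filter_rank_le {X : Finset ℕ} {k : ℕ} (hk : k ≤ X.card) :
    (X.filter (fun q => (X.filter (· ≤ q)).card ≤ k)).card = k := by
  have hlt : ∀ q ∈ X, ∀ q' ∈ X, q < q' → (X.filter (· ≤ q)).card < (X.filter (· ≤ q')).card := by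
    intro q _ q' hq' hlt
    apply Finset.card_lt_card
    rw [Finset.ssubset_iff_of_subset]
    · exact ⟨q', by simp [hq'], by simp [hlt]⟩
    · intro r hr
      rw [Finset.mem_filter] at hr ⊢
      exact ⟨hr.1, hr.2.trans hlt.le⟩
  have hinj : Set.InjOn (fun q => (X.filter (· ≤ q)).card) (X : Set ℕ) := by
    intro q hq q' hq' he
    rcases lt_trichotomy q q' with h | h | h
    · exact absurd he (hlt q hq q' hq' h).ne
    · exact h
    · exact absurd he (hlt q' hq' q hq h).ne'
  have himg : X.image (fun q => (X.filter (· ≤ q)).card) = Finset.Icc 1 X.card := by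
    apply Finset.eq_of_subset_of_card_le
    · intro m hm
      obtain ⟨q, hq, rfl⟩ := Finset.mem_image.1 hm
      rw [Finset.mem_Icc]
      exact ⟨Finset.card_pos.2 ⟨q, by simp [hq]⟩, Finset.card_filter_le _ _⟩
    · rw [Finset.card_image_of_injOn hinj]; simp
  rw [← Finset.card_image_of_injOn (hinj.mono (by
    intro q hq; simp only [Finset.coe_filter, mem_ofPred_eq] at hq; exact hq.1)),
    ← Finset.filter_image (p := fun m => m ≤ k), himg]
  have : (Finset.Icc 1 X.card).filter (fun m => m ≤ k) = Finset.Icc 1 k := by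
    ext m; simp only [Finset.mem_filter, Finset.mem_Icc]; omega
  rw [this]; simp

/-- The wave `s` is retained at the collision point: its cell lies between the states `L` and `R`
on the two sides. -/
def Retained (σ n : ℕ → ℤ) (L R : ℤ) (s : ℕ) : Prop :=
  σ s * L ≤ σ s * n s - 1 ∧ σ s * n s ≤ σ s * R

open Classical in
/-- The waves that remain after a collision at `c`. -/
noncomputable def remaining (σ n : ℕ → ℤ) (W : Finset ℕ) (p : ℕ → ℝ) (c : ℝ) : Finset ℕ :=
  W.filter (fun s => p s = c → Retained σ n (∑ q ∈ W.filter (fun q => p q < c), σ q)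
    (∑ q ∈ W.filter (fun q => p q ≤ c), σ q) s)

/-- What happens to the waves in a binary collision. If the colliding fronts have opposite signs,
then the removed waves are the right end of the left front and the left end of the right front, and
one of the two fronts disappears. -/
structure CollisionStep (ε : ℝ) (σ n : ℕ → ℤ) (W W' : Finset ℕ) (x w p : ℕ → ℝ) (v' : ℝ → ℝ)
    (c : ℝ) (zl zr : ℕ) : Prop where
  config : IsConfig ε σ n W' p v'
  sub : W' ⊆ W
  removed : ∀ s ∈ W, s ∉ W' → p s = c
  left_lt : σ zl ≠ σ zr → ∀ r ∈ W, r ∉ W' → (x r = x zl ∧ w r = w zl) →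
    ∀ s ∈ W', (x s = x zl ∧ w s = w zl) → s < r
  right_lt : σ zl ≠ σ zr → ∀ r ∈ W, r ∉ W' → (x r = x zr ∧ w r = w zr) →
    ∀ s ∈ W', (x s = x zr ∧ w s = w zr) → r < s
  one : σ zl ≠ σ zr → (∀ s ∈ W', ¬ (x s = x zr ∧ w s = w zr)) ∨
    (∀ s ∈ W', ¬ (x s = x zl ∧ w s = w zl))

set_option maxHeartbeats 1000000 in
/-- The states of the colliding waves are determined by their rank in the two fronts `X` and `Y`, so
the condition for being retained is one on the rank: if the signs agree all waves are retained, and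
otherwise `min #X #Y` waves are removed on either side of the common boundary. -/
theorem collisionStep (h : IsConfig ε σ n W x v) {w : ℕ → ℝ} {τ c : ℝ} {zl zr : ℕ}
    (hc : IsCollision W x w τ c zl zr) {v' : ℝ → ℝ}
    (hmono : MonotoneOn (fun q => x q + w q * τ) W)
    (hv' : ∀ z, v' z = ε * ((∑ q ∈ W.filter (fun q => x q + w q * τ ≤ z), σ q : ℤ) : ℝ)) :
    CollisionStep ε σ n W (remaining σ n W (fun q => x q + w q * τ) c) x w
      (fun q => x q + w q * τ) v' c zl zr := by
  classical
  set p : ℕ → ℝ := fun q => x q + w q * τ with hp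
  set L : ℤ := ∑ q ∈ W.filter (fun q => p q < c), σ q with hL
  set R : ℤ := ∑ q ∈ W.filter (fun q => p q ≤ c), σ q with hR
  set W' := remaining σ n W p c with hW'
  set X := W.filter (fun q => x q = x zl ∧ w q = w zl) with hX
  set Y := W.filter (fun q => x q = x zr ∧ w q = w zr) with hY
  have memX : ∀ {q}, q ∈ X ↔ q ∈ W ∧ (x q = x zl ∧ w q = w zl) := by simp [hX]
  have memY : ∀ {q}, q ∈ Y ↔ q ∈ W ∧ (x q = x zr ∧ w q = w zr) := by simp [hY]
  have memW' : ∀ {q}, q ∈ W' ↔ q ∈ W ∧ (p q = c → Retained σ n L R q) := by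
    simp [hW', remaining, hL, hR]
  have hXp : ∀ q ∈ X, p q = c := fun q hq => by
    rw [← hc.left_eq, hp]; simp only; rw [(memX.1 hq).2.1, (memX.1 hq).2.2]
  have hYp : ∀ q ∈ Y, p q = c := fun q hq => by
    rw [← hc.right_eq, hp]; simp only; rw [(memY.1 hq).2.1, (memY.1 hq).2.2]
  have hXY : ∀ q ∈ X, ∀ q' ∈ Y, q < q' := fun q hq q' hq' => by
    by_contra! hle
    have := h.mono (memY.1 hq').1 (memX.1 hq).1 hle
    rw [(memY.1 hq').2.1, (memX.1 hq).2.1] at this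
    exact absurd hc.lt (not_lt.2 this)
  have hfr : ∀ q ∈ W, p q = c → q ∈ X ∨ q ∈ Y := fun q hq he => by
    rcases hc.front q hq he with h1 | h1
    · exact Or.inl (memX.2 ⟨hq, h1⟩)
    · exact Or.inr (memY.2 ⟨hq, h1⟩)
  have hσX : ∀ q ∈ X, σ q = σ zl := fun q hq =>
    h.sign_eq q (memX.1 hq).1 zl hc.left_mem (memX.1 hq).2.1
  have hσY : ∀ q ∈ Y, σ q = σ zr := fun q hq =>
    h.sign_eq q (memY.1 hq).1 zr hc.right_mem (memY.1 hq).2.1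
  have ltc : ∀ q ∈ W, ∀ s ∈ W, p s = c → p q < c → q < s := fun q hq s hs hs' hq' => by
    by_contra! hle
    have := hmono hs hq hle
    change p s ≤ p q at this
    linarith
  have gtc : ∀ q ∈ W, ∀ s ∈ W, p s = c → c < p q → s < q := fun q hq s hs hs' hq' => by
    by_contra! hle
    have := hmono hq hs hle
    change p q ≤ p s at this
    linarith
  have dXY : Disjoint X Y := Finset.disjoint_left.2 fun q hq hq' => lt_irrefl _ (hXY q hq q hq')
  have sumX : ∀ T ⊆ X, ∑ q ∈ T, σ q = σ zl * T.card := fun T hT => by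
    rw [Finset.sum_congr rfl fun q hq => hσX q (hT hq)]; simp [mul_comm]
  have sumY : ∀ T ⊆ Y, ∑ q ∈ T, σ q = σ zr * T.card := fun T hT => by
    rw [Finset.sum_congr rfl fun q hq => hσY q (hT hq)]; simp [mul_comm]
  -- the states of the colliding waves
  have hRe : R = L + σ zl * X.card + σ zr * Y.card := by
    have e : W.filter (fun q => p q ≤ c) = W.filter (fun q => p q < c) ∪ (X ∪ Y) := by
      ext q
      simp only [Finset.mem_filter, Finset.mem_union]
      constructor
      · rintro ⟨h1, h2⟩
        rcases h2.eq_or_lt with h3 | h3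
        · exact Or.inr (hfr q h1 h3)
        · exact Or.inl ⟨h1, h3⟩
      · rintro (⟨h1, h2⟩ | h1 | h1)
        · exact ⟨h1, h2.le⟩
        · exact ⟨(memX.1 h1).1, (hXp q h1).le⟩
        · exact ⟨(memY.1 h1).1, (hYp q h1).le⟩
    rw [hR, e, Finset.sum_union, Finset.sum_union dXY, sumX X subset_rfl, sumY Y subset_rfl]
    · ring
    · rw [Finset.disjoint_left]
      intro q hq hq'
      rw [Finset.mem_filter] at hq
      rcases Finset.mem_union.1 hq' with h1 | h1
      · exact hq.2.ne (hXp q h1)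
      · exact hq.2.ne (hYp q h1)
  have hnX : ∀ s ∈ X, n s = L + σ zl * (X.filter (· ≤ s)).card := by
    intro s hs
    have hsW := (memX.1 hs).1
    have e : W.filter (· ≤ s) = W.filter (fun q => p q < c) ∪ X.filter (· ≤ s) := by
      ext q
      simp only [Finset.mem_filter, Finset.mem_union]
      constructor
      · rintro ⟨h1, h2⟩
        rcases lt_trichotomy (p q) c with h3 | h3 | h3
        · exact Or.inl ⟨h1, h3⟩
        · rcases hfr q h1 h3 with h4 | h4
          · exact Or.inr ⟨h4, h2⟩
          · exact absurd (hXY s hs q h4) (not_lt.2 h2)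
        · exact absurd (gtc q h1 s hsW (hXp s hs) h3) (not_lt.2 h2)
      · rintro (⟨h1, h2⟩ | ⟨h1, h2⟩)
        · exact ⟨h1, (ltc q h1 s hsW (hXp s hs) h2).le⟩
        · exact ⟨(memX.1 h1).1, h2⟩
    rw [← h.state s hsW, e, Finset.sum_union, sumX _ (Finset.filter_subset _ _)]
    rw [Finset.disjoint_left]
    intro q hq hq'
    rw [Finset.mem_filter] at hq hq'
    exact hq.2.ne (hXp q hq'.1)
  have hnY : ∀ s ∈ Y, n s = L + σ zl * X.card + σ zr * (Y.filter (· ≤ s)).card := by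
    intro s hs
    have hsW := (memY.1 hs).1
    have e : W.filter (· ≤ s) = W.filter (fun q => p q < c) ∪ (X ∪ Y.filter (· ≤ s)) := by
      ext q
      simp only [Finset.mem_filter, Finset.mem_union]
      constructor
      · rintro ⟨h1, h2⟩
        rcases lt_trichotomy (p q) c with h3 | h3 | h3
        · exact Or.inl ⟨h1, h3⟩
        · rcases hfr q h1 h3 with h4 | h4
          · exact Or.inr (Or.inl h4)
          · exact Or.inr (Or.inr ⟨h4, h2⟩)
        · exact absurd (gtc q h1 s hsW (hYp s hs) h3) (not_lt.2 h2)
      · rintro (⟨h1, h2⟩ | h1 | ⟨h1, h2⟩)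
        · exact ⟨h1, (ltc q h1 s hsW (hYp s hs) h2).le⟩
        · exact ⟨(memX.1 h1).1, (hXY q h1 s hs).le⟩
        · exact ⟨(memY.1 h1).1, h2⟩
    rw [← h.state s hsW, e, Finset.sum_union, Finset.sum_union, sumX X subset_rfl,
      sumY _ (Finset.filter_subset _ _)]
    · ring
    · exact dXY.mono_right (Finset.filter_subset _ _)
    · rw [Finset.disjoint_left]
      intro q hq hq'
      rw [Finset.mem_filter] at hq
      rcases Finset.mem_union.1 hq' with h1 | h1
      · exact hq.2.ne (hXp q h1)
      · exact hq.2.ne (hYp q (Finset.mem_filter.1 h1).1)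
  have rkX : ∀ s ∈ X, 1 ≤ (X.filter (· ≤ s)).card ∧ (X.filter (· ≤ s)).card ≤ X.card := fun s hs =>
    ⟨Finset.card_pos.2 ⟨s, by simp [hs]⟩, Finset.card_filter_le _ _⟩
  have rkY : ∀ s ∈ Y, 1 ≤ (Y.filter (· ≤ s)).card ∧ (Y.filter (· ≤ s)).card ≤ Y.card := fun s hs =>
    ⟨Finset.card_pos.2 ⟨s, by simp [hs]⟩, Finset.card_filter_le _ _⟩
  have sl1 := h.sign zl hc.left_mem
  have sr1 := h.sign zr hc.right_mem
  have hsub : W' ⊆ W := fun q hq => (memW'.1 hq).1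
  have hrem : ∀ s ∈ W, s ∉ W' → p s = c := fun s hs hs' => by
    by_contra hne
    exact hs' (memW'.2 ⟨hs, fun he => absurd he hne⟩)
  -- It suffices to know the survivors: in each case the removed waves form a block of total sign 0.
  have finish : (∀ s ∈ W', ∑ q ∈ (W \ W').filter (· ≤ s), σ q = 0) →
      ∑ q ∈ W \ W', σ q = 0 →
      (∀ s ∈ W', ∀ s' ∈ W', p s = c → p s' = c → σ s = σ s') →
      IsConfig ε σ n W' p v' := by
    intro h1 h2 h3
    have hsplit : ∀ P : ℕ → Prop, [DecidablePred P] → ∑ q ∈ W.filter P, σ q =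
        ∑ q ∈ W'.filter P, σ q + ∑ q ∈ (W \ W').filter P, σ q := by
      intro P _
      rw [← Finset.sum_union]
      · rw [← Finset.filter_union, Finset.union_sdiff_of_subset hsub]
      · exact Finset.disjoint_filter_filter Finset.disjoint_sdiff
    refine ⟨fun s hs => h.sign s (hsub hs), fun s hs => ?_, fun z => ?_, fun s hs s' hs' hle =>
      hmono (hsub hs) (hsub hs') hle, fun s hs s' hs' he => ?_⟩
    · rw [← h.state s (hsub hs), hsplit, h1 s hs, add_zero]
    · rw [hv' z]
      congr 2
      rw [hsplit]
      have hrp : ∀ q ∈ W \ W', p q = c := fun q hq =>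
        hrem q (Finset.mem_sdiff.1 hq).1 (Finset.mem_sdiff.1 hq).2
      have : ∑ q ∈ (W \ W').filter (fun q => x q + w q * τ ≤ z), σ q = 0 := by
        rcases le_or_gt c z with hz | hz
        · rw [Finset.filter_true_of_mem (fun q hq => (hrp q hq).trans_le hz), h2]
        · rw [Finset.filter_false_of_mem (fun q hq => not_le.2 (hz.trans_eq (hrp q hq).symm)),
            Finset.sum_empty]
      rw [this, add_zero]
    · rcases hc.only s (hsub hs) s' (hsub hs') he with h4 | h4
      · exact h.sign_eq s (hsub hs) s' (hsub hs') h4.1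
      · exact h3 s hs s' hs' h4.1 h4.2
  by_cases hsame : σ zl = σ zr
  · -- waves of the same sign: all of them are retained
    have hall : W' = W := by
      refine Finset.Subset.antisymm hsub fun q hq => memW'.2 ⟨hq, fun he => ?_⟩
      have e1 : σ zl * σ zl = 1 := by rcases sl1 with h1 | h1 <;> rw [h1] <;> norm_num
      rcases hfr q hq he with h1 | h1
      · have := rkX q h1
        have h2 : ((X.filter (· ≤ q)).card : ℤ) ≤ X.card := by exact_mod_cast this.2
        have h3 : (1 : ℤ) ≤ (X.filter (· ≤ q)).card := by exact_mod_cast this.1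
        have h4 : (0 : ℤ) ≤ Y.card := by positivity
        rw [Retained, hσX q h1, hnX q h1, hRe, ← hsame]
        constructor
        · linear_combination h3 - ((X.filter (· ≤ q)).card : ℤ) * e1
        · linear_combination h2 + h4 + (((X.filter (· ≤ q)).card : ℤ) - X.card - Y.card) * e1
      · have := rkY q h1
        have h2 : ((Y.filter (· ≤ q)).card : ℤ) ≤ Y.card := by exact_mod_cast this.2
        have h3 : (1 : ℤ) ≤ (Y.filter (· ≤ q)).card := by exact_mod_cast this.1
        have h4 : (0 : ℤ) ≤ X.card := by positivity
        rw [Retained, hσY q h1, hnY q h1, hRe, ← hsame]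
        constructor
        · linear_combination h3 + h4 - (X.card + ((Y.filter (· ≤ q)).card : ℤ)) * e1
        · linear_combination h2 + (((Y.filter (· ≤ q)).card : ℤ) - Y.card) * e1
    refine ⟨finish ?_ ?_ ?_, hsub, hrem, fun hh => absurd hsame hh, fun hh => absurd hsame hh,
      fun hh => absurd hsame hh⟩
    · rw [hall]; simp
    · rw [hall]; simp
    · intro s hs s' hs' he he'
      have e : ∀ q ∈ W', p q = c → σ q = σ zl := fun q hq he => by
        rcases hfr q (hsub hq) he with h1 | h1
        · exact hσX q h1
        · rw [hσY q h1, hsame]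
      rw [e s hs he, e s' hs' he']
  · -- waves of opposite signs
    have hopp : σ zr = - σ zl := by
      clear_value X Y W' L R
      omega
    have survX : ∀ q ∈ X, (q ∈ W' ↔ (X.filter (· ≤ q)).card + Y.card ≤ X.card) := by
      intro q hq
      have h1 := rkX q hq
      rw [memW', Retained, hσX q hq, hnX q hq, hRe, hopp]
      simp only [(memX.1 hq).1, hXp q hq, true_and, true_implies]
      rcases sl1 with h2 | h2 <;> rw [h2] <;> omega
    have survY : ∀ q ∈ Y, (q ∈ W' ↔ X.card + 1 ≤ (Y.filter (· ≤ q)).card) := by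
      intro q hq
      have h1 := rkY q hq
      rw [memW', Retained, hσY q hq, hnY q hq, hRe, hopp]
      simp only [(memY.1 hq).1, hYp q hq, true_and, true_implies]
      rcases sl1 with h2 | h2 <;> rw [h2] <;> omega
    have rk_le : ∀ (T : Finset ℕ) (q q' : ℕ), q ≤ q' →
        (T.filter (· ≤ q)).card ≤ (T.filter (· ≤ q')).card := fun T q q' hqq =>
      Finset.card_le_card fun r hr => by
        rw [Finset.mem_filter] at hr ⊢; exact ⟨hr.1, hr.2.trans hqq⟩
    have leftlt : ∀ r ∈ X, r ∉ W' → ∀ s ∈ W', s ∈ X → s < r := by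
      intro r hr hrW s hs hsX
      by_contra! hle
      have h1 := rk_le X r s hle
      rw [survX r hr] at hrW
      rw [survX s hsX] at hs
      omega
    have rightlt : ∀ r ∈ Y, r ∉ W' → ∀ s ∈ W', s ∈ Y → r < s := by
      intro r hr hrW s hs hsY
      by_contra! hle
      have h1 := rk_le Y s r hle
      rw [survY r hr] at hrW
      rw [survY s hsY] at hs
      omega
    have hone : (∀ s ∈ W', s ∉ Y) ∨ (∀ s ∈ W', s ∉ X) := by
      rcases le_total Y.card X.card with hYX | hXY'
      · left
        intro s hs hsY
        rw [survY s hsY] at hs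
        have := rkY s hsY
        omega
      · right
        intro s hs hsX
        rw [survX s hsX] at hs
        have := rkX s hsX
        omega
    have hR' : W \ W' = (X.filter (· ∉ W')) ∪ (Y.filter (· ∉ W')) := by
      ext q
      simp only [Finset.mem_sdiff, Finset.mem_union, Finset.mem_filter]
      constructor
      · rintro ⟨h1, h2⟩
        rcases hfr q h1 (hrem q h1 h2) with h3 | h3
        · exact Or.inl ⟨h3, h2⟩
        · exact Or.inr ⟨h3, h2⟩
      · rintro (⟨h1, h2⟩ | ⟨h1, h2⟩)
        · exact ⟨(memX.1 h1).1, h2⟩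
        · exact ⟨(memY.1 h1).1, h2⟩
    have cX : (X.filter (· ∈ W')).card = X.card - Y.card := by
      rw [← card_filter_rank_le (X := X) (k := X.card - Y.card) (by omega)]
      congr 1
      refine Finset.filter_congr fun q hq => ?_
      have := rkX q hq
      rw [survX q hq]; omega
    have cY : (Y.filter (· ∉ W')).card = min X.card Y.card := by
      rw [← card_filter_rank_le (X := Y) (k := min X.card Y.card) (by omega)]
      congr 1
      refine Finset.filter_congr fun q hq => ?_
      have := rkY q hq
      rw [survY q hq]; omega
    have cX' : (X.filter (· ∉ W')).card = min X.card Y.card := by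
      have := Finset.card_filter_add_card_filter_not (s := X) (fun q => q ∈ W')
      omega
    have hsum : ∑ q ∈ W \ W', σ q = 0 := by
      rw [hR', Finset.sum_union (Finset.disjoint_filter_filter dXY),
        sumX _ (Finset.filter_subset _ _), sumY _ (Finset.filter_subset _ _), cX', cY, hopp]
      ring
    refine ⟨finish ?_ hsum ?_, hsub, hrem,
      fun _ r hr hrW hf s hs hf' => leftlt r (memX.2 ⟨hr, hf⟩) hrW s hs (memX.2 ⟨hsub hs, hf'⟩),
      fun _ r hr hrW hf s hs hf' => rightlt r (memY.2 ⟨hr, hf⟩) hrW s hs (memY.2 ⟨hsub hs, hf'⟩),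
      fun _ => hone.imp (fun h1 s hs hf => h1 s hs (memY.2 ⟨hsub hs, hf⟩))
        (fun h1 s hs hf => h1 s hs (memX.2 ⟨hsub hs, hf⟩))⟩
    · intro s hs
      have hsW := hsub hs
      -- either all removed waves come after `s` or all of them come before `s`
      have : (∀ q ∈ W \ W', s < q) ∨ (∀ q ∈ W \ W', q < s) := by
        rcases lt_trichotomy (p s) c with h1 | h1 | h1
        · left
          intro q hq
          rw [Finset.mem_sdiff] at hq
          exact ltc s hsW q hq.1 (hrem q hq.1 hq.2) h1
        · rcases hfr s hsW h1 with h2 | h2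
          · left
            intro q hq
            rw [hR', Finset.mem_union] at hq
            rcases hq with hq | hq <;> obtain ⟨hq1, hq2⟩ := Finset.mem_filter.1 hq
            · exact leftlt q hq1 hq2 s hs h2
            · exact hXY s h2 q hq1
          · right
            intro q hq
            rw [hR', Finset.mem_union] at hq
            rcases hq with hq | hq <;> obtain ⟨hq1, hq2⟩ := Finset.mem_filter.1 hq
            · exact hXY q hq1 s h2
            · exact rightlt q hq1 hq2 s hs h2
        · right
          intro q hq
          rw [Finset.mem_sdiff] at hq
          exact gtc s hsW q hq.1 (hrem q hq.1 hq.2) h1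
      rcases this with h1 | h1
      · rw [Finset.filter_false_of_mem (fun q hq => not_le.2 (h1 q hq)), Finset.sum_empty]
      · rw [Finset.filter_true_of_mem (fun q hq => (h1 q hq).le), hsum]
    · intro s hs s' hs' he he'
      rcases hfr s (hsub hs) he with h1 | h1 <;> rcases hfr s' (hsub hs') he' with h2 | h2
      · rw [hσX s h1, hσX s' h2]
      · rcases hone with h3 | h3
        · exact absurd h2 (h3 s' hs')
        · exact absurd h1 (h3 s hs)
      · rcases hone with h3 | h3
        · exact absurd h1 (h3 s hs)
        · exact absurd h2 (h3 s' hs')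
      · rw [hσY s h1, hσY s' h2]

end IsConfig

end WFT

namespace WFT

/-! ### The waves at the initial time -/

section Initial

variable {ε : ℝ} {u₀ ubar : ℝ → ℝ}

theorem varUpTo_add (hu : BoundedVariationOn u₀ univ) {y z : ℝ} (hyz : y ≤ z) :
    varUpTo u₀ z = varUpTo u₀ y + (eVariationOn u₀ (Icc y z)).toReal := by
  rw [varUpTo, varUpTo, ← ENNReal.toReal_add (hu.mono (subset_univ _)) (hu.mono (subset_univ _)),
    ← eVariationOn.union u₀ (isGreatest_Iic) (isLeast_Icc hyz), Iic_union_Icc_eq_Iic hyz]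

theorem varUpTo_mono (hu : BoundedVariationOn u₀ univ) : Monotone (varUpTo u₀) := fun y z h => by
  rw [varUpTo_add hu h]; simp

theorem abs_sub_le_varUpTo (hu : BoundedVariationOn u₀ univ) {y z : ℝ} (hyz : y ≤ z) :
    |u₀ z - u₀ y| ≤ varUpTo u₀ z - varUpTo u₀ y := by
  rw [varUpTo_add hu hyz, add_sub_cancel_left, ← Real.dist_eq]
  exact BoundedVariationOn.dist_le (hu.mono (subset_univ _)) (right_mem_Icc.2 hyz)
    (left_mem_Icc.2 hyz)

/-- The variation of a function that is constant but for a jump at the right end. -/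
theorem varUpTo_sub_of_const (hu : BoundedVariationOn u₀ univ) {y z : ℝ} (hyz : y ≤ z)
    (hc : ∀ w ∈ Ico y z, u₀ w = u₀ y) : varUpTo u₀ z - varUpTo u₀ y = |u₀ z - u₀ y| := by
  refine le_antisymm ?_ (abs_sub_le_varUpTo hu hyz)
  rw [varUpTo_add hu hyz, add_sub_cancel_left]
  have hval : ∀ w ∈ Icc y z, w = z ∨ u₀ w = u₀ y := fun w hw => by
    rcases hw.2.eq_or_lt with h | h
    · exact Or.inl h
    · exact Or.inr (hc w ⟨hw.1, h⟩)
  refine ENNReal.toReal_le_of_le_ofReal (abs_nonneg _) ?_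
  rcases le_total (u₀ y) (u₀ z) with h | h
  · have hm : MonotoneOn u₀ (Icc y z) := by
      intro a ha b hb hab
      rcases hval b hb with rfl | hb'
      · rcases hval a ha with rfl | ha'
        · exact le_rfl
        · rw [ha']; exact h
      · rcases hval a ha with rfl | ha'
        · rw [le_antisymm hab hb.2]
        · rw [ha', hb']
    rw [abs_of_nonneg (sub_nonneg.2 h)]
    simpa using (hm.eVariationOn_eq (left_mem_Icc.2 hyz) (right_mem_Icc.2 hyz)).le
  · have hm : MonotoneOn (fun w => -u₀ w) (Icc y z) := by
      intro a ha b hb hab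
      rcases hval b hb with rfl | hb'
      · rcases hval a ha with rfl | ha'
        · exact le_rfl
        · simp only [ha']; exact neg_le_neg h
      · rcases hval a ha with rfl | ha'
        · rw [le_antisymm hab hb.2]
        · simp only [ha', hb', le_refl]
    have h1 := (hm.eVariationOn_eq (left_mem_Icc.2 hyz) (right_mem_Icc.2 hyz)).le
    rw [inter_self] at h1
    rw [abs_of_nonpos (sub_nonpos.2 h)]
    have h2 : eVariationOn (fun w => -u₀ w) (Icc y z) = eVariationOn u₀ (Icc y z) := by
      simp only [eVariationOn, edist_neg_neg]
    rw [h2] at h1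
    rwa [show -(u₀ z - u₀ y) = -u₀ z - -u₀ y by ring]

/-- A function with values in `εℤ` has its variation in `εℕ`. -/
theorem exists_eVariationOn_eq (hε : 0 < ε) (hv : ∀ x, ∃ m : ℤ, u₀ x = m * ε) {s : Set ℝ}
    (hne : s.Nonempty) (hu : BoundedVariationOn u₀ s) :
    ∃ k : ℕ, eVariationOn u₀ s = ENNReal.ofReal (ε * k) := by
  choose m hm using hv
  let cnt : (ℕ × { u : ℕ → ℝ // Monotone u ∧ ∀ i, u i ∈ s }) → ℕ := fun p =>
    ∑ i ∈ Finset.range p.1, (m (p.2.1 (i + 1)) - m (p.2.1 i)).natAbs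
  have hcnt : ∀ p : ℕ × { u : ℕ → ℝ // Monotone u ∧ ∀ i, u i ∈ s },
      ∑ i ∈ Finset.range p.1, edist (u₀ (p.2.1 (i + 1))) (u₀ (p.2.1 i)) =
        ENNReal.ofReal (ε * cnt p) := by
    intro p
    rw [Nat.cast_sum, Finset.mul_sum, ENNReal.ofReal_sum_of_nonneg fun i _ => by positivity]
    refine Finset.sum_congr rfl fun i _ => ?_
    rw [edist_dist, Real.dist_eq, hm, hm, ← sub_mul, abs_mul, abs_of_pos hε, mul_comm,
      Nat.cast_natAbs]
    push_cast
    rfl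
  have hE : eVariationOn u₀ s = ⨆ p, ENNReal.ofReal (ε * cnt p) := by
    simp only [eVariationOn, hcnt]
  have hbdd : BddAbove (range cnt) := by
    refine ⟨⌊(eVariationOn u₀ s).toReal / ε⌋₊, ?_⟩
    rintro _ ⟨p, rfl⟩
    rw [Nat.le_floor_iff (by positivity), le_div_iff₀ hε, mul_comm]
    rw [← ENNReal.ofReal_le_iff_le_toReal hu, hE]
    exact le_iSup (fun p => ENNReal.ofReal (ε * cnt p)) p
  have := eVariationOn.nonempty_monotone_mem hne
  obtain ⟨p, hp⟩ := Nat.sSup_mem (range_nonempty cnt) hbdd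
  refine ⟨cnt p, ?_⟩
  rw [hE]
  refine le_antisymm (iSup_le fun q => ENNReal.ofReal_le_ofReal ?_)
    (le_iSup (fun p => ENNReal.ofReal (ε * cnt p)) p)
  refine mul_le_mul_of_nonneg_left ?_ hε.le
  rw [hp]
  exact_mod_cast le_csSup hbdd ⟨q, rfl⟩

theorem IsDiscretization.boundedVariationOn (hu₀ : IsDiscretization ε ubar u₀)
    (hubar : BoundedVariationOn ubar univ) : BoundedVariationOn u₀ univ :=
  ne_top_of_le_ne_top hubar hu₀.variation_le

theorem exists_varUpTo_eq (hε : 0 < ε) (hu₀ : IsDiscretization ε ubar u₀)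
    (hu : BoundedVariationOn u₀ univ) (x : ℝ) : ∃ k : ℕ, varUpTo u₀ x = ε * k := by
  obtain ⟨k, hk⟩ := exists_eVariationOn_eq hε hu₀.values (nonempty_Iic (a := x))
    (hu.mono (subset_univ _))
  exact ⟨k, by rw [varUpTo, hk, ENNReal.toReal_ofReal (by positivity)]⟩

/-- Since the values are discrete, `u₀` is constant to the right of every point, and so is its
variation. -/
theorem exists_varUpTo_right (hε : 0 < ε) (hu₀ : IsDiscretization ε ubar u₀)
    (hu : BoundedVariationOn u₀ univ) (x : ℝ) :
    ∃ z > x, ∀ w ∈ Ico x z, varUpTo u₀ w = varUpTo u₀ x := by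
  have h1 : ∀ᶠ w in 𝓝[≥] x, |u₀ w - u₀ x| < ε := by
    have := (hu₀.rightCont x).eventually (Metric.ball_mem_nhds (u₀ x) hε)
    simpa [Metric.mem_ball, Real.dist_eq] using this
  obtain ⟨z, hz, hI⟩ := (mem_nhdsGE_iff_exists_Ico_subset).1 h1
  have hconst : ∀ w ∈ Ico x z, u₀ w = u₀ x := by
    intro w hw
    have h2 : |u₀ w - u₀ x| < ε := hI hw
    obtain ⟨m, hm⟩ := hu₀.values w
    obtain ⟨m', hm'⟩ := hu₀.values x
    rw [hm, hm', ← sub_mul, abs_mul, abs_of_pos hε] at h2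
    have h3 : |((m - m' : ℤ) : ℝ)| < 1 := by
      push_cast
      exact lt_of_mul_lt_mul_right (by linarith) hε.le
    have h4 : |m - m'| < 1 := by exact_mod_cast h3
    rw [hm, hm', sub_eq_zero.1 (Int.abs_lt_one_iff.1 h4)]
  refine ⟨z, hz, fun w hw => ?_⟩
  have := varUpTo_sub_of_const hu hw.1 fun w' hw' => hconst w' ⟨hw'.1, hw'.2.trans hw.2⟩
  rw [hconst w hw, sub_self, abs_zero] at this
  linarith

/-- Outside a compact interval `u₀` vanishes. -/
theorem exists_support (hu₀ : IsDiscretization ε ubar u₀) :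
    ∃ A B : ℝ, (∀ x ≤ A, u₀ x = 0) ∧ ∀ x ≥ B, u₀ x = 0 := by
  obtain ⟨r, hr⟩ := hu₀.compactSupport.isCompact.isBounded.subset_closedBall 0
  have : ∀ x, |x| > r → u₀ x = 0 := by
    intro x hx
    by_contra h
    have := hr (subset_tsupport _ h)
    rw [mem_closedBall_zero_iff, Real.norm_eq_abs] at this
    linarith
  refine ⟨-|r| - 1, |r| + 1, fun x hx => this x ?_, fun x hx => this x ?_⟩
  · linarith [le_abs_self r, neg_le_abs x]
  · linarith [le_abs_self x, le_abs_self r]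

theorem exists_varUpTo_eq_zero (hu₀ : IsDiscretization ε ubar u₀) :
    ∃ A : ℝ, (∀ x ≤ A, varUpTo u₀ x = 0) ∧ ∀ x ≤ A, u₀ x = 0 := by
  obtain ⟨A, -, hA, -⟩ := exists_support hu₀
  refine ⟨A, fun x hx => ?_, hA⟩
  rw [varUpTo, eVariationOn.constant_on, ENNReal.toReal_zero]
  rintro _ ⟨a, ha, rfl⟩ _ ⟨b, hb, rfl⟩
  rw [hA a (le_trans ha hx), hA b (le_trans hb hx)]

theorem exists_varUpTo_eq_totVar (hu₀ : IsDiscretization ε ubar u₀) :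
    ∃ B : ℝ, varUpTo u₀ B = totVar u₀ := by
  obtain ⟨-, B, -, hB⟩ := exists_support hu₀
  refine ⟨B, ?_⟩
  rw [varUpTo, totVar, ← Iic_union_Ici (a := B), eVariationOn.union u₀ isGreatest_Iic isLeast_Ici,
    show eVariationOn u₀ (Ici B) = 0 from eVariationOn.constant_on ?_, add_zero]
  rintro _ ⟨a, ha, rfl⟩ _ ⟨b, hb, rfl⟩
  rw [hB a ha, hB b hb]

theorem varUpTo_le_totVar (hu : BoundedVariationOn u₀ univ) (x : ℝ) : varUpTo u₀ x ≤ totVar u₀ :=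
  ENNReal.toReal_mono hu (eVariationOn.mono u₀ (subset_univ _))

theorem mem_waves (hε : 0 < ε) (s : ℕ) : s ∈ waves ε u₀ ↔ 0 < s ∧ ε * s ≤ totVar u₀ := by
  rw [waves, Finset.mem_Icc, Nat.le_floor_iff (by rw [totVar]; positivity), le_div_iff₀ hε,
    mul_comm (s : ℝ)]
  rfl

/-- The wave `s` lies at or to the left of `x` if the variation up to `x` has reached `ε s`. -/
theorem initPos_le_iff (hε : 0 < ε) (hu₀ : IsDiscretization ε ubar u₀)
    (hu : BoundedVariationOn u₀ univ) {s : ℕ} (hs : s ∈ waves ε u₀) (x : ℝ) :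
    initPos ε u₀ s ≤ x ↔ ε * s ≤ varUpTo u₀ x := by
  rw [mem_waves hε] at hs
  obtain ⟨A, hA, -⟩ := exists_varUpTo_eq_zero hu₀
  obtain ⟨B, hB⟩ := exists_varUpTo_eq_totVar hu₀
  have hpos : 0 < ε * s := mul_pos hε (by exact_mod_cast hs.1)
  have hbdd : BddBelow {x : ℝ | ε * s ≤ varUpTo u₀ x} := by
    refine ⟨A, fun x hx => ?_⟩
    by_contra! hlt
    have hx : ε * s ≤ varUpTo u₀ x := hx
    rw [hA x hlt.le] at hx
    linarith
  have hne : {x : ℝ | ε * s ≤ varUpTo u₀ x}.Nonempty :=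
    ⟨B, by rw [mem_ofPred_eq, hB]; exact hs.2⟩
  constructor
  · intro hle
    refine le_trans ?_ (varUpTo_mono hu hle)
    obtain ⟨z, hz, hzz⟩ := exists_varUpTo_right hε hu₀ hu (initPos ε u₀ s)
    obtain ⟨w, hw, hwz⟩ := exists_lt_of_csInf_lt hne (show sInf _ < z from hz)
    rw [← hzz w ⟨csInf_le hbdd hw, hwz⟩]
    exact hw
  · exact fun h => csInf_le hbdd h

/-- The sign of the wave `s` as an integer. -/
noncomputable def intSign (ε : ℝ) (u₀ : ℝ → ℝ) (s : ℕ) : ℤ :=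
  if 0 < waveSign ε u₀ s then 1 else -1

/-- The right state of the wave `s` in units of `ε`. -/
noncomputable def intState (ε : ℝ) (u₀ : ℝ → ℝ) (s : ℕ) : ℤ :=
  ∑ q ∈ (waves ε u₀).filter (· ≤ s), intSign ε u₀ q

theorem intState_eq_add {k N : ℕ} {c : ℤ} (hk : k ≤ N)
    (hq : ∀ q, k < q → q ≤ N → q ∈ waves ε u₀ ∧ intSign ε u₀ q = c) :
    intState ε u₀ N = intState ε u₀ k + (N - k : ℤ) * c := by
  have e : (waves ε u₀).filter (· ≤ N) = (waves ε u₀).filter (· ≤ k) ∪ Finset.Ioc k N := by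
    ext q
    simp only [Finset.mem_filter, Finset.mem_union, Finset.mem_Ioc]
    constructor
    · rintro ⟨h1, h2⟩
      rcases le_or_gt q k with h3 | h3
      · exact Or.inl ⟨h1, h3⟩
      · exact Or.inr ⟨h3, h2⟩
    · rintro (⟨h1, h2⟩ | ⟨h1, h2⟩)
      · exact ⟨h1, h2.trans hk⟩
      · exact ⟨(hq q h1 h2).1, h2⟩
  rw [intState, intState, e, Finset.sum_union]
  · congr 1
    rw [Finset.sum_congr rfl fun q hq' =>
      (hq q (Finset.mem_Ioc.1 hq').1 (Finset.mem_Ioc.1 hq').2).2]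
    simp only [Finset.sum_const, Nat.card_Ioc, nsmul_eq_mul]
    rw [Nat.cast_sub hk]
  · rw [Finset.disjoint_left]
    intro q h1 h2
    rw [Finset.mem_filter] at h1
    rw [Finset.mem_Ioc] at h2
    omega

/-- To the left of the initial position of a wave, `u₀` and its variation are locally constant. -/
theorem exists_left (hε : 0 < ε) (hu₀ : IsDiscretization ε ubar u₀)
    (hu : BoundedVariationOn u₀ univ) {s : ℕ} (hs : s ∈ waves ε u₀) :
    ∃ y < initPos ε u₀ s, ∃ k < s, varUpTo u₀ y = ε * k ∧
      Function.leftLim u₀ (initPos ε u₀ s) = u₀ y ∧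
      Function.leftLim (varUpTo u₀) (initPos ε u₀ s) = ε * k ∧
      |u₀ (initPos ε u₀ s) - u₀ y| = varUpTo u₀ (initPos ε u₀ s) - ε * k ∧
      ∀ w ∈ Ico y (initPos ε u₀ s), varUpTo u₀ w = ε * k := by
  choose N hN using exists_varUpTo_eq hε hu₀ hu
  set ξ := initPos ε u₀ s with hξ
  have hlt : ∀ y < ξ, N y < s := by
    intro y hy
    have := (initPos_le_iff hε hu₀ hu hs y).not.1 (not_le.2 hy)
    rw [hN y, not_le] at this
    exact_mod_cast lt_of_mul_lt_mul_left this hε.le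
  have hbdd : BddAbove (N '' Iio ξ) := ⟨s, by rintro _ ⟨y, hy, rfl⟩; exact (hlt y hy).le⟩
  obtain ⟨y, hy, hyk⟩ := Nat.sSup_mem ((nonempty_Iio (a := ξ)).image N) hbdd
  have hconst : ∀ w ∈ Ico y ξ, varUpTo u₀ w = ε * (N y : ℕ) := by
    intro w hw
    refine le_antisymm ?_ ((hN y).symm.trans_le (varUpTo_mono hu hw.1))
    rw [hN w, hyk]
    refine mul_le_mul_of_nonneg_left ?_ hε.le
    exact_mod_cast le_csSup hbdd ⟨w, hw.2, rfl⟩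
  have hconst' : ∀ w ∈ Ico y ξ, u₀ w = u₀ y := by
    intro w hw
    have := abs_sub_le_varUpTo hu hw.1
    rw [hconst w hw, hN y, sub_self] at this
    exact sub_eq_zero.1 (abs_nonpos_iff.1 this)
  have hev : Ico y ξ ∈ 𝓝[<] ξ := Ico_mem_nhdsLT hy
  refine ⟨y, hy, N y, hlt y hy, hN y, ?_, ?_, ?_, hconst⟩
  · refine leftLim_eq_of_tendsto (tendsto_const_nhds.congr' ?_)
    filter_upwards [hev] with w hw using (hconst' w hw).symm
  · refine leftLim_eq_of_tendsto (tendsto_const_nhds.congr' ?_)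
    filter_upwards [hev] with w hw using (hconst w hw).symm
  · rw [← varUpTo_sub_of_const hu (le_of_lt hy) hconst', hN y]

/-- The local structure of `u₀` at the initial position of the wave `s`: the waves there are those
from `k + 1` to `m`, and they all have the sign of the jump. -/
theorem exists_initial_jump (hε : 0 < ε) (hu₀ : IsDiscretization ε ubar u₀)
    (hu : BoundedVariationOn u₀ univ) {s : ℕ} (hs : s ∈ waves ε u₀) :
    ∃ y k m, y < initPos ε u₀ s ∧ k < s ∧ s ≤ m ∧ varUpTo u₀ y = ε * (k : ℕ) ∧
      varUpTo u₀ (initPos ε u₀ s) = ε * (m : ℕ) ∧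
      Function.leftLim u₀ (initPos ε u₀ s) = u₀ y ∧
      Function.leftLim (varUpTo u₀) (initPos ε u₀ s) = ε * k ∧
      waveSign ε u₀ s = intSign ε u₀ s ∧
      u₀ (initPos ε u₀ s) = u₀ y + ε * (((m - k : ℤ) * intSign ε u₀ s : ℤ) : ℝ) ∧
      ∀ q, k < q → q ≤ m → q ∈ waves ε u₀ ∧ intSign ε u₀ q = intSign ε u₀ s := by
  obtain ⟨y, hy, k, hk, hyk, hl, hlU, habs, hconst⟩ := exists_left hε hu₀ hu hs
  obtain ⟨m, hm⟩ := exists_varUpTo_eq hε hu₀ hu (initPos ε u₀ s)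
  have hsm : s ≤ m := by
    have := (initPos_le_iff hε hu₀ hu hs _).1 le_rfl
    rw [hm] at this
    exact_mod_cast le_of_mul_le_mul_left this hε
  have hkm : (k : ℝ) < m := by exact_mod_cast hk.trans_le hsm
  rw [hm, ← mul_sub] at habs
  have hpos : 0 < ε * ((m : ℝ) - k) := mul_pos hε (by linarith)
  have hne : u₀ (initPos ε u₀ s) - u₀ y ≠ 0 := abs_pos.1 (habs ▸ hpos)
  have hws : waveSign ε u₀ s = Real.sign (u₀ (initPos ε u₀ s) - u₀ y) := by
    rw [waveSign, jump, hl]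
  refine ⟨y, k, m, hy, hk, hsm, hyk, hm, hl, hlU, ?_, ?_, ?_⟩
  · rw [intSign, hws]
    rcases lt_or_gt_of_ne hne with h | h
    · rw [Real.sign_of_neg h]; norm_num
    · rw [Real.sign_of_pos h]; norm_num
  · rw [intSign, hws]
    rcases lt_or_gt_of_ne hne with h | h
    · rw [abs_of_neg h] at habs
      rw [Real.sign_of_neg h, if_neg (by norm_num)]; push_cast; linarith
    · rw [abs_of_pos h] at habs
      rw [Real.sign_of_pos h, if_pos (by norm_num)]; push_cast; linarith
  · intro q hkq hqm
    have hq : q ∈ waves ε u₀ := by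
      rw [mem_waves hε]
      refine ⟨by omega, le_trans ?_ ((hm.symm.trans_le (varUpTo_le_totVar hu _)))⟩
      exact mul_le_mul_of_nonneg_left (by exact_mod_cast hqm) hε.le
    have hpq : initPos ε u₀ q = initPos ε u₀ s := by
      refine le_antisymm ?_ (le_of_not_gt fun hlt => ?_)
      · rw [initPos_le_iff hε hu₀ hu hq, hm]
        exact mul_le_mul_of_nonneg_left (by exact_mod_cast hqm) hε.le
      · have h1 : initPos ε u₀ q ≤ max y (initPos ε u₀ q) := le_max_right _ _
        rw [initPos_le_iff hε hu₀ hu hq, hconst _ ⟨le_max_left _ _, max_lt hy hlt⟩] at h1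
        have : (q : ℝ) ≤ k := le_of_mul_le_mul_left h1 hε
        exact absurd (by exact_mod_cast this : q ≤ k) (not_le.2 hkq)
    exact ⟨hq, by rw [intSign, intSign, waveSign, waveSign, hpq]⟩

/-- The states of `u₀`, read off from the number of waves up to a point. -/
theorem eq_intState_of_varUpTo (hε : 0 < ε) (hu₀ : IsDiscretization ε ubar u₀)
    (hu : BoundedVariationOn u₀ univ) : ∀ (N : ℕ) (x : ℝ), varUpTo u₀ x = ε * N →
      u₀ x = ε * (intState ε u₀ N : ℝ) := by
  intro N
  induction N using Nat.strong_induction_on with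
  | _ N ih =>
    intro x hx
    rcases Nat.eq_zero_or_pos N with rfl | hN
    · obtain ⟨A, hA, hA'⟩ := exists_varUpTo_eq_zero hu₀
      have h1 := abs_sub_le_varUpTo hu (min_le_right A x)
      rw [hA _ (min_le_left _ _), hA' _ (min_le_left _ _), hx] at h1
      have : (waves ε u₀).filter (· ≤ 0) = ∅ := by
        ext q; simp [waves]; omega
      rw [intState, this]
      simpa using h1
    · have hNw : N ∈ waves ε u₀ := by
        rw [mem_waves hε, ← hx]; exact ⟨hN, varUpTo_le_totVar hu x⟩
      obtain ⟨y, k, m, hy, hk, hsm, hyk, hm, -, -, -, hval, hq⟩ :=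
        exists_initial_jump hε hu₀ hu hNw
      have hle : initPos ε u₀ N ≤ x := (initPos_le_iff hε hu₀ hu hNw x).2 hx.ge
      have hmN : m = N := by
        refine le_antisymm ?_ hsm
        have := varUpTo_mono hu hle
        rw [hm, hx] at this
        exact_mod_cast le_of_mul_le_mul_left this hε
      subst hmN
      have hxx : u₀ x = u₀ (initPos ε u₀ m) := by
        have := abs_sub_le_varUpTo hu hle
        rw [hm, hx, sub_self] at this
        exact sub_eq_zero.1 (abs_nonpos_iff.1 this)
      rw [hxx, hval, ih k hk y hyk, ← mul_add, ← Int.cast_add, intState_eq_add hk.le hq]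

theorem waveSign_eq (hε : 0 < ε) (hu₀ : IsDiscretization ε ubar u₀)
    (hu : BoundedVariationOn u₀ univ) {s : ℕ} (hs : s ∈ waves ε u₀) :
    waveSign ε u₀ s = intSign ε u₀ s := by
  obtain ⟨y, k, m, -, -, -, -, -, -, -, h, -⟩ := exists_initial_jump hε hu₀ hu hs
  exact h

theorem rightState_eq (hε : 0 < ε) (hu₀ : IsDiscretization ε ubar u₀)
    (hu : BoundedVariationOn u₀ univ) {s : ℕ} (hs : s ∈ waves ε u₀) :
    rightState ε u₀ s = ε * (intState ε u₀ s : ℝ) := by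
  obtain ⟨y, k, m, hy, hk, hsm, hyk, hm, hl, hlU, hws, -, hq⟩ :=
    exists_initial_jump hε hu₀ hu hs
  rw [rightState, hl, hlU, hws, eq_intState_of_varUpTo hε hu₀ hu k y hyk]
  rw [intState_eq_add hk.le fun q h1 h2 => hq q h1 (h2.trans hsm)]
  push_cast
  ring

theorem isConfig_initial (hε : 0 < ε) (hu₀ : IsDiscretization ε ubar u₀)
    (hu : BoundedVariationOn u₀ univ) :
    IsConfig ε (intSign ε u₀) (intState ε u₀) (waves ε u₀) (initPos ε u₀) u₀ where
  sign s _ := by rw [intSign]; split_ifs <;> simp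
  state s _ := rfl
  profile z := by
    obtain ⟨N, hN⟩ := exists_varUpTo_eq hε hu₀ hu z
    rw [eq_intState_of_varUpTo hε hu₀ hu N z hN, intState]
    congr 3
    refine Finset.filter_congr fun q hq => ?_
    rw [initPos_le_iff hε hu₀ hu hq, hN, mul_le_mul_iff_right₀ hε, Nat.cast_le]
  mono s hs s' hs' hle := by
    rw [initPos_le_iff hε hu₀ hu hs]
    exact le_trans (mul_le_mul_of_nonneg_left (by exact_mod_cast hle) hε.le)
      ((initPos_le_iff hε hu₀ hu hs' _).1 le_rfl)
  sign_eq s _ s' _ hx := by rw [intSign, intSign, waveSign, waveSign, hx]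

end Initial

end WFT

namespace WFT

/-! ### The waves at the collision times -/

/-- The standing assumptions on the data of a wavefront tracking solution. -/
structure Admissible (f : ℝ → ℝ) (ε : ℝ) (ubar u₀ : ℝ → ℝ) : Prop where
  pos : 0 < ε
  disc : IsDiscretization ε ubar u₀
  bv : BoundedVariationOn u₀ univ
  bin : ∀ i : ℕ, HasCollision f ε u₀ i → IsBinaryCollision f ε u₀ i

open Classical in
/-- The waves that are present after the `i`-th collision. -/
noncomputable def alive (f : ℝ → ℝ) (ε : ℝ) (u₀ : ℝ → ℝ) (i : ℕ) : Finset ℕ :=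
  (waves ε u₀).filter fun s => posAt f ε u₀ i s ≠ ⊤

/-- The position after the `i`-th collision as a real number, with the value `0` for the waves
that have been removed. -/
noncomputable def place (f : ℝ → ℝ) (ε : ℝ) (u₀ : ℝ → ℝ) (i s : ℕ) : ℝ :=
  (posAt f ε u₀ i s).untopD 0

/-- The speed of the wave `s` after the `i`-th collision. -/
noncomputable def speed (f : ℝ → ℝ) (ε : ℝ) (u₀ : ℝ → ℝ) (i : ℕ) : ℕ → ℝ :=
  IsConfig.vel f ε (intState ε u₀) (place f ε u₀ i) (profile f ε u₀ i)

variable {f : ℝ → ℝ} {ε : ℝ} {ubar u₀ : ℝ → ℝ} {i j k s s' : ℕ}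

theorem mem_alive : s ∈ alive f ε u₀ i ↔ s ∈ waves ε u₀ ∧ posAt f ε u₀ i s ≠ ⊤ := by
  simp [alive]

theorem posAt_eq (hs : s ∈ alive f ε u₀ i) : posAt f ε u₀ i s = (place f ε u₀ i s : ℝ) := by
  obtain ⟨p, hp⟩ := WithTop.ne_top_iff_exists.1 (mem_alive.1 hs).2
  rw [place, ← hp, WithTop.untopD_coe]

theorem speedAt_eq (A : Admissible f ε ubar u₀) (hs : s ∈ waves ε u₀) :
    speedAt f ε u₀ (profile f ε u₀ i) (place f ε u₀ i s) s = speed f ε u₀ i s := by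
  rw [speedAt, rightState_eq A.pos A.disc A.bv hs]; rfl

open Classical in
theorem posAt_succ (A : Admissible f ε ubar u₀) (hs : s ∈ alive f ε u₀ i) :
    posAt f ε u₀ (i + 1) s =
      if place f ε u₀ i s + speed f ε u₀ i s * nextDelay f ε (profile f ε u₀ i) =
        collisionPoint f ε u₀ i ∧ HasCollision f ε u₀ i ∧ ¬ Survives f ε u₀ i s then ⊤
      else ((place f ε u₀ i s + speed f ε u₀ i s * nextDelay f ε (profile f ε u₀ i) : ℝ) :
        WithTop ℝ) := by
  rw [posAt, posAt_eq hs]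
  simp only [speedAt_eq A (mem_alive.1 hs).1]

theorem alive_succ_subset : alive f ε u₀ (i + 1) ⊆ alive f ε u₀ i := by
  intro s hs
  rw [mem_alive] at hs ⊢
  refine ⟨hs.1, fun h => hs.2 ?_⟩
  rw [posAt, h]

theorem alive_anti (h : k ≤ i) : alive f ε u₀ i ⊆ alive f ε u₀ k := by
  induction i, h using Nat.le_induction with
  | base => exact Finset.Subset.refl _
  | succ n _ ih => exact alive_succ_subset.trans ih

theorem mem_alive_succ (A : Admissible f ε ubar u₀) : s ∈ alive f ε u₀ (i + 1) ↔
    s ∈ alive f ε u₀ i ∧ ¬ (place f ε u₀ i s + speed f ε u₀ i s *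
      nextDelay f ε (profile f ε u₀ i) = collisionPoint f ε u₀ i ∧
        HasCollision f ε u₀ i ∧ ¬ Survives f ε u₀ i s) := by
  classical
  constructor
  · intro h
    have hs := alive_succ_subset h
    refine ⟨hs, fun hc => (mem_alive.1 h).2 ?_⟩
    rw [posAt_succ A hs, if_pos hc]
  · rintro ⟨hs, hc⟩
    rw [mem_alive, posAt_succ A hs, if_neg hc]
    exact ⟨(mem_alive.1 hs).1, WithTop.coe_ne_top⟩

theorem place_succ (A : Admissible f ε ubar u₀) (hs : s ∈ alive f ε u₀ (i + 1)) :
    place f ε u₀ (i + 1) s =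
      place f ε u₀ i s + speed f ε u₀ i s * nextDelay f ε (profile f ε u₀ i) := by
  classical
  rw [place, posAt_succ A (alive_succ_subset hs), if_neg ((mem_alive_succ A).1 hs).2]
  rfl

theorem IsConfig.congr {σ n : ℕ → ℤ} {W : Finset ℕ} {x x' : ℕ → ℝ} {v : ℝ → ℝ}
    (h : IsConfig ε σ n W x v) (hx : ∀ s ∈ W, x' s = x s) : IsConfig ε σ n W x' v where
  sign := h.sign
  state := h.state
  profile z := by
    rw [h.profile, Finset.filter_congr fun q hq => by rw [← hx q hq]]
  mono s hs s' hs' hle := by rw [hx s hs, hx s' hs']; exact h.mono hs hs' hle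
  sign_eq s hs s' hs' he := h.sign_eq s hs s' hs' (by rwa [hx s hs, hx s' hs'] at he)

theorem profile_succ_of_not_hasCollision (A : Admissible f ε ubar u₀)
    (h : IsConfig ε (intSign ε u₀) (intState ε u₀) (alive f ε u₀ i) (place f ε u₀ i)
      (profile f ε u₀ i)) (hc : ¬ HasCollision f ε u₀ i) :
    profile f ε u₀ (i + 1) = profile f ε u₀ i := by
  funext z
  rw [profile, h.evolve_eq A.pos, nextDelay_eq_zero hc, h.profile]
  simp only [mul_zero, add_zero]

/-- The survival condition in terms of integers. -/
theorem survives_iff (A : Admissible f ε ubar u₀) {W : Finset ℕ} {p : ℕ → ℝ}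
    (hs : s ∈ waves ε u₀) (hv : ∀ z, profile f ε u₀ (i + 1) z =
      ε * ((∑ q ∈ W.filter (fun q => p q ≤ z), intSign ε u₀ q : ℤ) : ℝ)) :
    Survives f ε u₀ i s ↔ IsConfig.Retained (intSign ε u₀) (intState ε u₀)
      (∑ q ∈ W.filter (fun q => p q < collisionPoint f ε u₀ i), intSign ε u₀ q)
      (∑ q ∈ W.filter (fun q => p q ≤ collisionPoint f ε u₀ i), intSign ε u₀ q) s := by
  rw [Survives, leftLim_step hv, hv, waveSign_eq A.pos A.disc A.bv hs,
    rightState_eq A.pos A.disc A.bv hs, IsConfig.Retained]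
  have key : ∀ m m' d : ℤ, ((intSign ε u₀ s : ℝ) * (ε * m) ≤ intSign ε u₀ s * (ε * m') - ε * d ↔
      intSign ε u₀ s * m ≤ intSign ε u₀ s * m' - d) := by
    intro m m' d
    rw [show (intSign ε u₀ s : ℝ) * (ε * m) = ε * ((intSign ε u₀ s * m : ℤ) : ℝ) by
      push_cast; ring, show (intSign ε u₀ s : ℝ) * (ε * m') - ε * d =
      ε * ((intSign ε u₀ s * m' - d : ℤ) : ℝ) by push_cast; ring, mul_le_mul_iff_right₀ A.pos,
      Int.cast_le]
  refine and_congr ?_ ?_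
  · rw [← key, Int.cast_one, mul_one]
  · rw [← sub_zero (intSign ε u₀ s * (∑ q ∈ _, _ : ℤ)), ← key, Int.cast_zero, mul_zero, sub_zero]

/-- What a collision does to the waves, provided that they describe the profile before it. -/
theorem exists_collisionStep (A : Admissible f ε ubar u₀)
    (h : IsConfig ε (intSign ε u₀) (intState ε u₀) (alive f ε u₀ i) (place f ε u₀ i)
      (profile f ε u₀ i)) (hc : HasCollision f ε u₀ i) :
    ∃ zl zr, IsConfig.IsCollision (alive f ε u₀ i) (place f ε u₀ i) (speed f ε u₀ i)
        (nextDelay f ε (profile f ε u₀ i)) (collisionPoint f ε u₀ i) zl zr ∧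
      IsConfig.CollisionStep ε (intSign ε u₀) (intState ε u₀) (alive f ε u₀ i)
        (alive f ε u₀ (i + 1)) (place f ε u₀ i) (speed f ε u₀ i)
        (fun q => place f ε u₀ i q + speed f ε u₀ i q * nextDelay f ε (profile f ε u₀ i))
        (profile f ε u₀ (i + 1)) (collisionPoint f ε u₀ i) zl zr := by
  classical
  obtain ⟨zl, zr, hcol⟩ := h.exists_isCollision A.pos hc (A.bin i hc)
  refine ⟨zl, zr, hcol, ?_⟩
  have hv' := h.evolve_eq (f := f) A.pos (nextDelay f ε (profile f ε u₀ i))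
  have hstep := h.collisionStep hcol
    (h.move_mono (f := f) A.pos nextDelay_nonneg le_rfl) hv'
  have : alive f ε u₀ (i + 1) = IsConfig.remaining (intSign ε u₀) (intState ε u₀)
      (alive f ε u₀ i)
      (fun q => place f ε u₀ i q + speed f ε u₀ i q * nextDelay f ε (profile f ε u₀ i))
      (collisionPoint f ε u₀ i) := by
    ext s
    rw [mem_alive_succ A, IsConfig.remaining, Finset.mem_filter]
    refine and_congr_right fun hs => ?_
    rw [survives_iff A (mem_alive.1 hs).1 hv']
    constructor
    · exact fun h1 h2 => by_contra fun h3 => h1 ⟨h2, hc, h3⟩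
    · exact fun h1 h2 => h2.2.2 (h1 h2.1)
  rw [this]
  exact hstep

/-- The waves describe the profile at all collision times. -/
theorem isConfig (A : Admissible f ε ubar u₀) (i : ℕ) :
    IsConfig ε (intSign ε u₀) (intState ε u₀) (alive f ε u₀ i) (place f ε u₀ i)
      (profile f ε u₀ i) := by
  induction i with
  | zero =>
    have : alive f ε u₀ 0 = waves ε u₀ := by
      ext s; rw [mem_alive, posAt]; simp
    rw [this]
    exact isConfig_initial A.pos A.disc A.bv
  | succ i ih =>
    by_cases hc : HasCollision f ε u₀ i
    · obtain ⟨zl, zr, -, hstep⟩ := exists_collisionStep A ih hc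
      exact hstep.config.congr fun s hs => place_succ A hs
    · have : alive f ε u₀ (i + 1) = alive f ε u₀ i := by
        ext s; rw [mem_alive_succ A]; tauto
      rw [profile_succ_of_not_hasCollision A ih hc, this]
      refine ih.congr fun s hs => ?_
      rw [place_succ A (this ▸ hs), nextDelay_eq_zero hc, mul_zero, add_zero]

/-! ### Times between collisions -/

theorem HasCollision.of_succ (A : Admissible f ε ubar u₀) (h : HasCollision f ε u₀ (i + 1)) :
    HasCollision f ε u₀ i := by
  by_contra hc
  rw [HasCollision, profile_succ_of_not_hasCollision A (isConfig A i) hc] at h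
  exact hc h

theorem HasCollision.of_le (A : Admissible f ε ubar u₀) (h : HasCollision f ε u₀ j) (hij : i ≤ j) :
    HasCollision f ε u₀ i := by
  induction j, hij using Nat.le_induction with
  | base => exact h
  | succ n _ ih => exact ih (h.of_succ A)

theorem time_succ : time f ε u₀ (i + 1) = time f ε u₀ i + nextDelay f ε (profile f ε u₀ i) :=
  Finset.sum_range_succ _ _

theorem time_mono : Monotone (time f ε u₀) :=
  monotone_nat_of_le_succ fun i => by
    rw [time_succ]
    exact le_add_of_nonneg_right nextDelay_nonneg

theorem time_lt_succ (A : Admissible f ε ubar u₀) (h : HasCollision f ε u₀ i) :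
    time f ε u₀ i < time f ε u₀ (i + 1) := by
  rw [time_succ]
  linarith [((isConfig A i).nextDelay_mem A.pos h).1]

theorem collisionCount_eq (A : Admissible f ε ubar u₀) {r : ℝ} (hk : ∀ i < k, HasCollision f ε u₀ i)
    (h1 : time f ε u₀ k ≤ r) (h2 : ¬ HasCollision f ε u₀ k ∨ r < time f ε u₀ (k + 1)) :
    collisionCount f ε u₀ r = k := by
  have : {i : ℕ | HasCollision f ε u₀ i ∧ time f ε u₀ (i + 1) ≤ r} = (Finset.range k : Set ℕ) := by
    ext i
    simp only [mem_ofPred_eq, Finset.coe_range, mem_Iio]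
    constructor
    · rintro ⟨hi, hr⟩
      by_contra! hle
      rcases h2 with h2 | h2
      · exact h2 (hi.of_le A hle)
      · exact absurd (h2.trans_le (time_mono (Nat.succ_le_succ hle))) (not_lt.2 hr)
    · exact fun hi => ⟨hk i hi, (time_mono hi).trans h1⟩
  rw [collisionCount, this, ncard_coe_finset, Finset.card_range]

theorem collisionCount_time (A : Admissible f ε ubar u₀) (hk : ∀ i < k, HasCollision f ε u₀ i) :
    collisionCount f ε u₀ (time f ε u₀ k) = k := by
  refine collisionCount_eq A hk le_rfl ?_
  by_cases hc : HasCollision f ε u₀ k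
  · exact Or.inr (time_lt_succ A hc)
  · exact Or.inl hc

theorem pos_eq (A : Admissible f ε ubar u₀) {r : ℝ} (hr : collisionCount f ε u₀ r = k)
    (hs : s ∈ alive f ε u₀ k) :
    pos f ε u₀ r s = ((place f ε u₀ k s + speed f ε u₀ k s * (r - time f ε u₀ k) : ℝ) :
      WithTop ℝ) := by
  rw [pos, hr, posAt_eq hs]
  simp only [speedAt_eq A (mem_alive.1 hs).1]

theorem pos_eq_top {r : ℝ} (hr : collisionCount f ε u₀ r = k) (hs : posAt f ε u₀ k s = ⊤) :
    pos f ε u₀ r s = ⊤ := by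
  rw [pos, hr, hs]

theorem realWaves_time (A : Admissible f ε ubar u₀) (hk : ∀ i < k, HasCollision f ε u₀ i) :
    realWaves f ε u₀ (time f ε u₀ k) = alive f ε u₀ k := by
  have hc := collisionCount_time A hk
  ext s
  rw [realWaves, Finset.mem_filter]
  constructor
  · rintro ⟨h1, h2⟩
    exact mem_alive.2 ⟨h1, fun h => h2 (pos_eq_top hc h)⟩
  · intro hs
    refine ⟨(mem_alive.1 hs).1, ?_⟩
    rw [pos_eq A hc hs]
    exact WithTop.coe_ne_top

theorem sol_time (A : Admissible f ε ubar u₀) (hk : ∀ i < k, HasCollision f ε u₀ i) :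
    sol f ε u₀ (time f ε u₀ k) = profile f ε u₀ k := by
  funext z
  rw [sol, collisionCount_time A hk, sub_self, (isConfig A k).evolve_eq A.pos,
    (isConfig A k).profile]
  simp only [mul_zero, add_zero]

/-- Two waves have interacted by the time of the `i`-th collision if and only if they have been at
the same position at one of the collision times: between two collisions fronts do not meet. -/
theorem haveInteracted_time_iff (A : Admissible f ε ubar u₀)
    (hi : ∀ k < i, HasCollision f ε u₀ k) :
    HaveInteracted f ε u₀ (time f ε u₀ i) s s' ↔ s ∈ alive f ε u₀ i ∧ s' ∈ alive f ε u₀ i ∧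
      ∃ k ≤ i, place f ε u₀ k s = place f ε u₀ k s' := by
  rw [HaveInteracted, realWaves_time A hi]
  refine and_congr_right fun hs => and_congr_right fun hs' => ?_
  constructor
  · rintro ⟨r, hr0, hr, he⟩
    obtain ⟨k, hki, h1, h2⟩ : ∃ k ≤ i, time f ε u₀ k ≤ r ∧ (k = i ∨ r < time f ε u₀ (k + 1)) := by
      clear hs hs' hi
      induction i with
      | zero => exact ⟨0, le_rfl, by simpa [time] using hr0, Or.inl rfl⟩
      | succ i ih =>
        rcases lt_or_ge r (time f ε u₀ (i + 1)) with h | h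
        · rcases le_or_gt r (time f ε u₀ i) with h' | h'
          · obtain ⟨k, hk, h1, h2⟩ := ih h'
            refine ⟨k, by omega, h1, Or.inr ?_⟩
            rcases h2 with rfl | h2
            · exact h
            · exact h2
          · exact ⟨i, by omega, h'.le, Or.inr h⟩
        · exact ⟨i + 1, le_rfl, h, Or.inl rfl⟩
    have hk : ∀ q < k, HasCollision f ε u₀ q := fun q hq => hi q (by omega)
    have hrr : r - time f ε u₀ k < nextDelay f ε (profile f ε u₀ k) ∨ ¬ HasCollision f ε u₀ k := by
      by_cases hc : HasCollision f ε u₀ k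
      · left
        rcases h2 with rfl | h2
        · have := time_lt_succ A hc
          rw [time_succ] at this
          linarith
        · rw [time_succ] at h2; linarith
      · exact Or.inr hc
    have hcount : collisionCount f ε u₀ r = k := by
      refine collisionCount_eq A hk h1 (hrr.symm.imp id fun h => ?_)
      rw [time_succ]; linarith
    rw [pos_eq A hcount (alive_anti hki hs), pos_eq A hcount (alive_anti hki hs'),
      WithTop.coe_inj] at he
    exact ⟨k, hki, (isConfig A k).sameFront_of_move_eq A.pos (sub_nonneg.2 h1) hrr
      (alive_anti hki hs) (alive_anti hki hs') he⟩
  · rintro ⟨k, hki, he⟩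
    have hk : ∀ q < k, HasCollision f ε u₀ q := fun q hq => hi q (by omega)
    refine ⟨time f ε u₀ k, ?_, time_mono hki, ?_⟩
    · exact Finset.sum_nonneg fun _ _ => nextDelay_nonneg
    · have hc := collisionCount_time A hk
      rw [pos_eq A hc (alive_anti hki hs), pos_eq A hc (alive_anti hki hs'), sub_self, mul_zero,
        mul_zero, add_zero, add_zero, he]

end WFT

namespace WFT

variable {f : ℝ → ℝ} {ε : ℝ} {ubar u₀ : ℝ → ℝ} {i j k s s' r a b : ℕ}

/-! ### The waves of the wavefront tracking solution as an abstract system -/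

theorem intSign_eq (s : ℕ) : intSign ε u₀ s = 1 ∨ intSign ε u₀ s = -1 := by
  rw [intSign]; split_ifs <;> simp

/-- The waves of the wavefront tracking solution, the stages being the collision times. -/
noncomputable def waveSystem (A : Admissible f ε ubar u₀) : WaveSystem ℕ where
  W := alive f ε u₀
  x := place f ε u₀
  v := speed f ε u₀
  y s := intSign ε u₀ s * intState ε u₀ s
  F s := gridFlux f ε (intSign ε u₀ s)
  W_succ _ := alive_succ_subset
  x_mono i := (isConfig A i).mono
  F_eq i s hs s' hs' he := by rw [(isConfig A i).sign_eq s hs s' hs' he]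
  card_class i _ hs _ hs' hle hx := (isConfig A i).card_class hs hs' hle hx
  card_le i s hs s' hs' hle hx := by
    obtain ⟨k, hk, he⟩ := hx
    exact (isConfig A i).card_le hs hs' hle
      ((isConfig A k).sign_eq s (alive_anti hk hs) s' (alive_anti hk hs') he)
  speed i s hs a ha b hb hxa hxb hz := (isConfig A i).fanSpeed_eq A.pos ⟨hs, ha, hb, hxa, hxb, hz⟩
  motion i s hs s' hs' hx hv := by rw [place_succ A hs, place_succ A hs', hx, hv]

theorem haveInteracted_iff_inter (A : Admissible f ε ubar u₀)
    (hi : ∀ k < i, HasCollision f ε u₀ k) :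
    HaveInteracted f ε u₀ (time f ε u₀ i) s s' ↔ (waveSystem A).Inter i s s' :=
  haveInteracted_time_iff A hi

theorem Inter.sign_eq (A : Admissible f ε ubar u₀) (h : (waveSystem A).Inter i s s') :
    intSign ε u₀ s = intSign ε u₀ s' := by
  obtain ⟨hs, hs', k, hk, he⟩ := h
  exact (isConfig A k).sign_eq s (alive_anti hk hs) s' (alive_anti hk hs') he

theorem intSign_mul_self (s : ℕ) : intSign ε u₀ s * intSign ε u₀ s = 1 := by
  rcases intSign_eq (ε := ε) (u₀ := u₀) s with h | h <;> rw [h] <;> norm_num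

/-! ### Weights of pairs of waves -/

/-- The cells of the waves that have interacted with both `s` and `s'` fill the interval between the
cell of the first and that of the last such wave, so the artificial speed is an envelope slope. -/
theorem artSpeed_commonWaves (A : Admissible f ε ubar u₀) (hi : ∀ k < i, HasCollision f ε u₀ k)
    (hab : Ext ((waveSystem A).common i s s') a b)
    (hr : r ∈ (waveSystem A).common i s s') :
    artSpeed f ε u₀ (commonWaves f ε u₀ (time f ε u₀ i) s s') r =
      sl ((waveSystem A).F s) ((waveSystem A).y a - 1) ((waveSystem A).y b)
        ((waveSystem A).y r) := by
  have hε := A.pos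
  have hK : commonWaves f ε u₀ (time f ε u₀ i) s s' = {p | p ∈ (waveSystem A).common i s s'} := by
    ext p
    rw [commonWaves, mem_ofPred_eq, mem_ofPred_eq, haveInteracted_iff_inter A hi,
      haveInteracted_iff_inter A hi, WaveSystem.mem_common]
  have hsg : ∀ p ∈ (waveSystem A).common i s s', intSign ε u₀ p = intSign ε u₀ s := fun p hp =>
    Inter.sign_eq A (WaveSystem.mem_common.1 hp).1
  have hw : ∀ p ∈ (waveSystem A).common i s s', p ∈ waves ε u₀ := fun p hp =>
    (mem_alive.1 (WaveSystem.mem_common.1 hp).1.1).1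
  have hya : ∀ p ∈ (waveSystem A).common i s s', (waveSystem A).y a ≤ (waveSystem A).y p :=
    fun p hp => WaveSystem.y_le_of_mem_common hab.1 hp (hab.2.2 p hp).1
  have hyb : ∀ p ∈ (waveSystem A).common i s s', (waveSystem A).y p ≤ (waveSystem A).y b :=
    fun p hp => WaveSystem.y_le_of_mem_common hp hab.2.1 (hab.2.2 p hp).2
  have hy : ∀ p ∈ (waveSystem A).common i s s',
      (waveSystem A).y p = intSign ε u₀ s * intState ε u₀ p := fun p hp => by
    rw [← hsg p hp]; rfl
  have hF : (waveSystem A).F s = gridFlux f ε (intSign ε u₀ s) := rfl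
  have h1 := hya r hr
  have h2 := hyb r hr
  have hpos : 0 < waveSign ε u₀ r ↔ intSign ε u₀ s = 1 := by
    rw [waveSign_eq hε A.disc A.bv (hw r hr), hsg r hr]
    rcases intSign_eq (ε := ε) (u₀ := u₀) s with h | h <;> rw [h] <;> norm_num
  have hcell : ∀ p ∈ (waveSystem A).common i s s', cell ε u₀ p =
      if intSign ε u₀ s = 1 then
        Ioc ((waveSystem A).y p * ε - ε) ((waveSystem A).y p * ε)
      else Ico (-((waveSystem A).y p * ε)) (-((waveSystem A).y p * ε) + ε) := by
    intro p hp
    rw [cell, waveSign_eq hε A.disc A.bv (hw p hp), rightState_eq hε A.disc A.bv (hw p hp),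
      hsg p hp, hy p hp]
    rcases intSign_eq (ε := ε) (u₀ := u₀) s with h | h
    · rw [h, if_pos (by norm_num), if_pos rfl]; push_cast; rw [one_mul, mul_comm]
    · rw [h, if_neg (by norm_num), if_neg (by norm_num)]; push_cast
      rw [neg_one_mul, neg_mul, neg_neg, mul_comm]
  have hle : ∀ m m' : ℤ, m ≤ m' → (m : ℝ) * ε ≤ m' * ε := fun m m' hm =>
    mul_le_mul_of_nonneg_right (by exact_mod_cast hm) hε.le
  set U := ⋃ p ∈ {p | p ∈ (waveSystem A).common i s s'}, cell ε u₀ p with hU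
  have hmemU : ∀ w, w ∈ U ↔ ∃ p ∈ (waveSystem A).common i s s', w ∈ cell ε u₀ p := by
    intro w; simp [hU]
  rw [artSpeed, hK]
  simp only [← hU]
  rw [rightState_eq hε A.disc A.bv (hw r hr)]
  rcases intSign_eq (ε := ε) (u₀ := u₀) s with hσ | hσ
  · rw [if_pos (hpos.2 hσ)]
    simp only [if_pos hσ] at hcell
    have hglb : IsGLB U (((waveSystem A).y a - 1 : ℤ) * ε) := by
      constructor
      · intro w hww
        obtain ⟨p, hp, hwp⟩ := (hmemU w).1 hww
        rw [hcell p hp] at hwp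
        have := hle _ _ (hya p hp)
        push_cast
        linarith [hwp.1]
      · intro c hc
        have h3 : c ∈ lowerBounds (Ioc (((waveSystem A).y a : ℝ) * ε - ε)
            ((waveSystem A).y a * ε)) := fun w hww =>
          hc ((hmemU w).2 ⟨a, hab.1, by rw [hcell a hab.1]; exact hww⟩)
        rw [show (((waveSystem A).y a - 1 : ℤ) : ℝ) * ε = (waveSystem A).y a * ε - ε by
          push_cast; ring]
        exact (isGLB_Ioc (by linarith)).2 h3
    have hgr : IsGreatest U ((waveSystem A).y b * ε) := by
      constructor
      · refine (hmemU _).2 ⟨b, hab.2.1, ?_⟩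
        rw [hcell b hab.2.1]
        exact ⟨by linarith, le_rfl⟩
      · intro w hww
        obtain ⟨p, hp, hwp⟩ := (hmemU w).1 hww
        rw [hcell p hp] at hwp
        exact hwp.2.trans (hle _ _ (hyb p hp))
    rw [hglb.csInf_eq hgr.nonempty, hgr.csSup_eq, hF, hσ, Int.cast_one, gridFlux_one,
      ← convSpeed_eq hε (by omega) h2]
    congr 1
    rw [hy r hr, hσ, one_mul, mul_comm]
  · rw [if_neg (fun h => by rw [hpos.1 h] at hσ; norm_num at hσ)]
    have hσ' : ¬ intSign ε u₀ s = 1 := by rw [hσ]; norm_num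
    simp only [if_neg hσ'] at hcell
    have hle' : IsLeast U (-((waveSystem A).y b * ε)) := by
      constructor
      · refine (hmemU _).2 ⟨b, hab.2.1, ?_⟩
        rw [hcell b hab.2.1]
        exact ⟨le_rfl, by linarith⟩
      · intro w hww
        obtain ⟨p, hp, hwp⟩ := (hmemU w).1 hww
        rw [hcell p hp] at hwp
        exact (neg_le_neg (hle _ _ (hyb p hp))).trans hwp.1
    have hlub : IsLUB U (-(((waveSystem A).y a - 1 : ℤ) * ε)) := by
      rw [show -((((waveSystem A).y a - 1 : ℤ) : ℝ) * ε) = -((waveSystem A).y a * ε) + ε by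
        push_cast; ring]
      constructor
      · intro w hww
        obtain ⟨p, hp, hwp⟩ := (hmemU w).1 hww
        rw [hcell p hp] at hwp
        have := hle _ _ (hya p hp)
        linarith [hwp.2]
      · intro c hc
        have h3 : c ∈ upperBounds (Ico (-((waveSystem A).y a * ε))
            (-((waveSystem A).y a * ε) + ε)) := fun w hww =>
          hc ((hmemU w).2 ⟨a, hab.1, by rw [hcell a hab.1]; exact hww⟩)
        exact (isLUB_Ico (by linarith)).2 h3
    rw [hle'.csInf_eq, hlub.csSup_eq hle'.nonempty, hF, hσ,
      show ((-1 : ℤ) : ℝ) = -1 by norm_num, ← concSpeed_eq hε (by omega) h2]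
    congr 1
    rw [hy r hr, hσ]; push_cast; ring

/-- The weight of a pair of waves that have interacted. -/
theorem weight_eq (A : Admissible f ε ubar u₀) (hi : ∀ k < i, HasCollision f ε u₀ k)
    (h : (waveSystem A).Inter i s s') (hlt : s < s')
    (hab : Ext ((waveSystem A).common i s s') a b) :
    weight f ε u₀ (time f ε u₀ i) s s' = (waveSystem A).gap a b s s' /
      (ε * (((alive f ε u₀ i).filter (fun z => s ≤ z ∧ z ≤ s')).card : ℝ)) := by
  rw [weight, if_pos ((haveInteracted_iff_inter A hi).2 h),
    artSpeed_commonWaves A hi hab (WaveSystem.right_mem_common h),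
    artSpeed_commonWaves A hi hab (WaveSystem.left_mem_common h)]
  congr 1
  · exact abs_of_nonneg (WaveSystem.gap_nonneg h hlt.le hab)
  · have hc := h.card hlt.le
    have hs : s ∈ waves ε u₀ := (mem_alive.1 h.1).1
    have hs' : s' ∈ waves ε u₀ := (mem_alive.1 h.2.1).1
    rw [rightState_eq A.pos A.disc A.bv hs, rightState_eq A.pos A.disc A.bv hs',
      waveSign_eq A.pos A.disc A.bv hs]
    have e : ε * (intState ε u₀ s' : ℝ) - (ε * intState ε u₀ s - intSign ε u₀ s * ε) =
        intSign ε u₀ s * (ε * (((alive f ε u₀ i).filter (fun z => s ≤ z ∧ z ≤ s')).card : ℝ)) := by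
      have hc' : intSign ε u₀ s * intState ε u₀ s' - intSign ε u₀ s * intState ε u₀ s + 1 =
          (((alive f ε u₀ i).filter (fun z => s ≤ z ∧ z ≤ s')).card : ℤ) := by
        refine Eq.trans ?_ hc
        have : (waveSystem A).y s' = intSign ε u₀ s * intState ε u₀ s' := by
          rw [Inter.sign_eq A h]; rfl
        rw [this]; rfl
      have hm : (intSign ε u₀ s : ℝ) * intSign ε u₀ s = 1 := by
        exact_mod_cast intSign_mul_self s
      rw [← Int.cast_natCast, ← hc']
      push_cast
      linear_combination (ε * intState ε u₀ s - ε * intState ε u₀ s') * hm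
    have habs : |(intSign ε u₀ s : ℝ)| = 1 := by
      rcases intSign_eq (ε := ε) (u₀ := u₀) s with h | h <;> rw [h] <;> norm_num
    rw [e, abs_mul, habs, one_mul]
    exact abs_of_nonneg (mul_nonneg A.pos.le (Nat.cast_nonneg _))

theorem weight_nonneg : 0 ≤ weight f ε u₀ (time f ε u₀ i) s s' := by
  rw [weight]
  split_ifs
  · positivity
  · exact secondDerivNorm_nonneg

/-! ### Cancellations -/

theorem IsConfig.exists_jump_eq {σ n : ℕ → ℤ} {W : Finset ℕ} {x : ℕ → ℝ} {v : ℝ → ℝ}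
    (h : IsConfig ε σ n W x v) (hε : 0 < ε) (hs : s ∈ W) :
    ∃ c : ℝ, 0 < c ∧ jump v (x s) = c * σ s := by
  obtain ⟨a, b, hc⟩ := IsConfig.exists_class (x := x) hs
  have hab := h.y_le hc.2.1 hc.2.2.1 (hc.2.2.2.2.2 a hc.2.1 hc.2.2.2.1).2
    (hc.2.2.2.1.trans hc.2.2.2.2.1.symm)
  rw [h.sign_eq a hc.2.1 s hs hc.2.2.2.1, h.sign_eq b hc.2.2.1 s hs hc.2.2.2.2.1] at hab
  refine ⟨ε * ((σ s * n b - σ s * n a + 1 : ℤ) : ℝ), mul_pos hε ?_, ?_⟩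
  · exact_mod_cast (by omega : 0 < σ s * n b - σ s * n a + 1)
  · rw [jump, h.right_class hc, h.leftLim_class hc, ← mul_sub, mul_assoc, ← Int.cast_mul,
      ← Int.cast_sub]
    congr 2
    rcases h.sign s hs with h1 | h1 <;> rw [h1] <;> ring

/-- At a cancellation point the colliding fronts have opposite signs. -/
theorem IsCancellation.sign_ne (A : Admissible f ε ubar u₀) (hj : IsCancellation f ε u₀ j)
    {zl zr : ℕ} (hcol : IsConfig.IsCollision (alive f ε u₀ j) (place f ε u₀ j) (speed f ε u₀ j)
        (nextDelay f ε (profile f ε u₀ j)) (collisionPoint f ε u₀ j) zl zr) :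
    intSign ε u₀ zl ≠ intSign ε u₀ zr := by
  intro he
  have hcfg := isConfig A j
  have hfr := hcfg.fronts_eq (f := f) A.pos
  have key : ∀ p ∈ collidingFronts f ε (profile f ε u₀ j),
      ∃ c : ℝ, 0 < c ∧ jump (profile f ε u₀ j) p.1 = c * intSign ε u₀ zl := by
    rintro p ⟨hp, q, hq, hne, hpq⟩
    rw [hfr] at hp hq
    obtain ⟨z, hz, rfl⟩ := hp
    obtain ⟨z', hz', rfl⟩ := hq
    obtain ⟨c, hc, hjump⟩ := hcfg.exists_jump_eq A.pos hz
    refine ⟨c, hc, ?_⟩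
    rw [hjump]
    congr 2
    rcases hcol.only z hz z' hz' hpq with h | h
    · exact absurd (Prod.ext h.1 h.2) hne
    · rcases hcol.front z hz h.1 with h1 | h1
      · exact hcfg.sign_eq z hz zl hcol.left_mem h1.1
      · rw [he]; exact hcfg.sign_eq z hz zr hcol.right_mem h1.1
  obtain ⟨-, p, hp, q, hq, hlt⟩ := hj
  obtain ⟨c, hc, h1⟩ := key p hp
  obtain ⟨c', hc', h2⟩ := key q hq
  have hm : (intSign ε u₀ zl : ℝ) * intSign ε u₀ zl = 1 := by exact_mod_cast intSign_mul_self zl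
  rw [h1, h2, show c * (intSign ε u₀ zl : ℝ) * (c' * intSign ε u₀ zl) =
    c * c' * (intSign ε u₀ zl * intSign ε u₀ zl) by ring, hm, mul_one] at hlt
  exact absurd (mul_pos hc hc') (not_lt.2 hlt.le)

/-- A cancellation point is a cancellation in the sense of systems of waves. A removed wave cannot
have interacted with waves in or beyond the other colliding front, which has the opposite sign. -/
theorem IsCancellation.exists_cancels (A : Admissible f ε ubar u₀) (hj : IsCancellation f ε u₀ j) :
    ∃ zl zr, (waveSystem A).Cancels j zl zr ∧
      ((∀ s ∈ alive f ε u₀ (j + 1), ¬ (waveSystem A).SameFront j s zr) ∨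
        (∀ s ∈ alive f ε u₀ (j + 1), ¬ (waveSystem A).SameFront j s zl)) := by
  have hcfg := isConfig A j
  obtain ⟨zl, zr, hcol, hstep⟩ := exists_collisionStep A hcfg hj.1
  have hne := hj.sign_ne A hcol
  set p : ℕ → ℝ := fun q => place f ε u₀ j q + speed f ε u₀ j q *
    nextDelay f ε (profile f ε u₀ j) with hp
  have hmono : MonotoneOn p (alive f ε u₀ j) :=
    hcfg.move_mono (f := f) A.pos nextDelay_nonneg le_rfl
  have hone := hstep.one hne
  have hsub := hstep.sub
  have hxlt : ∀ {q q'}, q ∈ alive f ε u₀ j → q' ∈ alive f ε u₀ j →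
      place f ε u₀ j q < place f ε u₀ j q' → q < q' := by
    intro q q' hq hq' hlt
    by_contra! hle
    exact absurd hlt (not_lt.2 (hcfg.mono hq' hq hle))
  -- a wave that starts between the colliding fronts arrives at the collision point if a wave `r`
  -- beyond it does so
  have hpc : ∀ q ∈ alive f ε u₀ j, place f ε u₀ j zl ≤ place f ε u₀ j q →
      place f ε u₀ j q ≤ place f ε u₀ j zr → ∀ r ∈ alive f ε u₀ j, p r = collisionPoint f ε u₀ j →
      ((r ≤ q ∧ place f ε u₀ j q < place f ε u₀ j zr) ∨
        (q ≤ r ∧ place f ε u₀ j zl < place f ε u₀ j q)) → p q = collisionPoint f ε u₀ j := by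
    rintro q hq h1 h2 r hr hpr (⟨h3, h4⟩ | ⟨h3, h4⟩)
    · have h5 := hmono hr hq h3
      have h6 := hmono hq hcol.right_mem (hxlt hq hcol.right_mem h4).le
      have h7 : p zr = collisionPoint f ε u₀ j := hcol.right_eq
      linarith
    · have h5 := hmono hq hr h3
      have h6 := hmono hcol.left_mem hq (hxlt hcol.left_mem hq h4).le
      have h7 : p zl = collisionPoint f ε u₀ j := hcol.left_eq
      linarith
  refine ⟨zl, zr, ⟨hcol.left_mem, hcol.right_mem, hcol.lt, ?_, ?_, ?_, ?_⟩, hone⟩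
  · exact fun r hr hr' => hcol.front r hr (hstep.removed r hr hr')
  · intro r hr hr' hf s hs hi
    have hsj := hsub hs
    have hpr := hstep.removed r hr hr'
    by_contra! hle
    have hrs : r < s := lt_of_le_of_ne hle fun h => hr' (h ▸ hs)
    have hxr : place f ε u₀ j r = place f ε u₀ j zl := hf.1
    have hx1 : place f ε u₀ j zl ≤ place f ε u₀ j s := hxr ▸ hcfg.mono hr hsj hle
    have hsr := Inter.sign_eq A hi
    have hrl : intSign ε u₀ r = intSign ε u₀ zl := hcfg.sign_eq r hr zl hcol.left_mem hxr
    rcases lt_trichotomy (place f ε u₀ j s) (place f ε u₀ j zr) with h1 | h1 | h1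
    · have hps := hpc s hsj hx1 h1.le r hr hpr (Or.inl ⟨hle, h1⟩)
      rcases hcol.front s hsj hps with h2 | h2
      · exact absurd (hstep.left_lt hne r hr hr' hf s hs h2) (not_lt.2 hle)
      · exact h1.ne h2.1
    · exact hne (hrl ▸ hsr.trans (hcfg.sign_eq s hsj zr hcol.right_mem h1))
    · have h2 := hi.btw hr hcol.right_mem le_rfl hle
        (hxlt hr hcol.right_mem (hxr ▸ hcol.lt)).le (hxlt hcol.right_mem hsj h1).le
      exact hne (hrl ▸ Inter.sign_eq A h2)
  · intro r hr hr' hf s hs hi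
    have hsj := hsub hs
    have hpr := hstep.removed r hr hr'
    by_contra! hle
    have hxr : place f ε u₀ j r = place f ε u₀ j zr := hf.1
    have hx1 : place f ε u₀ j s ≤ place f ε u₀ j zr := hxr ▸ hcfg.mono hsj hr hle
    have hsr := Inter.sign_eq A hi
    have hrl : intSign ε u₀ r = intSign ε u₀ zr := hcfg.sign_eq r hr zr hcol.right_mem hxr
    rcases lt_trichotomy (place f ε u₀ j zl) (place f ε u₀ j s) with h1 | h1 | h1
    · have hps := hpc s hsj h1.le hx1 r hr hpr (Or.inr ⟨hle, h1⟩)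
      rcases hcol.front s hsj hps with h2 | h2
      · exact h1.ne h2.1.symm
      · exact absurd (hstep.right_lt hne r hr hr' hf s hs h2) (not_lt.2 hle)
    · exact hne ((hcfg.sign_eq s hsj zl hcol.left_mem h1.symm).symm.trans (hsr.symm.trans hrl))
    · have h2 := hi.symm.btw hcol.left_mem hr (hxlt hsj hcol.left_mem h1).le
        (hxlt hcol.left_mem hr (hxr ▸ hcol.lt)).le hle le_rfl
      exact hne ((Inter.sign_eq A h2).trans hrl)
  · intro s hs s' hs' hx
    change place f ε u₀ (j + 1) s = place f ε u₀ (j + 1) s' at hx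
    rw [place_succ A hs, place_succ A hs'] at hx
    rcases hcol.only s (hsub hs) s' (hsub hs') hx with h | ⟨h1, h2⟩
    · exact h
    · rcases hcol.front s (hsub hs) h1 with h3 | h3 <;>
        rcases hcol.front s' (hsub hs') h2 with h4 | h4
      · exact ⟨h3.1.trans h4.1.symm, h3.2.trans h4.2.symm⟩
      · rcases hone with h5 | h5
        · exact absurd h4 (h5 s' hs')
        · exact absurd h3 (h5 s hs)
      · rcases hone with h5 | h5
        · exact absurd h3 (h5 s hs)
        · exact absurd h4 (h5 s' hs')
      · exact ⟨h3.1.trans h4.1.symm, h3.2.trans h4.2.symm⟩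

end WFT

namespace WFT

/-! ### Total variation in terms of waves -/

namespace IsConfig

variable {ε : ℝ} {σ n : ℕ → ℤ} {W : Finset ℕ} {x : ℕ → ℝ} {v : ℝ → ℝ}

theorem eVariationOn_le (h : IsConfig ε σ n W x v) (hε : 0 < ε) :
    eVariationOn v univ ≤ ENNReal.ofReal (ε * W.card) := by
  set N : ℝ → ℝ := fun z => ε * ((W.filter (fun q => x q ≤ z)).card : ℝ) with hN
  have hle : ∀ {y z}, y ≤ z → edist (v z) (v y) ≤ ENNReal.ofReal (N z - N y) := by
    intro y z hyz
    have hsub : W.filter (fun q => x q ≤ y) ⊆ W.filter (fun q => x q ≤ z) :=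
      fun q hq => by
        rw [Finset.mem_filter] at hq ⊢
        exact ⟨hq.1, hq.2.trans hyz⟩
    rw [edist_dist, Real.dist_eq, h.profile, h.profile, ← mul_sub, abs_mul, abs_of_pos hε,
      ← Int.cast_sub, ← Finset.sum_sdiff hsub, add_sub_cancel_right, hN]
    refine ENNReal.ofReal_le_ofReal ?_
    rw [← mul_sub, ← Nat.cast_sub (Finset.card_le_card hsub), ← Finset.card_sdiff_of_subset hsub]
    refine mul_le_mul_of_nonneg_left ?_ hε.le
    rw [← Int.cast_abs, ← Int.cast_natCast, Int.cast_le]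
    refine (Finset.abs_sum_le_sum_abs _ _).trans ?_
    refine (Finset.sum_le_card_nsmul _ _ 1 fun q hq => ?_).trans (by simp)
    rcases h.sign q (Finset.mem_filter.1 (Finset.mem_sdiff.1 hq).1).1 with h1 | h1 <;>
      rw [h1] <;> norm_num
  have hmono : Monotone N := fun y z hyz => by
    refine mul_le_mul_of_nonneg_left ?_ hε.le
    refine Nat.cast_le.2 (Finset.card_le_card fun q hq => ?_)
    rw [Finset.mem_filter] at hq ⊢
    exact ⟨hq.1, hq.2.trans hyz⟩
  refine iSup_le fun p => ?_
  obtain ⟨m, u, hu, -⟩ := p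
  calc ∑ i ∈ Finset.range m, edist (v (u (i + 1))) (v (u i))
      ≤ ∑ i ∈ Finset.range m, ENNReal.ofReal (N (u (i + 1)) - N (u i)) :=
        Finset.sum_le_sum fun i _ => hle (hu i.le_succ)
    _ = ENNReal.ofReal (∑ i ∈ Finset.range m, (N (u (i + 1)) - N (u i))) :=
        (ENNReal.ofReal_sum_of_nonneg fun i _ => sub_nonneg.2 (hmono (hu i.le_succ))).symm
    _ ≤ ENNReal.ofReal (ε * W.card) := by
        refine ENNReal.ofReal_le_ofReal ?_
        rw [Finset.sum_range_sub (fun i => N (u i))]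
        have h1 : 0 ≤ N (u 0) := mul_nonneg hε.le (Nat.cast_nonneg _)
        have h2 : N (u m) ≤ ε * W.card :=
          mul_le_mul_of_nonneg_left (Nat.cast_le.2 (Finset.card_filter_le _ _)) hε.le
        linarith

/-- Waves at the same position have the same sign, so they add up in the jump there. -/
theorem le_eVariationOn_Iic (h : IsConfig ε σ n W x v) (hε : 0 < ε) (m : ℕ) : ∀ c : ℝ,
    (W.filter (fun q => x q ≤ c)).card = m →
      ENNReal.ofReal (ε * m) ≤ eVariationOn v (Iic c) := by
  induction m using Nat.strong_induction_on with
  | _ m ih =>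
    intro c hc
    rcases Nat.eq_zero_or_pos m with rfl | hm
    · simp
    obtain ⟨_, b, -, hb, hbmax⟩ := exists_ext (Finset.card_pos.1 (hc ▸ hm))
    rw [Finset.mem_filter] at hb
    have hξ : ∀ q ∈ W, x q ≤ c → x q ≤ x b := fun q hq hqc =>
      h.mono hq hb.1 (hbmax q (Finset.mem_filter.2 ⟨hq, hqc⟩)).2
    obtain ⟨y, hy, hyq⟩ : ∃ y < x b, ∀ q ∈ W, x q < x b → x q ≤ y := by
      have h1 : ∀ᶠ y in 𝓝[<] x b, ∀ q ∈ W, x q < x b → x q ≤ y := by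
        rw [Filter.eventually_all_finset]
        intro q _
        rcases lt_or_ge (x q) (x b) with hq | hq
        · filter_upwards [Ioo_mem_nhdsLT hq] with y hy _ using hy.1.le
        · exact Eventually.of_forall fun y hlt => absurd hq (not_le.2 hlt)
      obtain ⟨y, h2, h3⟩ := (h1.and self_mem_nhdsWithin).exists
      exact ⟨y, h3, h2⟩
    set X := W.filter (fun q => x q = x b) with hX
    have hsplit : ∀ c', x b ≤ c' → c' ≤ c → W.filter (fun q => x q ≤ c') =
        W.filter (fun q => x q ≤ y) ∪ X := by
      intro c' h1 h2
      ext q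
      simp only [hX, Finset.mem_filter, Finset.mem_union, ← and_or_left, and_congr_right_iff]
      intro hq
      constructor
      · intro h3
        rcases (hξ q hq (h3.trans h2)).eq_or_lt with h4 | h4
        · exact Or.inr h4
        · exact Or.inl (hyq q hq h4)
      · rintro (h3 | h3)
        · exact h3.trans (hy.le.trans h1)
        · exact h3.trans_le h1
    have hdisj : Disjoint (W.filter (fun q => x q ≤ y)) X := by
      rw [Finset.disjoint_left]
      intro q h1 h2
      rw [Finset.mem_filter] at h1 h2
      linarith [h1.2, h2.2]
    have hcard : (W.filter (fun q => x q ≤ y)).card + X.card = m := by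
      rw [← hc, hsplit c hb.2 le_rfl, Finset.card_union_of_disjoint hdisj]
    have hX0 : 0 < X.card := Finset.card_pos.2 ⟨b, by simp [hX, hb.1]⟩
    have hjump : edist (v y) (v (x b)) = ENNReal.ofReal (ε * X.card) := by
      rw [edist_comm, edist_dist, Real.dist_eq, h.profile, h.profile, hsplit _ le_rfl hb.2,
        Finset.sum_union hdisj, ← mul_sub, abs_mul, abs_of_pos hε, ← Int.cast_sub,
        add_sub_cancel_left, Finset.sum_congr rfl fun q hq =>
          h.sign_eq q (Finset.mem_filter.1 hq).1 b hb.1 (Finset.mem_filter.1 hq).2]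
      congr 2
      rw [← Int.cast_abs, Finset.sum_const, nsmul_eq_mul, abs_mul]
      rcases h.sign b hb.1 with h1 | h1 <;> rw [h1] <;> simp [hX]
    calc ENNReal.ofReal (ε * m)
        = ENNReal.ofReal (ε * (W.filter (fun q => x q ≤ y)).card) +
            ENNReal.ofReal (ε * X.card) := by
          rw [← ENNReal.ofReal_add (by positivity) (by positivity), ← mul_add, ← hcard]
          push_cast; rfl
      _ ≤ eVariationOn v (Iic y) + eVariationOn v (Icc y (x b)) :=
          add_le_add (ih _ (by omega) y rfl) (hjump ▸ eVariationOn.edist_le v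
            (left_mem_Icc.2 hy.le) (right_mem_Icc.2 hy.le))
      _ ≤ eVariationOn v (Iic y ∪ Icc y (x b)) :=
          eVariationOn.add_le_union v fun a ha b hb => le_trans ha hb.1
      _ ≤ eVariationOn v (Iic c) := eVariationOn.mono v (by
          rw [Iic_union_Icc_eq_Iic hy.le]; exact Iic_subset_Iic.2 hb.2)

/-- The total variation is `ε` times the number of waves. -/
theorem totVar_eq (h : IsConfig ε σ n W x v) (hε : 0 < ε) : totVar v = ε * W.card := by
  have h1 : ∃ c, W.filter (fun q => x q ≤ c) = W := by
    obtain ⟨c, hc⟩ := (W.finite_toSet.image x).bddAbove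
    exact ⟨c, Finset.filter_true_of_mem fun q hq => hc ⟨q, hq, rfl⟩⟩
  obtain ⟨c, hc⟩ := h1
  have h2 := (h.le_eVariationOn_Iic hε _ c (by rw [hc])).trans
    (eVariationOn.mono v (subset_univ _))
  rw [totVar, le_antisymm (h.eVariationOn_le hε) h2, ENNReal.toReal_ofReal (by positivity)]

end IsConfig

end WFT

namespace WFT

/-! ### The estimate for the functional -/

variable {f : ℝ → ℝ} {ε : ℝ} {ubar u₀ : ℝ → ℝ} {j : ℕ}

/-- The amount of cancellation is `ε` times the number of removed waves. -/
theorem cancellation_eq (A : Admissible f ε ubar u₀) (hj : HasCollision f ε u₀ j) :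
    cancellation f ε u₀ j = ε * ((alive f ε u₀ j \ alive f ε u₀ (j + 1)).card : ℝ) := by
  rw [cancellation, sol_time A fun k hk => hj.of_le A hk.le,
    sol_time A fun k hk => hj.of_le A (Nat.lt_succ_iff.1 hk), (isConfig A j).totVar_eq A.pos,
    (isConfig A (j + 1)).totVar_eq A.pos, Finset.card_sdiff_of_subset alive_succ_subset,
    Nat.cast_sub (Finset.card_le_card alive_succ_subset)]
  ring

theorem card_alive_le (A : Admissible f ε ubar u₀) (hubar : BoundedVariationOn ubar univ) (i : ℕ) :
    ε * ((alive f ε u₀ i).card : ℝ) ≤ totVar ubar := by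
  calc ε * ((alive f ε u₀ i).card : ℝ) ≤ ε * ((waves ε u₀).card : ℝ) :=
        mul_le_mul_of_nonneg_left
          (Nat.cast_le.2 (Finset.card_le_card fun s hs => (mem_alive.1 hs).1)) A.pos.le
    _ = totVar u₀ := ((isConfig_initial A.pos A.disc A.bv).totVar_eq A.pos).symm
    _ ≤ totVar ubar := ENNReal.toReal_mono hubar A.disc.variation_le

/-- The growth of the weights at a cancellation is controlled by the increments of a monotone
function on the remaining waves, whose oscillation is proportional to the amount of cancellation. -/
theorem IsCancellation.exists_weight_sub_le (A : Admissible f ε ubar u₀) (hf : ContDiff ℝ 2 f)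
    (hf2 : BddAbove (range fun u : ℝ => |iteratedDeriv 2 f u|)) (hj : IsCancellation f ε u₀ j) :
    ∃ h : ℕ → ℝ, MonotoneOn h (alive f ε u₀ (j + 1)) ∧
      (∀ s ∈ alive f ε u₀ (j + 1), ∀ s' ∈ alive f ε u₀ (j + 1),
        h s' - h s ≤ secondDerivNorm f * cancellation f ε u₀ j) ∧
      ∀ s ∈ alive f ε u₀ (j + 1), ∀ s' ∈ alive f ε u₀ (j + 1), s < s' →
        weight f ε u₀ (time f ε u₀ (j + 1)) s s' - weight f ε u₀ (time f ε u₀ j) s s' ≤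
          (h s' - h s) /
            (ε * (((alive f ε u₀ (j + 1)).filter (fun z => s ≤ z ∧ z ≤ s')).card : ℝ)) := by
  have hε := A.pos
  have hc0 : ∀ k < j, HasCollision f ε u₀ k := fun k hk => hj.1.of_le A hk.le
  have hc1 : ∀ k < j + 1, HasCollision f ε u₀ k := fun k hk =>
    hj.1.of_le A (Nat.lt_succ_iff.1 hk)
  obtain ⟨zl, zr, hC, hone⟩ := hj.exists_cancels A
  obtain ⟨h, hmono, hosc, hgap⟩ := hC.exists_monotoneOn hone
    (mul_nonneg secondDerivNorm_nonneg hε.le) fun s => slopeLip_gridFlux hf hf2 hε (by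
      rcases intSign_eq (ε := ε) (u₀ := u₀) s with h | h <;> rw [h] <;> norm_num)
  refine ⟨h, hmono, fun s hs s' hs' => ?_, fun s hs s' hs' hlt => ?_⟩
  · rw [cancellation_eq A hj.1, ← mul_assoc]
    exact hosc s hs s' hs'
  by_cases hI : (waveSystem A).Inter (j + 1) s s'
  · have hI0 : (waveSystem A).Inter j s s' := (hC.inter_iff hs hs').1 hI
    obtain ⟨a, b, hab⟩ := exists_ext ⟨s, WaveSystem.left_mem_common hI0⟩
    obtain ⟨a', b', hab'⟩ := exists_ext ⟨s, WaveSystem.left_mem_common hI⟩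
    have hcard : ((alive f ε u₀ j).filter (fun z => s ≤ z ∧ z ≤ s')).card =
        ((alive f ε u₀ (j + 1)).filter (fun z => s ≤ z ∧ z ≤ s')).card := by
      have h1 := hI0.card hlt.le
      rw [hI.card hlt.le] at h1
      exact_mod_cast h1.symm
    rw [weight_eq A hc1 hI hlt hab', weight_eq A hc0 hI0 hlt hab, hcard, ← sub_div]
    exact div_le_div_of_nonneg_right (hgap s hs s' hs' hlt hI0 a b a' b' hab hab')
      (mul_nonneg hε.le (Nat.cast_nonneg _))
  · have hI0 : ¬ (waveSystem A).Inter j s s' := fun h0 => hI ((hC.inter_iff hs hs').2 h0)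
    rw [weight, weight, if_neg (fun h1 => hI ((haveInteracted_iff_inter A hc1).1 h1)),
      if_neg (fun h1 => hI0 ((haveInteracted_iff_inter A hc0).1 h1)), sub_self]
    exact div_nonneg (sub_nonneg.2 (hmono hs hs' hlt.le)) (mul_nonneg hε.le (Nat.cast_nonneg _))

end WFT

theorem mainTheorem4 (f : ℝ → ℝ) (hf : ContDiff ℝ 2 f)
    (hf2 : BddAbove (Set.range fun u : ℝ => |iteratedDeriv 2 f u|))
    (ε : ℝ) (hε : 0 < ε)
    (ubar : ℝ → ℝ) (hubar : BoundedVariationOn ubar Set.univ)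
    (u₀ : ℝ → ℝ) (hu₀ : WFT.IsDiscretization ε ubar u₀)
    (hbin : ∀ i : ℕ, WFT.HasCollision f ε u₀ i → WFT.IsBinaryCollision f ε u₀ i)
    (j : ℕ) (hj : WFT.IsCancellation f ε u₀ j) :
    WFT.Q f ε u₀ (WFT.time f ε u₀ (j + 1)) - WFT.Q f ε u₀ (WFT.time f ε u₀ j) ≤
      Real.log 2 * WFT.secondDerivNorm f * WFT.totVar ubar * WFT.cancellation f ε u₀ j := by
  have A : WFT.Admissible f ε ubar u₀ := ⟨hε, hu₀, hu₀.boundedVariationOn hubar, hbin⟩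
  obtain ⟨h, hmono, hosc, hw⟩ := hj.exists_weight_sub_le A hf hf2
  set W := WFT.alive f ε u₀ j with hW
  set W' := WFT.alive f ε u₀ (j + 1) with hW'
  have hsub : W' ⊆ W := WFT.alive_succ_subset
  set H := WFT.secondDerivNorm f * WFT.cancellation f ε u₀ j with hH
  have hH0 : 0 ≤ H := by
    rw [hH, WFT.cancellation_eq A hj.1]
    exact mul_nonneg WFT.secondDerivNorm_nonneg (mul_nonneg hε.le (Nat.cast_nonneg _))
  rw [WFT.Q, WFT.Q, WFT.realWaves_time A fun k hk => hj.1.of_le A hk.le,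
    WFT.realWaves_time A fun k hk => hj.1.of_le A (Nat.lt_succ_iff.1 hk), ← hW, ← hW']
  calc _ ≤ ∑ p ∈ (W' ×ˢ W').filter (fun p => p.1 < p.2),
          WFT.weight f ε u₀ (WFT.time f ε u₀ (j + 1)) p.1 p.2 * ε * ε -
        ∑ p ∈ (W' ×ˢ W').filter (fun p => p.1 < p.2),
          WFT.weight f ε u₀ (WFT.time f ε u₀ j) p.1 p.2 * ε * ε := by
        -- the pairs containing a removed wave only decrease the functional
        refine sub_le_sub_left (Finset.sum_le_sum_of_subset_of_nonneg
          (Finset.filter_subset_filter _ (Finset.product_subset_product hsub hsub))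
          fun p _ _ => ?_) _
        exact mul_nonneg (mul_nonneg WFT.weight_nonneg hε.le) hε.le
    _ ≤ ∑ p ∈ (W' ×ˢ W').filter (fun p => p.1 < p.2),
          ε * ((h p.2 - h p.1) / ((W'.filter (fun z => p.1 ≤ z ∧ z ≤ p.2)).card : ℝ)) := by
        rw [← Finset.sum_sub_distrib]
        refine Finset.sum_le_sum fun p hp => ?_
        rw [Finset.mem_filter, Finset.mem_product] at hp
        have h1 := mul_le_mul_of_nonneg_right (hw p.1 hp.1.1 p.2 hp.1.2 hp.2)
          (mul_nonneg hε.le hε.le)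
        have h2 : (h p.2 - h p.1) / (ε * ((W'.filter (fun z => p.1 ≤ z ∧ z ≤ p.2)).card : ℝ)) *
            (ε * ε) = ε * ((h p.2 - h p.1) /
              ((W'.filter (fun z => p.1 ≤ z ∧ z ≤ p.2)).card : ℝ)) := by
          rw [mul_comm ε (Nat.cast _), ← div_div, ← mul_assoc, div_mul_cancel₀ _ hε.ne', mul_comm]
        rw [← h2]
        linarith
    _ ≤ ε * (H * W'.card * Real.log 2) := by
        rw [← Finset.mul_sum]
        exact mul_le_mul_of_nonneg_left (WFT.sum_pairs_le W' h H hmono hosc) hε.le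
    _ = Real.log 2 * H * (ε * W'.card) := by ring
    _ ≤ Real.log 2 * H * WFT.totVar ubar :=
        mul_le_mul_of_nonneg_left (WFT.card_alive_le A hubar (j + 1))
          (mul_nonneg (Real.log_nonneg (by norm_num)) hH0)
    _ = Real.log 2 * WFT.secondDerivNorm f * WFT.totVar ubar *
          WFT.cancellation f ε u₀ j := by rw [hH]; ring
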